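/- Let $\Omega\subset\mathbb{R}^d$ be compact and convex with non-empty interior $\Omega^\circ$, and let $p_0,p_1$ be probability densities that vanish off $\Omega$ and are continuous and bounded away from zero on $\Omega$. For functions $p,q$ on $\Omega$ put $$\omega_{p,q}(\eta)=\sup_{z,z'\in\Omega,\ \|z-z'\|\le\eta}\max\Big\{\Big|\tfrac{p(z)}{p(z')}-1\Big|,\Big|\tfrac{q(z)}{q(z')}-1\Big|\Big\},\qquad S_t(z)=\{\delta\in\mathbb{R}^d:\ z-t\delta\in\Omega,\ z+(1-t)\delta\in\Omega\},$$ $$v_{p,q}(t,z)=\frac{\int_{S_t(z)}\delta\,p(z-t\delta)\,q(z+(1-t)\delta)\,d\delta}{\int_{S_t(z)}p(z-t\delta)\,q(z+(1-t)\delta)\,d\delta}\qquad(t\in[0,1],\ z\in\Omega^\circ).$$ Let $v=v_{p_0,p_1}$, so that $v(t,z)=\mathbb{E}[X_1-X_0\mid(1-t)X_0+tX_1=z]$ for independent $X_0\sim p_0$, $X_1\sim p_1$. Assume that $\omega_{p_0,p_1}(\eta)\le L\eta$ for some $L<\infty$ and all $\eta>0$. Let $\widehat p_0=\widehat p_{0,n}$,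 $\widehat p_1=\widehat p_{1,n}$ be estimators (random functions on $\Omega$), and let $G_n$ be the event that $\omega_{\widehat p_0,\widehat p_1}(\eta)\le L_n\eta$ for some (possibly random) $L_n<\infty$ and all $\eta>0$; assume $\mathbb{P}(G_n)\to1$. Let $\widehat v^{\mathrm{den}}=v_{\widehat p_0,\widehat p_1}$ and $$r_n=\sup_{x\in\Omega}\max_{j=0,1}\Big|\ln\frac{\widehat p_j(x)}{p_j(x)}\Big|,\qquad s_n=\operatorname*{ess\,sup}_{x\in\Omega^\circ}\max_{j=0,1}\big\|\nabla\log\widehat p_j(x)-\nabla\log p_j(x)\big\|,$$ with $r_n=\infty$ if some $\widehat p_j$ is not positive on $\Omega$. For $x\in\Omega^\circ$ let $\mathfrak R(\cdot,x)$ and $\widehat{\mathfrak R}(\cdot,x)$ be the solutions, with values in $\Omega^\circ$ for $t\in[0,1)$, of $$\mathfrak R(t,x)=x+\int_0^t v(s,\mathfrak R(s,x))\,ds,\qquad \widehat{\mathfrak R}(t,x)=x+\int_0^t\widehat v^{\mathrm{den}}(s,\widehat{\mathfrak R}(s,x))\,ds,\qquad t\in[0,1].$$ Fix $x\in\Omega$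 such that $\mathrm{dist}(x,\partial\Omega)>0$, $\mathrm{dist}(\mathfrak R(1,x),\partial\Omega)>0$, and the set of $t\in[0,1]$ for which $z\mapsto v(t,z)$ is not differentiable at $\mathfrak R(t,x)$ is Lebesgue-null. Then the following hold. 1. $\mathfrak R(\cdot,x)$ exists and is unique; on $G_n$, $\widehat{\mathfrak R}(\cdot,x)$ exists and is unique; and $z\mapsto v(s,z)$ is differentiable at $\mathfrak R(s,x)$ for almost every $s\in[0,1]$. Write $\partial_zv(s,\mathfrak R(s,x))$ for the derivative (the Jacobian matrix). 2. The equation $\Phi(t)=I+\int_0^t\partial_zv(s,\mathfrak R(s,x))\,\Phi(s)\,ds$, $t\in[0,1]$, has a unique solution $\Phi:[0,1]\to\mathbb{R}^{d\times d}$, and $\Phi(t)$ is invertible for every $t$. On $G_n$ the equation $$\widetilde E(t,x)=\int_0^t\{\widehat v^{\mathrm{den}}(s,\mathfrak R(s,x))-v(s,\mathfrak R(s,x))\}\,ds+\int_0^t\partial_zv(s,\mathfrak R(s,x))\,\widetilde E(s,x)\,ds,\qquad t\in[0,1],$$ has a unique solution, namely $$\widetilde E(t,x)=\Phi(t)\int_0^t\Phi(s)^{-1}\{\widehat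 v^{\mathrm{den}}(s,\mathfrak R(s,x))-v(s,\mathfrak R(s,x))\}\,ds.$$ 3. If $r_n+s_n=o_p(1)$ as $n\to\infty$, then $$\sup_{t\in[0,1]}\big\|\widehat{\mathfrak R}(t,x)-\mathfrak R(t,x)-\widetilde E(t,x)\big\|=o_p\Big(\sup_{t\in[0,1]}\|\widetilde E(t,x)\|\Big),$$ where $A_n=o_p(B_n)$ means that $\mathbb{P}(A_n>\varepsilon B_n)\to0$ for every $\varepsilon>0$. -/

import Mathlib

open MeasureTheory Set Filter Topology
open scoped ENNReal NNReal

namespace RectifiedFlow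

/-- `p` is a probability density with respect to Lebesgue measure that vanishes off `Ω`, is
continuous on `Ω` and is bounded away from zero on `Ω`. (Boundedness from above on a compact `Ω`
is a consequence.) -/
structure IsDensityOn {d : ℕ} (Ω : Set (EuclideanSpace ℝ (Fin d)))
    (p : EuclideanSpace ℝ (Fin d) → ℝ) : Prop where
  eq_zero_of_notMem : ∀ x ∉ Ω, p x = 0
  continuousOn : ContinuousOn p Ω
  bounded_below : ∃ c > 0, ∀ x ∈ Ω, c ≤ p x
  integral_eq_one : ∫ x, p x = 1

/-- `S_t(z)`, the set of all `δ` with `z - tδ ∈ Ω` and `z + (1-t)δ ∈ Ω`. -/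
def admissible {d : ℕ} (Ω : Set (EuclideanSpace ℝ (Fin d))) (t : ℝ)
    (z : EuclideanSpace ℝ (Fin d)) : Set (EuclideanSpace ℝ (Fin d)) :=
  {δ | z - t • δ ∈ Ω ∧ z + (1 - t) • δ ∈ Ω}

/-- The velocity field on `[0,1] × Ω°` that belongs to a pair `p, q` of functions on `Ω`:
`∫_{S_t(z)} δ p(z-tδ) q(z+(1-t)δ) dδ / ∫_{S_t(z)} p(z-tδ) q(z+(1-t)δ) dδ`.
For densities `p, q` it is the pointwise version of `E[X₁ - X₀ | (1-t)X₀ + tX₁ = z]` with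
independent `X₀ ∼ p`, `X₁ ∼ q`; for estimated densities it is the plug-in estimator. The values
of `p` and `q` off `Ω` play no role. -/
noncomputable def velocity {d : ℕ} (Ω : Set (EuclideanSpace ℝ (Fin d)))
    (p q : EuclideanSpace ℝ (Fin d) → ℝ) (t : ℝ) (z : EuclideanSpace ℝ (Fin d)) :
    EuclideanSpace ℝ (Fin d) :=
  (∫ δ in admissible Ω t z, p (z - t • δ) * q (z + (1 - t) • δ))⁻¹ •
    ∫ δ in admissible Ω t z, (p (z - t • δ) * q (z + (1 - t) • δ)) • δ

/-- `y` is, on `[0,1]`, a Carathéodory solution of `y' = v(t, y)`, `y(0) = x`. As `v` is a field on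
`[0,1] × Ω°`, a solution stays in `Ω°` at all times before `1`. -/
structure IsSolution {d : ℕ} (Ω : Set (EuclideanSpace ℝ (Fin d)))
    (v : ℝ → EuclideanSpace ℝ (Fin d) → EuclideanSpace ℝ (Fin d))
    (x : EuclideanSpace ℝ (Fin d)) (y : ℝ → EuclideanSpace ℝ (Fin d)) : Prop where
  mem_interior : ∀ t ∈ Ico (0 : ℝ) 1, y t ∈ interior Ω
  integrable : IntervalIntegrable (fun s => v s (y s)) volume 0 1
  eq_integral : ∀ t ∈ Icc (0 : ℝ) 1, y t = x + ∫ s in (0 : ℝ)..t, v s (y s)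

open Classical in
/-- The flow `t ↦ ℜ(t, x)` of the field `v`: the solution that starts at `x` (and the constant
path if there is none). -/
noncomputable def flow {d : ℕ} (Ω : Set (EuclideanSpace ℝ (Fin d)))
    (v : ℝ → EuclideanSpace ℝ (Fin d) → EuclideanSpace ℝ (Fin d))
    (t : ℝ) (x : EuclideanSpace ℝ (Fin d)) : EuclideanSpace ℝ (Fin d) :=
  if h : ∃ y, IsSolution Ω v x y then h.choose t else x

/-- The set `B(t)` of points of `Ω` at which `z ↦ v(t, z)` is not differentiable. -/
def nonDiff {d : ℕ} (Ω : Set (EuclideanSpace ℝ (Fin d)))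
    (v : ℝ → EuclideanSpace ℝ (Fin d) → EuclideanSpace ℝ (Fin d)) (t : ℝ) :
    Set (EuclideanSpace ℝ (Fin d)) :=
  {z ∈ Ω | ¬ DifferentiableAt ℝ (v t) z}

/-- `ℰ₁`: the points of `Ω` at positive distance from the boundary. -/
def E₁ {d : ℕ} (Ω : Set (EuclideanSpace ℝ (Fin d))) : Set (EuclideanSpace ℝ (Fin d)) :=
  {z ∈ Ω | 0 < Metric.infDist z (frontier Ω)}

/-- `ℰ₂`: the points that the flow takes, at time `1`, to positive distance from the boundary. -/
def E₂ {d : ℕ} (Ω : Set (EuclideanSpace ℝ (Fin d)))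
    (v : ℝ → EuclideanSpace ℝ (Fin d) → EuclideanSpace ℝ (Fin d)) :
    Set (EuclideanSpace ℝ (Fin d)) :=
  {z ∈ Ω | 0 < Metric.infDist (flow Ω v 1 z) (frontier Ω)}

/-- `ℰ₄`: the points whose path meets the non-differentiability sets at Lebesgue-almost no time. -/
def E₄ {d : ℕ} (Ω : Set (EuclideanSpace ℝ (Fin d)))
    (v : ℝ → EuclideanSpace ℝ (Fin d) → EuclideanSpace ℝ (Fin d)) :
    Set (EuclideanSpace ℝ (Fin d)) :=
  {z ∈ Ω | volume {t ∈ Icc (0 : ℝ) 1 | flow Ω v t z ∈ nonDiff Ω v t} = 0}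

/-- The modulus `ω(η) = sup max {|p(z)/p(z') - 1|, |q(z)/q(z') - 1|}` over `z, z' ∈ Ω` with
`‖z - z'‖ ≤ η`. If `p` or `q` has a zero in `Ω`, then `ω ≥ 1` by the choice `z = z'`. -/
noncomputable def modulus {d : ℕ} (Ω : Set (EuclideanSpace ℝ (Fin d)))
    (p q : EuclideanSpace ℝ (Fin d) → ℝ) (η : ℝ) : ℝ≥0∞ :=
  ⨆ (z ∈ Ω) (z' ∈ Ω) (_ : ‖z - z'‖ ≤ η),
    ENNReal.ofReal (max |p z / p z' - 1| |q z / q z' - 1|)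

/-- There is a finite `L` with `ω(η) ≤ Lη` for all `η > 0`. -/
def HasLinearModulus {d : ℕ} (Ω : Set (EuclideanSpace ℝ (Fin d)))
    (p q : EuclideanSpace ℝ (Fin d) → ℝ) : Prop :=
  ∃ L : ℝ, ∀ η > 0, modulus Ω p q η ≤ ENNReal.ofReal (L * η)

open Classical in
/-- `|ln (a / b)|` for `b > 0`, with value `∞` if `a ≤ 0`. -/
noncomputable def absLogRatio (a b : ℝ) : ℝ≥0∞ :=
  if 0 < a then ENNReal.ofReal |Real.log (a / b)| else ⊤

/-- `sup_{x ∈ Ω} max {|ln (p̂₀/p₀)|, |ln (p̂₁/p₁)|}`. -/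
noncomputable def logRatioError {d : ℕ} (Ω : Set (EuclideanSpace ℝ (Fin d)))
    (p₀ p₁ q₀ q₁ : EuclideanSpace ℝ (Fin d) → ℝ) : ℝ≥0∞ :=
  ⨆ x ∈ Ω, max (absLogRatio (q₀ x) (p₀ x)) (absLogRatio (q₁ x) (p₁ x))

/-- `ess sup_{x ∈ Ω°} max {‖∇ log p̂₀ - ∇ log p₀‖, ‖∇ log p̂₁ - ∇ log p₁‖}`. -/
noncomputable def scoreError {d : ℕ} (Ω : Set (EuclideanSpace ℝ (Fin d)))
    (p₀ p₁ q₀ q₁ : EuclideanSpace ℝ (Fin d) → ℝ) : ℝ≥0∞ :=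
  essSup (fun x =>
    max ‖gradient (fun y => Real.log (q₀ y)) x - gradient (fun y => Real.log (p₀ y)) x‖ₑ
      ‖gradient (fun y => Real.log (q₁ y)) x - gradient (fun y => Real.log (p₁ y)) x‖ₑ)
    (volume.restrict (interior Ω))

/-- `w` solves, on `[0,1]`, the linear Volterra equation `w(t) = ∫₀ᵗ a(s) ds + ∫₀ᵗ b(s) w(s) ds`. -/
structure IsVolterraSolution {d : ℕ}
    (b : ℝ → EuclideanSpace ℝ (Fin d) →L[ℝ] EuclideanSpace ℝ (Fin d))
    (a w : ℝ → EuclideanSpace ℝ (Fin d)) : Prop where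
  integrable_drift : IntervalIntegrable a volume 0 1
  integrable : IntervalIntegrable (fun s => b s (w s)) volume 0 1
  eq_integral : ∀ t ∈ Icc (0 : ℝ) 1,
    w t = (∫ s in (0 : ℝ)..t, a s) + ∫ s in (0 : ℝ)..t, b s (w s)

open Classical in
/-- The solution of the linear Volterra equation (and `0` if there is none). -/
noncomputable def volterraSolution {d : ℕ}
    (b : ℝ → EuclideanSpace ℝ (Fin d) →L[ℝ] EuclideanSpace ℝ (Fin d))
    (a : ℝ → EuclideanSpace ℝ (Fin d)) : ℝ → EuclideanSpace ℝ (Fin d) :=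
  if h : ∃ w, IsVolterraSolution b a w then h.choose else 0

/-- `Φ` solves, on `[0,1]`, the matrix equation `Φ(t) = I + ∫₀ᵗ b(s) Φ(s) ds`. -/
structure IsFundamentalSolution {d : ℕ}
    (b Φ : ℝ → EuclideanSpace ℝ (Fin d) →L[ℝ] EuclideanSpace ℝ (Fin d)) : Prop where
  integrable : IntervalIntegrable (fun s => b s ∘L Φ s) volume 0 1
  eq_integral : ∀ t ∈ Icc (0 : ℝ) 1,
    Φ t = ContinuousLinearMap.id ℝ (EuclideanSpace ℝ (Fin d)) + ∫ s in (0 : ℝ)..t, b s ∘L Φ s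

/-- `A_n = o_p(B_n)`: for every `ε > 0` the probability of `A_n > ε B_n` tends to `0`. For events
that are not measurable, `P` is the outer probability. -/
def IsLittleOP {Ξ : Type*} [MeasurableSpace Ξ] (P : Measure Ξ) (A B : ℕ → Ξ → ℝ≥0∞) : Prop :=
  ∀ ε : ℝ, 0 < ε → Tendsto (fun n => P {ξ | ENNReal.ofReal ε * B n ξ < A n ξ}) atTop (𝓝 0)

end RectifiedFlow

namespace RectifiedFlow
open Classical in
lemma IsDensityOn.measurable {d : ℕ} {Ω : Set (EuclideanSpace ℝ (Fin d))}
    {p : EuclideanSpace ℝ (Fin d) → ℝ} (h : IsDensityOn Ω p) (hΩ : IsCompact Ω) :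
    Measurable p := by
  have : p = Ω.piecewise p 0 := by
    funext x
    by_cases hx : x ∈ Ω
    · simp [hx]
    · simp [hx, h.eq_zero_of_notMem x hx]
  rw [this]
  exact h.continuousOn.measurable_piecewise continuousOn_const hΩ.measurableSet

lemma IsDensityOn.nonneg {d : ℕ} {Ω : Set (EuclideanSpace ℝ (Fin d))}
    {p : EuclideanSpace ℝ (Fin d) → ℝ} (h : IsDensityOn Ω p) (x) : 0 ≤ p x := by
  obtain ⟨c, hc, hcp⟩ := h.bounded_below
  by_cases hx : x ∈ Ω
  · exact hc.le.trans (hcp x hx)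
  · simp [h.eq_zero_of_notMem x hx]

lemma IsDensityOn.integrable {d : ℕ} {Ω : Set (EuclideanSpace ℝ (Fin d))}
    {p : EuclideanSpace ℝ (Fin d) → ℝ} (h : IsDensityOn Ω p) : Integrable p := by
  by_contra hc
  have := h.integral_eq_one
  rw [integral_undef hc] at this
  norm_num at this

/-- The change of variables `(z, δ) ↦ (z - tδ, z + (1-t)δ)` preserves volume. -/
lemma measurePreserving_chord {d : ℕ} (t : ℝ) :
    MeasurePreserving (fun w : EuclideanSpace ℝ (Fin d) × EuclideanSpace ℝ (Fin d) =>
      (w.1 - t • w.2, w.1 + (1 - t) • w.2)) (volume.prod volume) (volume.prod volume) := by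
  have h1 : MeasurePreserving (fun w : EuclideanSpace ℝ (Fin d) × EuclideanSpace ℝ (Fin d) =>
      (w.1, w.2 - t • w.1)) (volume.prod volume) (volume.prod volume) := by
    refine (MeasurePreserving.id volume).skew_product (g := fun a b => b - t • a) ?_ ?_
    · fun_prop
    · exact Filter.Eventually.of_forall fun a => (measurePreserving_sub_right volume (t • a)).map_eq
  have h2 := (measurePreserving_prod_add (volume : Measure (EuclideanSpace ℝ (Fin d)))
    (volume : Measure (EuclideanSpace ℝ (Fin d))))
  have h3 := Measure.measurePreserving_swap
    (μ := (volume : Measure (EuclideanSpace ℝ (Fin d))))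
    (ν := (volume : Measure (EuclideanSpace ℝ (Fin d))))
  have := h2.comp (h3.comp (h1.comp h3))
  convert this using 1
  funext w
  simp only [Function.comp, Prod.swap]
  ext1
  · rfl
  · simp only [sub_smul, one_smul]; abel

lemma velocity_eq {d : ℕ} {Ω : Set (EuclideanSpace ℝ (Fin d))}
    {p q : EuclideanSpace ℝ (Fin d) → ℝ} (hp : IsDensityOn Ω p) (hq : IsDensityOn Ω q)
    (t : ℝ) (z : EuclideanSpace ℝ (Fin d)) :
    velocity Ω p q t z = (∫ δ, p (z - t • δ) * q (z + (1 - t) • δ))⁻¹ •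
      ∫ δ, (p (z - t • δ) * q (z + (1 - t) • δ)) • δ := by
  have key : ∀ δ, δ ∉ admissible Ω t z → p (z - t • δ) * q (z + (1 - t) • δ) = 0 := by
    intro δ hδ
    by_cases h : z - t • δ ∈ Ω
    · rw [hq.eq_zero_of_notMem _ (fun h' => hδ ⟨h, h'⟩), mul_zero]
    · rw [hp.eq_zero_of_notMem _ h, zero_mul]
  rw [velocity, setIntegral_eq_integral_of_forall_compl_eq_zero key,
    setIntegral_eq_integral_of_forall_compl_eq_zero (fun δ hδ => by rw [key δ hδ, zero_smul])]

/-- For independent `X₀ ∼ p`, `X₁ ∼ q`, the field `velocity Ω p q` evaluated at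
`X_t = (1-t)X₀ + tX₁` is the conditional expectation `E[X₁ - X₀ | X_t]`. -/
theorem velocity_eq_condExp {d : ℕ} {Ω : Set (EuclideanSpace ℝ (Fin d))} (hΩ : IsCompact Ω)
    {p q : EuclideanSpace ℝ (Fin d) → ℝ} (hp : IsDensityOn Ω p) (hq : IsDensityOn Ω q) (t : ℝ)
    (X : EuclideanSpace ℝ (Fin d) × EuclideanSpace ℝ (Fin d) → EuclideanSpace ℝ (Fin d))
    (hX : X = fun w => (1 - t) • w.1 + t • w.2)
    (μ : Measure (EuclideanSpace ℝ (Fin d) × EuclideanSpace ℝ (Fin d)))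
    (hμ : μ = (volume.withDensity fun x => ENNReal.ofReal (p x)).prod
      (volume.withDensity fun x => ENNReal.ofReal (q x))) :
    (fun w => velocity Ω p q t (X w)) =ᵐ[μ]
      μ[fun w => w.2 - w.1 | MeasurableSpace.comap X inferInstance] := by
  have hpm := hp.measurable hΩ
  have hqm := hq.measurable hΩ
  have hXm : Measurable X := by rw [hX]; fun_prop
  set T : EuclideanSpace ℝ (Fin d) × EuclideanSpace ℝ (Fin d) →
      EuclideanSpace ℝ (Fin d) × EuclideanSpace ℝ (Fin d) :=
    fun w => (w.1 - t • w.2, w.1 + (1 - t) • w.2) with hT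
  have hTm : Measurable T := by rw [hT]; fun_prop
  have hTmp : MeasurePreserving T (volume.prod volume) (volume.prod volume) :=
    measurePreserving_chord t
  have hTX : ∀ w, X (T w) = w.1 := by
    intro w; rw [hX, hT]; simp only [smul_sub, smul_add, smul_smul, sub_smul, one_smul]
    module
  have hTd : ∀ w, (T w).2 - (T w).1 = w.2 := by
    intro w; rw [hT]; simp only; module
  set r : EuclideanSpace ℝ (Fin d) × EuclideanSpace ℝ (Fin d) → ℝ :=
    fun w => p w.1 * q w.2 with hr
  have hrm : Measurable r := by rw [hr]; fun_prop
  have hr0 : ∀ w, 0 ≤ r w := fun w => mul_nonneg (hp.nonneg _) (hq.nonneg _)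
  have hμ' : μ = (volume.prod volume).withDensity (fun w => ENNReal.ofReal (r w)) := by
    rw [hμ, prod_withDensity (by fun_prop) (by fun_prop)]
    congr 1; funext w; rw [hr, ENNReal.ofReal_mul (hp.nonneg _)]
  -- integrability over the chord coordinates
  have hri : Integrable r (volume.prod volume) := hp.integrable.mul_prod hq.integrable
  have hrT : Integrable (fun w => r (T w)) (volume.prod volume) := hTmp.integrable_comp_of_integrable hri
  have : IsFiniteMeasure μ := by
    rw [hμ']; exact isFiniteMeasure_withDensity_ofReal hri.2
  have hint : ∀ g : EuclideanSpace ℝ (Fin d) × EuclideanSpace ℝ (Fin d) → EuclideanSpace ℝ (Fin d),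
      StronglyMeasurable g →
      (∫ w, g w ∂μ = ∫ w, r (T w) • g (T w) ∂(volume.prod volume)) := by
    intro g hg
    rw [hμ', integral_withDensity_eq_integral_toReal_smul (by fun_prop) (by simp)]
    have hm : AEStronglyMeasurable (fun w => r w • g w) (Measure.map T (volume.prod volume)) :=
      (hrm.stronglyMeasurable.smul hg).aestronglyMeasurable
    have h := integral_map hTm.aemeasurable hm
    rw [hTmp.map_eq] at h
    rw [← h]
    simp only [ENNReal.toReal_ofReal (hr0 _)]
  obtain ⟨D, hD⟩ := hΩ.isBounded.exists_norm_le
  have hrD : ∀ w, r (T w) * ‖w.2‖ ≤ r (T w) * (2 * D) := by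
    intro w
    by_cases h1 : (T w).1 ∈ Ω
    · by_cases h2 : (T w).2 ∈ Ω
      · refine mul_le_mul_of_nonneg_left ?_ (hr0 _)
        rw [← hTd w]
        linarith [norm_sub_le (T w).2 (T w).1, hD _ h1, hD _ h2]
      · simp [hr, hq.eq_zero_of_notMem _ h2]
    · simp [hr, hp.eq_zero_of_notMem _ h1]
  have hf : Integrable (fun w => r (T w) • w.2) (volume.prod volume) := by
    refine (hrT.mul_const (2 * D)).mono' ?_ (Eventually.of_forall fun w => ?_)
    · exact ((hrm.comp hTm).stronglyMeasurable.smul measurable_snd.stronglyMeasurable).aestronglyMeasurable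
    · rw [norm_smul, Real.norm_of_nonneg (hr0 _)]; exact hrD w
  have hvel : ∀ z, velocity Ω p q t z = (∫ δ, r (T (z, δ)))⁻¹ • ∫ δ, r (T (z, δ)) • δ :=
    fun z => velocity_eq hp hq t z
  have hvm : StronglyMeasurable (velocity Ω p q t) := by
    have : velocity Ω p q t = fun z => (∫ δ, r (T (z, δ)))⁻¹ • ∫ δ, r (T (z, δ)) • δ :=
      funext hvel
    rw [this]
    have h1 : StronglyMeasurable fun z => ∫ δ, r (T (z, δ)) :=
      StronglyMeasurable.integral_prod_right (f := fun z δ => r (T (z, δ)))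
        (hrm.comp hTm).stronglyMeasurable
    have h2 : StronglyMeasurable fun z => ∫ δ, r (T (z, δ)) • δ :=
      StronglyMeasurable.integral_prod_right (f := fun z δ => r (T (z, δ)) • δ)
        ((hrm.comp hTm).stronglyMeasurable.smul measurable_snd.stronglyMeasurable)
    exact h1.measurable.inv.stronglyMeasurable.smul h2
  -- the field is bounded
  have hvb : ∀ z, ‖velocity Ω p q t z‖ ≤ 2 * |D| := by
    intro z
    rw [hvel, norm_smul, norm_inv, Real.norm_of_nonneg (integral_nonneg fun δ => hr0 _)]
    by_cases hi : Integrable fun δ => r (T (z, δ))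
    · have : ‖∫ δ, r (T (z, δ)) • δ‖ ≤ ∫ δ, r (T (z, δ)) * (2 * |D|) := by
        refine norm_integral_le_of_norm_le (hi.mul_const _) (Eventually.of_forall fun δ => ?_)
        rw [norm_smul, Real.norm_of_nonneg (hr0 _)]
        refine (hrD (z, δ)).trans (mul_le_mul_of_nonneg_left ?_ (hr0 _))
        linarith [le_abs_self D]
      rw [integral_mul_const] at this
      have hn : 0 ≤ ∫ δ, r (T (z, δ)) := integral_nonneg fun δ => hr0 _
      rcases hn.eq_or_lt with h0 | h0
      · rw [← h0]; simp
      · refine (mul_le_mul_of_nonneg_left this (inv_nonneg.2 h0.le)).trans ?_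
        rw [← mul_assoc, inv_mul_cancel₀ h0.ne', one_mul]
    · rw [integral_undef hi]; simp
  have hvi : Integrable (fun w => velocity Ω p q t (X w)) μ :=
    Integrable.of_bound (hvm.comp_measurable hXm).aestronglyMeasurable (2 * |D|)
      (Eventually.of_forall fun w => hvb _)
  have hdm : StronglyMeasurable
      (fun w : EuclideanSpace ℝ (Fin d) × EuclideanSpace ℝ (Fin d) => w.2 - w.1) :=
    (measurable_snd.sub measurable_fst).stronglyMeasurable
  have hdi : Integrable
      (fun w : EuclideanSpace ℝ (Fin d) × EuclideanSpace ℝ (Fin d) => w.2 - w.1) μ := by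
    rw [hμ', integrable_withDensity_iff_integrable_smul' (by fun_prop) (by simp)]
    have h1 : Integrable (fun w : EuclideanSpace ℝ (Fin d) × EuclideanSpace ℝ (Fin d) =>
        r w • (w.2 - w.1)) (volume.prod volume) := by
      have hm : AEStronglyMeasurable
          (fun w : EuclideanSpace ℝ (Fin d) × EuclideanSpace ℝ (Fin d) => r w • (w.2 - w.1))
          (volume.prod volume) := (hrm.stronglyMeasurable.smul hdm).aestronglyMeasurable
      rw [← hTmp.integrable_comp hm]
      refine hf.congr (Eventually.of_forall fun w => ?_)
      simp only [Function.comp, hTd]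
    refine h1.congr (Eventually.of_forall fun w => ?_)
    simp [ENNReal.toReal_ofReal (hr0 _)]
  refine ae_eq_condExp_of_forall_setIntegral_eq hXm.comap_le hdi
    (fun s _ _ => hvi.integrableOn) ?_ ?_
  · rintro _ ⟨B, hB, rfl⟩ _
    have hXB : MeasurableSet (X ⁻¹' B) := hXm hB
    have hvX : StronglyMeasurable fun w => velocity Ω p q t (X w) := hvm.comp_measurable hXm
    rw [← integral_indicator hXB, ← integral_indicator hXB,
      hint _ (hvX.indicator hXB), hint _ (hdm.indicator hXB)]
    have e1 : ∀ w, r (T w) • (X ⁻¹' B).indicator (fun w => velocity Ω p q t (X w)) (T w) =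
        B.indicator (fun _ => r (T w) • velocity Ω p q t w.1) w.1 := by
      intro w
      by_cases h : w.1 ∈ B <;> simp [indicator, hTX, h]
    have e2 : ∀ w, r (T w) • (X ⁻¹' B).indicator
        (fun w : EuclideanSpace ℝ (Fin d) × EuclideanSpace ℝ (Fin d) => w.2 - w.1) (T w) =
        B.indicator (fun _ => r (T w) • w.2) w.1 := by
      intro w
      by_cases h : w.1 ∈ B <;> simp [indicator, hTX, hTd, h]
    simp_rw [e1, e2]
    have hB1 : MeasurableSet {w : EuclideanSpace ℝ (Fin d) × EuclideanSpace ℝ (Fin d) | w.1 ∈ B} :=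
      measurable_fst hB
    have i1 : Integrable (fun w : EuclideanSpace ℝ (Fin d) × EuclideanSpace ℝ (Fin d) =>
        B.indicator (fun _ => r (T w) • velocity Ω p q t w.1) w.1) (volume.prod volume) := by
      have : Integrable (fun w => r (T w) • velocity Ω p q t w.1) (volume.prod volume) :=
        hrT.smul_bdd (2 * |D|)
          (hvm.comp_measurable measurable_fst).aestronglyMeasurable
          (Eventually.of_forall fun w => hvb _)
      exact this.indicator hB1
    have i2 : Integrable (fun w : EuclideanSpace ℝ (Fin d) × EuclideanSpace ℝ (Fin d) =>
        B.indicator (fun _ => r (T w) • w.2) w.1) (volume.prod volume) := hf.indicator hB1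
    rw [integral_prod _ i1, integral_prod _ i2]
    refine integral_congr_ae ?_
    filter_upwards [hrT.prod_right_ae] with z hz
    by_cases h : z ∈ B
    · simp only [indicator_of_mem h]
      rw [integral_smul_const, hvel]
      rcases eq_or_ne (∫ δ, r (T (z, δ))) 0 with h0 | h0
      · rw [h0, zero_smul]
        rw [integral_eq_zero_iff_of_nonneg (fun δ => hr0 _) hz] at h0
        symm
        apply integral_eq_zero_of_ae
        filter_upwards [h0] with δ hδ
        simp only [Pi.zero_apply] at hδ ⊢
        rw [hδ, zero_smul]
      · rw [smul_smul, mul_inv_cancel₀ h0, one_smul]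
    · simp [indicator_of_notMem h]
  · have : Measurable[MeasurableSpace.comap X inferInstance] X := comap_measurable X
    exact (hvm.comp_measurable this).aestronglyMeasurable

end RectifiedFlow

/-! The velocity is a quotient of two integrals over the moving set S_t(z). Two facts control it on
`core Ω ρ`, the points whose closed ρ-ball lies in Ω. The denominator is bounded below, because
S_t(z) contains the ρ-ball about 0. And S_t(z) changes by O(‖z - z'‖/ρ) in volume, because convexity
gives (1 - ‖z' - z‖/ρ) S_t(z) ⊆ S_t(z'). A kernel that is Lipschitz under simultaneous translation
of its arguments therefore yields a velocity that is Lipschitz in space, uniformly in time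
(`exists_lipschitz_velocity`). The same estimates, applied to the difference of the product kernels,
show that v̂ - v is small and also has a small Lipschitz constant once r_n + s_n is small
(`exists_velocity_sub_le_of_errors`). The score error is needed exactly for this: it bounds the
Lipschitz constant of log(p̂/p).

Trajectories do not reach the boundary before time 1. If f ≤ c on Ω for a linear f, then z + (1-t)δ
∈ Ω forces f(δ) ≤ (c - f(z))/(1-t), so c - f decays along a trajectory no faster than 1 - t
(`mem_core_one_sub_mul`). Picard iteration on a core gives existence on [0,T] for each T < 1,
Grönwall's inequality gives uniqueness, and boundedness of the velocity extends the solution to time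
1. A path whose endpoint is interior as well stays in one fixed core.

For the linearization let D be the difference of the two flows, w the linearized error and b the
derivative of v along the path R. Then (D - w)' = b(D - w) + {(v̂ - v)(R + D) - (v̂ - v)(R)} + {v(R
+ D) - v(R) - bD}. The first brace is at most a small constant times ‖D‖. The second has integral
o(sup ‖D‖) by dominated convergence, which needs differentiability of v at almost every time only
(`exists_integral_remainder_le`). Grönwall yields sup ‖D - w‖ ≤ θ sup ‖D‖ with θ ≤ 1/2, hence sup
‖D‖ ≤ 2 sup ‖w‖, and the error is small relative to w itself. This is a deterministic statement
(`exists_linearization`); the probabilistic one follows by an inclusion of events. -/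

namespace RectifiedFlow

/-! ### Grönwall's inequality and Picard iteration for integral equations. -/

/-- Grönwall's inequality in integral form. -/
theorem le_mul_exp_of_le_add_integral {u : ℝ → ℝ} {A C T : ℝ} (hC : 0 ≤ C)
    (hu : ContinuousOn u (Icc 0 T))
    (h : ∀ t ∈ Icc (0 : ℝ) T, u t ≤ A + C * ∫ s in (0 : ℝ)..t, u s) :
    ∀ t ∈ Icc (0 : ℝ) T, u t ≤ A * Real.exp (C * t) := by
  intro t ht
  have hT : 0 ≤ T := ht.1.trans ht.2
  have hint : IntervalIntegrable u volume 0 T := by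
    apply ContinuousOn.intervalIntegrable; rwa [uIcc_of_le hT]
  have hcont : ContinuousOn (fun t => A + C * ∫ s in (0 : ℝ)..t, u s) (Icc 0 T) := by
    have := intervalIntegral.continuousOn_primitive_interval'
      (hint) (left_mem_uIcc (a := (0 : ℝ)) (b := T))
    rw [uIcc_of_le hT] at this
    exact continuousOn_const.add (continuousOn_const.mul this)
  have hder : ∀ s ∈ Ico (0 : ℝ) T,
      HasDerivWithinAt (fun t => A + C * ∫ s in (0 : ℝ)..t, u s) (C * u s) (Ici s) s := by
    intro s hs
    have h1 : IntervalIntegrable u volume 0 s :=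
      hint.mono_set (by rw [uIcc_of_le hs.1, uIcc_of_le hT]; exact Icc_subset_Icc le_rfl hs.2.le)
    have hc : ContinuousWithinAt u (Ioi s) s :=
      ((hu s ⟨hs.1, hs.2.le⟩).mono_of_mem_nhdsWithin (by
        refine mem_of_superset (Icc_mem_nhdsGT hs.2) (Icc_subset_Icc hs.1 le_rfl)))
    have hm : StronglyMeasurableAtFilter u (𝓝[>] s) :=
      ⟨Icc s T, Icc_mem_nhdsGT hs.2,
        (hu.mono (Icc_subset_Icc hs.1 le_rfl)).aestronglyMeasurable measurableSet_Icc⟩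
    exact ((intervalIntegral.integral_hasDerivWithinAt_right h1 hm hc).const_mul C).const_add A
  -- The differential inequality is applied to the majorant A + C∫u, which is differentiable
  -- although u is only continuous; its derivative C u is at most C times the majorant.
  have := le_gronwallBound_of_liminf_deriv_right_le (δ := A) (K := C) (ε := 0) hcont
    (f' := fun s => C * u s)
    (fun s hs r hr => (hder s hs).liminf_right_slope_le hr) (by simp)
    (fun s hs => by
      have := mul_le_mul_of_nonneg_left (h s ⟨hs.1, hs.2.le⟩) hC
      simpa using this) t ht
  rw [gronwallBound_ε0, sub_zero] at this
  exact (h t ht).trans this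

/-- Global existence for an integral equation whose right-hand side is Lipschitz in space and only
integrable in time along continuous curves. -/
theorem exists_continuous_eq_add_integral {E : Type*} [NormedAddCommGroup E] [NormedSpace ℝ E]
    [CompleteSpace E] {f : ℝ → E → E} {T C : ℝ} (hT : 0 ≤ T) (hC : 0 ≤ C)
    (hint : ∀ y : ℝ → E, Continuous y → IntervalIntegrable (fun s => f s (y s)) volume 0 T)
    (hlip : ∀ s ∈ Icc (0 : ℝ) T, ∀ y z, ‖f s y - f s z‖ ≤ C * ‖y - z‖) (x : E) :
    ∃ y : ℝ → E, Continuous y ∧ ∀ t ∈ Icc (0 : ℝ) T, y t = x + ∫ s in (0 : ℝ)..t, f s (y s) := by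
  have hsub : ∀ t ∈ Icc (0 : ℝ) T, uIcc 0 t ⊆ uIcc 0 T := fun t ht => by
    rw [uIcc_of_le ht.1, uIcc_of_le hT]; exact Icc_subset_Icc le_rfl ht.2
  have hext : ∀ y : C(Icc (0 : ℝ) T, E), Continuous (IccExtend hT y) :=
    fun y => y.continuous.Icc_extend'
  let N : C(Icc (0 : ℝ) T, E) → C(Icc (0 : ℝ) T, E) := fun y =>
    ⟨fun t => x + ∫ s in (0 : ℝ)..t, f s (IccExtend hT y s), by
      have := intervalIntegral.continuousOn_primitive_interval'
        (hint _ (hext y)) (left_mem_uIcc (a := (0 : ℝ)) (b := T))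
      rw [uIcc_of_le hT] at this
      exact continuous_const.add this.domRestrict⟩
  -- The factorial comes from integrating s ^ n at each iteration. It makes some iterate a
  -- contraction on all of [0,T], so no subdivision into short intervals is needed.
  have hN : ∀ (n : ℕ) (y z : C(Icc (0 : ℝ) T, E)) (t : Icc (0 : ℝ) T),
      ‖(N^[n] y) t - (N^[n] z) t‖ ≤ (C * t) ^ n / n.factorial * dist y z := by
    intro n y z
    induction n with
    | zero =>
      intro t
      simpa [dist_eq_norm] using (ContinuousMap.dist_apply_le_dist (f := y) (g := z) t)
    | succ n ih =>
      intro t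
      rw [Function.iterate_succ_apply', Function.iterate_succ_apply']
      set y' := N^[n] y
      set z' := N^[n] z
      have hy := (hint _ (hext y')).mono_set (hsub t t.2)
      have hz := (hint _ (hext z')).mono_set (hsub t t.2)
      have e : (N y') t - (N z') t =
          ∫ s in (0 : ℝ)..t, (f s (IccExtend hT y' s) - f s (IccExtend hT z' s)) := by
        rw [intervalIntegral.integral_sub hy hz]
        simp [N]
      rw [e]
      have hb : ∀ s ∈ Ioc (0 : ℝ) t, ‖f s (IccExtend hT y' s) - f s (IccExtend hT z' s)‖ ≤
          C ^ (n + 1) / n.factorial * dist y z * s ^ n := by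
        intro s hs
        have hsT : s ∈ Icc (0 : ℝ) T := ⟨hs.1.le, hs.2.trans t.2.2⟩
        refine (hlip s hsT _ _).trans ?_
        rw [IccExtend_of_mem hT _ hsT, IccExtend_of_mem hT _ hsT]
        refine (mul_le_mul_of_nonneg_left (ih ⟨s, hsT⟩) hC).trans (le_of_eq ?_)
        simp only [mul_pow, pow_succ]; ring
      refine (intervalIntegral.norm_integral_le_of_norm_le t.2.1
        (Eventually.of_forall hb) ?_).trans (le_of_eq ?_)
      · exact (continuous_const.mul (continuous_pow n)).intervalIntegrable _ _
      · rw [intervalIntegral.integral_const_mul, integral_pow, Nat.factorial_succ]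
        push_cast
        have : ((n : ℝ) + 1) ≠ 0 := by positivity
        have : (n.factorial : ℝ) ≠ 0 := by positivity
        field_simp
        simp [mul_pow]; ring
  obtain ⟨n, hn⟩ : ∃ n : ℕ, (C * T) ^ n / n.factorial < 1 / 2 :=
    ((FloorSemiring.tendsto_pow_div_factorial_atTop (C * T)).eventually
      (gt_mem_nhds (by norm_num : (0 : ℝ) < 1 / 2))).exists
  have hcontr : ContractingWith (1 / 2) (N^[n]) := by
    refine ⟨by rw [← NNReal.coe_lt_coe]; norm_num, LipschitzWith.of_dist_le_mul fun y z => ?_⟩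
    rw [ContinuousMap.dist_le (by positivity)]
    intro t
    rw [dist_eq_norm]
    refine (hN n y z t).trans (mul_le_mul_of_nonneg_right ?_ dist_nonneg)
    have h1 : (C * t) ^ n ≤ (C * T) ^ n :=
      pow_le_pow_left₀ (mul_nonneg hC t.2.1) (mul_le_mul_of_nonneg_left t.2.2 hC) n
    have : (C * t) ^ n / n.factorial ≤ (C * T) ^ n / n.factorial := by gcongr
    simpa using this.trans hn.le
  have : Nonempty C(Icc (0 : ℝ) T, E) := ⟨ContinuousMap.const _ x⟩
  -- The unique fixed point of an iterate of `N` is a fixed point of `N` itself.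
  have hfix := hcontr.isFixedPt_fixedPoint_iterate
  set y := ContractingWith.fixedPoint (N^[n]) hcontr
  refine ⟨IccExtend hT y, hext y, fun t ht => ?_⟩
  conv_lhs => rw [← hfix, IccExtend_of_mem hT _ ht]
  rfl

end RectifiedFlow

namespace RectifiedFlow

/-! ### Primitives of integrable functions: Grönwall estimates and the product rule. -/

section Primitive

variable {F : Type*} [NormedAddCommGroup F]

theorem intervalIntegrable_mono_Icc {f : ℝ → F} {T s t : ℝ}
    (hf : IntervalIntegrable f volume 0 T) (hs : s ∈ Icc 0 T) (ht : t ∈ Icc 0 T) :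
    IntervalIntegrable f volume s t := by
  refine hf.mono_set ?_
  rw [uIcc_of_le (hs.1.trans hs.2)]
  exact uIcc_subset_Icc hs ht

theorem intervalIntegrable_of_bound {f : ℝ → F} {T C : ℝ} (hT : 0 ≤ T)
    (hf : AEStronglyMeasurable f (volume.restrict (Icc 0 T)))
    (hC : ∀ s ∈ Icc (0 : ℝ) T, ‖f s‖ ≤ C) : IntervalIntegrable f volume 0 T := by
  rw [intervalIntegrable_iff_integrableOn_Icc_of_le hT]
  refine Integrable.of_bound hf C ?_
  filter_upwards [ae_restrict_mem measurableSet_Icc] with s hs using hC s hs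

theorem aestronglyMeasurable_of_intervalIntegrable {f : ℝ → F} {T : ℝ} (hT : 0 ≤ T)
    (hf : IntervalIntegrable f volume 0 T) :
    AEStronglyMeasurable f (volume.restrict (Icc 0 T)) :=
  ((intervalIntegrable_iff_integrableOn_Icc_of_le hT).1 hf).aestronglyMeasurable

variable {G W : Type*} [NormedSpace ℝ F] [NormedAddCommGroup G]
  [NormedSpace ℝ G] [NormedAddCommGroup W] [NormedSpace ℝ W]

theorem continuousOn_integral {f : ℝ → F} {T : ℝ} (hT : 0 ≤ T)
    (hf : IntervalIntegrable f volume 0 T) :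
    ContinuousOn (fun t => ∫ s in (0 : ℝ)..t, f s) (Icc 0 T) := by
  have := intervalIntegral.continuousOn_primitive_interval' hf
    (left_mem_uIcc (a := (0 : ℝ)) (b := T))
  rwa [uIcc_of_le hT] at this

theorem norm_integral_sub_integral_le {f : ℝ → F} {T C : ℝ}
    (hf : IntervalIntegrable f volume 0 T)
    (hC : ∀ s ∈ Icc (0 : ℝ) T, ‖f s‖ ≤ C) {s t : ℝ} (hs : s ∈ Icc 0 T) (ht : t ∈ Icc 0 T) :
    ‖(∫ r in (0 : ℝ)..t, f r) - ∫ r in (0 : ℝ)..s, f r‖ ≤ C * |t - s| := by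
  have h0 : (0 : ℝ) ∈ Icc 0 T := ⟨le_rfl, hs.1.trans hs.2⟩
  rw [intervalIntegral.integral_interval_sub_left (intervalIntegrable_mono_Icc hf h0 ht)
    (intervalIntegrable_mono_Icc hf h0 hs)]
  refine intervalIntegral.norm_integral_le_of_norm_le_const fun r hr => hC r ?_
  exact uIcc_subset_Icc hs ht (uIoc_subset_uIcc hr)

/-- Grönwall's inequality for a primitive. -/
theorem norm_le_mul_exp_of_eq_integral {u k : ℝ → F} {ρ : ℝ → ℝ} {A C T : ℝ} (hC : 0 ≤ C)
    (hk : IntervalIntegrable k volume 0 T) (hu : ∀ t ∈ Icc (0 : ℝ) T, u t = ∫ s in (0 : ℝ)..t, k s)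
    (hρ : IntervalIntegrable ρ volume 0 T) (hρ0 : ∀ s ∈ Icc (0 : ℝ) T, 0 ≤ ρ s)
    (hρA : ∫ s in (0 : ℝ)..T, ρ s ≤ A)
    (hb : ∀ s ∈ Icc (0 : ℝ) T, ‖k s‖ ≤ ρ s + C * ‖u s‖) :
    ∀ t ∈ Icc (0 : ℝ) T, ‖u t‖ ≤ A * Real.exp (C * t) := by
  intro t ht
  have hT : 0 ≤ T := ht.1.trans ht.2
  have h0 : (0 : ℝ) ∈ Icc 0 T := ⟨le_rfl, hT⟩
  have huc : ContinuousOn u (Icc 0 T) := (continuousOn_integral hT hk).congr hu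
  have hun : IntervalIntegrable (fun s => ‖u s‖) volume 0 T := by
    apply ContinuousOn.intervalIntegrable; rw [uIcc_of_le hT]; exact huc.norm
  refine le_mul_exp_of_le_add_integral (u := fun t => ‖u t‖) hC huc.norm ?_ t ht
  intro t ht
  have i1 := intervalIntegrable_mono_Icc hρ h0 ht
  have i2 := (intervalIntegrable_mono_Icc hun h0 ht).const_mul C
  rw [hu t ht]
  refine (intervalIntegral.norm_integral_le_of_norm_le ht.1 (Eventually.of_forall fun s hs =>
    hb s ⟨hs.1.le, hs.2.trans ht.2⟩) (i1.add i2)).trans ?_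
  rw [intervalIntegral.integral_add i1 i2, intervalIntegral.integral_const_mul]
  have : ∫ s in (0 : ℝ)..t, ρ s ≤ ∫ s in (0 : ℝ)..T, ρ s :=
    intervalIntegral.integral_mono_interval le_rfl ht.1 ht.2
      (by filter_upwards [ae_restrict_mem measurableSet_Ioc] with s hs
          exact hρ0 s ⟨hs.1.le, hs.2⟩) hρ
  linarith

/-- The source of the uniqueness statements: it is applied to the difference of two solutions. -/
theorem eq_zero_of_eq_integral {u k : ℝ → F} {C T : ℝ} (hC : 0 ≤ C)
    (hk : IntervalIntegrable k volume 0 T) (hu : ∀ t ∈ Icc (0 : ℝ) T, u t = ∫ s in (0 : ℝ)..t, k s)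
    (hb : ∀ s ∈ Icc (0 : ℝ) T, ‖k s‖ ≤ C * ‖u s‖) :
    ∀ t ∈ Icc (0 : ℝ) T, u t = 0 := by
  intro t ht
  have := norm_le_mul_exp_of_eq_integral (ρ := fun _ => 0) (A := 0) hC hk hu (by simp) (by simp)
    (by simp) (by simpa using hb) t ht
  simpa using this

/-- The product rule in integral form for primitives of bounded functions. -/
theorem bilin_eq_add_integral [CompleteSpace F] [CompleteSpace G] [CompleteSpace W]
    (B : F →L[ℝ] G →L[ℝ] W) {f f' : ℝ → F} {g g' : ℝ → G} {f₀ : F} {g₀ : G} {C : ℝ}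
    (hf' : IntervalIntegrable f' volume 0 1) (hg' : IntervalIntegrable g' volume 0 1)
    (hfC : ∀ s ∈ Icc (0 : ℝ) 1, ‖f' s‖ ≤ C) (hgC : ∀ s ∈ Icc (0 : ℝ) 1, ‖g' s‖ ≤ C)
    (hf : ∀ t ∈ Icc (0 : ℝ) 1, f t = f₀ + ∫ s in (0 : ℝ)..t, f' s)
    (hg : ∀ t ∈ Icc (0 : ℝ) 1, g t = g₀ + ∫ s in (0 : ℝ)..t, g' s) :
    ∀ t ∈ Icc (0 : ℝ) 1, B (f t) (g t) =
      B f₀ g₀ + ∫ s in (0 : ℝ)..t, (B (f' s) (g s) + B (f s) (g' s)) := by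
  have h01 : (0 : ℝ) ≤ 1 := zero_le_one
  have h0 : (0 : ℝ) ∈ Icc (0 : ℝ) 1 := ⟨le_rfl, h01⟩
  have hC : 0 ≤ C := (norm_nonneg _).trans (hfC 0 h0)
  have hfc : ContinuousOn f (Icc 0 1) :=
    (continuousOn_const.add (continuousOn_integral h01 hf')).congr hf
  have hgc : ContinuousOn g (Icc 0 1) :=
    (continuousOn_const.add (continuousOn_integral h01 hg')).congr hg
  obtain ⟨Mf, hMf⟩ := isCompact_Icc.exists_bound_of_continuousOn hfc
  obtain ⟨Mg, hMg⟩ := isCompact_Icc.exists_bound_of_continuousOn hgc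
  set k : ℝ → W := fun s => B (f' s) (g s) + B (f s) (g' s) with hk
  have hkC : ∀ s ∈ Icc (0 : ℝ) 1, ‖k s‖ ≤ ‖B‖ * C * Mg + ‖B‖ * Mf * C := by
    intro s hs
    refine (norm_add_le _ _).trans (add_le_add ?_ ?_)
    · refine (B.le_opNorm₂ _ _).trans ?_
      gcongr
      exacts [hfC s hs, hMg s hs]
    · refine (B.le_opNorm₂ _ _).trans ?_
      have : 0 ≤ Mf := (norm_nonneg _).trans (hMf s hs)
      gcongr
      exacts [hMf s hs, hgC s hs]
  have hki : IntervalIntegrable k volume 0 1 := by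
    refine intervalIntegrable_of_bound h01 ?_ hkC
    exact (B.aestronglyMeasurable_comp₂ (aestronglyMeasurable_of_intervalIntegrable h01 hf')
      (hgc.aestronglyMeasurable measurableSet_Icc)).add
      (B.aestronglyMeasurable_comp₂ (hfc.aestronglyMeasurable measurableSet_Icc)
      (aestronglyMeasurable_of_intervalIntegrable h01 hg'))
  set M := ‖B‖ * C * Mg + ‖B‖ * Mf * C with hM
  have hM0 : 0 ≤ M := (norm_nonneg _).trans (hkC 0 h0)
  -- The claim is that `h` is constant. It is written with the primitives instead of `f` and `g`,
  -- which are known only on [0,1], so that two-sided derivatives make sense. Boundedness of the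
  -- integrands makes `h` Lipschitz, hence absolutely continuous, and by Lebesgue differentiation
  -- its derivative vanishes almost everywhere.
  set h : ℝ → W := fun t => B (f₀ + ∫ s in (0 : ℝ)..t, f' s) (g₀ + ∫ s in (0 : ℝ)..t, g' s) -
    ∫ s in (0 : ℝ)..t, k s with hh
  have hheq : ∀ t ∈ Icc (0 : ℝ) 1, h t = B (f t) (g t) - ∫ s in (0 : ℝ)..t, k s := by
    intro t ht
    rw [hh, hf t ht, hg t ht]
  have hfl : ∀ s ∈ Icc (0 : ℝ) 1, ∀ t ∈ Icc (0 : ℝ) 1, ‖f t - f s‖ ≤ C * |t - s| := by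
    intro s hs t ht
    rw [hf t ht, hf s hs, add_sub_add_left_eq_sub]
    exact norm_integral_sub_integral_le hf' hfC hs ht
  have hgl : ∀ s ∈ Icc (0 : ℝ) 1, ∀ t ∈ Icc (0 : ℝ) 1, ‖g t - g s‖ ≤ C * |t - s| := by
    intro s hs t ht
    rw [hg t ht, hg s hs, add_sub_add_left_eq_sub]
    exact norm_integral_sub_integral_le hg' hgC hs ht
  have hlip : LipschitzOnWith (Real.toNNReal (M + M)) h (uIcc 0 1) := by
    rw [uIcc_of_le h01]
    refine LipschitzOnWith.of_dist_le_mul fun t ht s hs => ?_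
    rw [dist_eq_norm, Real.dist_eq, Real.coe_toNNReal _ (by positivity), hheq t ht, hheq s hs]
    have e : B (f t) (g t) - (∫ r in (0 : ℝ)..t, k r) - (B (f s) (g s) - ∫ r in (0 : ℝ)..s, k r) =
        (B (f t - f s) (g t) + B (f s) (g t - g s)) -
          ((∫ r in (0 : ℝ)..t, k r) - ∫ r in (0 : ℝ)..s, k r) := by
      simp only [map_sub, _root_.sub_apply]; abel
    rw [e, add_mul]
    refine (norm_sub_le _ _).trans (add_le_add ?_ (norm_integral_sub_integral_le hki hkC hs ht))
    rw [hM, add_mul]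
    refine (norm_add_le _ _).trans (add_le_add ?_ ?_)
    · refine (B.le_opNorm₂ _ _).trans ?_
      have := hfl s hs t ht
      have h2 := hMg t ht
      calc ‖B‖ * ‖f t - f s‖ * ‖g t‖ ≤ ‖B‖ * (C * |t - s|) * Mg := by gcongr
        _ = _ := by ring
    · refine (B.le_opNorm₂ _ _).trans ?_
      have := hgl s hs t ht
      have h2 := hMf s hs
      have : 0 ≤ Mf := (norm_nonneg _).trans h2
      calc ‖B‖ * ‖f s‖ * ‖g t - g s‖ ≤ ‖B‖ * Mf * (C * |t - s|) := by gcongr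
        _ = _ := by ring
  obtain ⟨c, hc⟩ := hlip.absolutelyContinuousOnInterval.const_of_ae_hasDerivAt_zero (by
    filter_upwards [hf'.ae_hasDerivAt_integral, hg'.ae_hasDerivAt_integral,
      hki.ae_hasDerivAt_integral] with t h1 h2 h3 ht
    have ht' : t ∈ Icc (0 : ℝ) 1 := by rwa [uIcc_of_le h01] at ht
    have d1 := (h1 ht 0 (by simp)).const_add f₀
    have d2 := (h2 ht 0 (by simp)).const_add g₀
    have d3 := h3 ht 0 (by simp)
    have d4 := (B.hasFDerivAt_of_bilinear d1.hasFDerivAt d2.hasFDerivAt).hasDerivAt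
    have d5 := d4.sub d3
    convert! d5 using 1
    simp [hk, hf t ht', hg t ht']
    abel)
  intro t ht
  have e1 := hc t (by rwa [uIcc_of_le h01])
  have e2 := hc 0 (by simp)
  rw [hheq t ht] at e1
  have e3 : h 0 = B f₀ g₀ := by simp [hh]
  rw [e3] at e2
  rw [e2, ← e1]; abel

end Primitive

/-! ### Linear systems with bounded measurable coefficients. -/

section Linear

variable {d : ℕ} {b : ℝ → EuclideanSpace ℝ (Fin d) →L[ℝ] EuclideanSpace ℝ (Fin d)} {C : ℝ}

theorem IsVolterraSolution.eqOn {a w₁ w₂ : ℝ → EuclideanSpace ℝ (Fin d)}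
    (hbC : ∀ s ∈ Icc (0 : ℝ) 1, ‖b s‖ ≤ C)
    (h₁ : IsVolterraSolution b a w₁) (h₂ : IsVolterraSolution b a w₂) :
    EqOn w₁ w₂ (Icc 0 1) := by
  intro t ht
  have hC : 0 ≤ C := (norm_nonneg _).trans (hbC t ht)
  have h0 : (0 : ℝ) ∈ Icc (0 : ℝ) 1 := by simp
  refine sub_eq_zero.1 (eq_zero_of_eq_integral (u := fun t => w₁ t - w₂ t) hC
    (h₁.integrable.sub h₂.integrable) ?_ ?_ t ht)
  · intro t ht
    rw [h₁.eq_integral t ht, h₂.eq_integral t ht, intervalIntegral.integral_sub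
      (intervalIntegrable_mono_Icc h₁.integrable h0 ht)
      (intervalIntegrable_mono_Icc h₂.integrable h0 ht)]
    abel
  · intro s hs
    rw [← map_sub]
    exact (b s).le_of_opNorm_le (hbC s hs) _

theorem IsFundamentalSolution.eqOn
    {Φ₁ Φ₂ : ℝ → EuclideanSpace ℝ (Fin d) →L[ℝ] EuclideanSpace ℝ (Fin d)}
    (hbC : ∀ s ∈ Icc (0 : ℝ) 1, ‖b s‖ ≤ C)
    (h₁ : IsFundamentalSolution b Φ₁) (h₂ : IsFundamentalSolution b Φ₂) :
    EqOn Φ₁ Φ₂ (Icc 0 1) := by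
  intro t ht
  have hC : 0 ≤ C := (norm_nonneg _).trans (hbC t ht)
  have h0 : (0 : ℝ) ∈ Icc (0 : ℝ) 1 := by simp
  refine sub_eq_zero.1 (eq_zero_of_eq_integral (u := fun t => Φ₁ t - Φ₂ t) hC
    (h₁.integrable.sub h₂.integrable) ?_ ?_ t ht)
  · intro t ht
    rw [h₁.eq_integral t ht, h₂.eq_integral t ht, intervalIntegral.integral_sub
      (intervalIntegrable_mono_Icc h₁.integrable h0 ht)
      (intervalIntegrable_mono_Icc h₂.integrable h0 ht)]
    abel
  · intro s hs
    rw [← ContinuousLinearMap.comp_sub]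
    refine (ContinuousLinearMap.opNorm_comp_le _ _).trans ?_
    gcongr
    exact hbC s hs

/-- The fundamental matrix of a linear system with bounded measurable coefficients, together with
its inverse. -/
theorem exists_isFundamentalSolution (hbm : AEStronglyMeasurable b (volume.restrict (Icc 0 1)))
    (hbC : ∀ s ∈ Icc (0 : ℝ) 1, ‖b s‖ ≤ C) :
    ∃ Φ Ψ : ℝ → EuclideanSpace ℝ (Fin d) →L[ℝ] EuclideanSpace ℝ (Fin d),
      Continuous Φ ∧ Continuous Ψ ∧ IsFundamentalSolution b Φ ∧
      (∀ t ∈ Icc (0 : ℝ) 1, Φ t * Ψ t = 1) ∧ ∀ t ∈ Icc (0 : ℝ) 1, Ψ t * Φ t = 1 := by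
  have h01 : (0 : ℝ) ≤ 1 := zero_le_one
  have hC : 0 ≤ C := (norm_nonneg _).trans (hbC 0 (by simp))
  let m := ContinuousLinearMap.compL ℝ (EuclideanSpace ℝ (Fin d)) (EuclideanSpace ℝ (Fin d))
    (EuclideanSpace ℝ (Fin d))
  have hint : ∀ y : ℝ → EuclideanSpace ℝ (Fin d) →L[ℝ] EuclideanSpace ℝ (Fin d), Continuous y →
      IntervalIntegrable (fun s => b s * y s) volume 0 1 ∧
      IntervalIntegrable (fun s => - (y s * b s)) volume 0 1 ∧
      ∃ M, ∀ s ∈ Icc (0 : ℝ) 1, ‖b s * y s‖ ≤ M ∧ ‖-(y s * b s)‖ ≤ M := by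
    intro y hy
    obtain ⟨M, hM⟩ := isCompact_Icc.exists_bound_of_continuousOn (hy.continuousOn (s := Icc 0 1))
    have hb1 : ∀ s ∈ Icc (0 : ℝ) 1, ‖b s * y s‖ ≤ C * M := fun s hs =>
      (norm_mul_le _ _).trans (mul_le_mul (hbC s hs) (hM s hs) (norm_nonneg _) hC)
    have hb2 : ∀ s ∈ Icc (0 : ℝ) 1, ‖-(y s * b s)‖ ≤ C * M := fun s hs => by
      rw [norm_neg, mul_comm C]
      exact (norm_mul_le _ _).trans (mul_le_mul (hM s hs) (hbC s hs) (norm_nonneg _)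
        ((norm_nonneg _).trans (hM s hs)))
    refine ⟨intervalIntegrable_of_bound h01 ?_ hb1, intervalIntegrable_of_bound h01 ?_ hb2,
      C * M, fun s hs => ⟨hb1 s hs, hb2 s hs⟩⟩
    · exact m.aestronglyMeasurable_comp₂ hbm hy.aestronglyMeasurable
    · exact (m.aestronglyMeasurable_comp₂ hy.aestronglyMeasurable hbm).neg
  obtain ⟨Φ, hΦc, hΦ⟩ := exists_continuous_eq_add_integral (f := fun s y => b s * y) h01 hC
    (fun y hy => (hint y hy).1)
    (fun s hs y z => by
      rw [← mul_sub]
      exact (norm_mul_le _ _).trans (mul_le_mul_of_nonneg_right (hbC s hs) (norm_nonneg _))) 1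
  -- The inverse is constructed as the solution of the adjoint equation Ψ' = -Ψb; the product rule
  -- then gives (ΨΦ)' = -ΨbΦ + ΨbΦ = 0.
  obtain ⟨Ψ, hΨc, hΨ⟩ := exists_continuous_eq_add_integral (f := fun s y => -(y * b s)) h01 hC
    (fun y hy => (hint y hy).2.1)
    (fun s hs y z => by
      rw [neg_sub_neg, ← sub_mul, mul_comm C, norm_sub_rev y z]
      exact (norm_mul_le _ _).trans (mul_le_mul_of_nonneg_left (hbC s hs) (norm_nonneg _))) 1
  obtain ⟨i1, -, M1, hM1⟩ := hint Φ hΦc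
  obtain ⟨-, i2, M2, hM2⟩ := hint Ψ hΨc
  have hΨΦ : ∀ t ∈ Icc (0 : ℝ) 1, Ψ t * Φ t = 1 := by
    intro t ht
    have := bilin_eq_add_integral m (C := max M1 M2) i2 i1
      (fun s hs => (hM2 s hs).2.trans (le_max_right _ _))
      (fun s hs => (hM1 s hs).1.trans (le_max_left _ _)) hΨ hΦ t ht
    rw [show (fun s => m (-(Ψ s * b s)) (Φ s) + m (Ψ s) (b s * Φ s)) = fun _ => 0 from
      funext fun s => by
        ext1 v
        exact neg_add_cancel _, intervalIntegral.integral_zero, add_zero] at this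
    exact this
  refine ⟨Φ, Ψ, hΦc, hΨc, ⟨i1, hΦ⟩, fun t ht => ?_, hΨΦ⟩
  -- In finite dimension a left inverse is a right inverse; the passage to plain linear maps is made
  -- to use this.
  have h1 : (Ψ t : EuclideanSpace ℝ (Fin d) →ₗ[ℝ] EuclideanSpace ℝ (Fin d)) * (Φ t) = 1 := by
    ext1 v
    exact congrArg (fun A : EuclideanSpace ℝ (Fin d) →L[ℝ] EuclideanSpace ℝ (Fin d) => A v)
      (hΨΦ t ht)
  have h2 := mul_eq_one_comm.1 h1
  ext1 v
  exact congrArg (fun A : EuclideanSpace ℝ (Fin d) →ₗ[ℝ] EuclideanSpace ℝ (Fin d) => A v) h2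

/-- Variation of constants. -/
theorem IsFundamentalSolution.isVolterraSolution
    {Φ Ψ : ℝ → EuclideanSpace ℝ (Fin d) →L[ℝ] EuclideanSpace ℝ (Fin d)}
    {a : ℝ → EuclideanSpace ℝ (Fin d)} {A : ℝ}
    (hbC : ∀ s ∈ Icc (0 : ℝ) 1, ‖b s‖ ≤ C) (hΦ : IsFundamentalSolution b Φ)
    (hΦc : Continuous Φ) (hΨc : Continuous Ψ) (hΦΨ : ∀ t ∈ Icc (0 : ℝ) 1, Φ t * Ψ t = 1)
    (ha : IntervalIntegrable a volume 0 1) (haA : ∀ s ∈ Icc (0 : ℝ) 1, ‖a s‖ ≤ A) :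
    IntervalIntegrable (fun s => Ψ s (a s)) volume 0 1 ∧
      IsVolterraSolution b a (fun t => Φ t (∫ s in (0 : ℝ)..t, Ψ s (a s))) := by
  have h01 : (0 : ℝ) ≤ 1 := zero_le_one
  have h0 : (0 : ℝ) ∈ Icc (0 : ℝ) 1 := by simp
  have hC : 0 ≤ C := (norm_nonneg _).trans (hbC 0 h0)
  let ev := ContinuousLinearMap.id ℝ (EuclideanSpace ℝ (Fin d) →L[ℝ] EuclideanSpace ℝ (Fin d))
  obtain ⟨MΦ, hMΦ⟩ := isCompact_Icc.exists_bound_of_continuousOn (hΦc.continuousOn (s := Icc 0 1))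
  obtain ⟨MΨ, hMΨ⟩ := isCompact_Icc.exists_bound_of_continuousOn (hΨc.continuousOn (s := Icc 0 1))
  have hΨb : ∀ s ∈ Icc (0 : ℝ) 1, ‖Ψ s (a s)‖ ≤ MΨ * A := fun s hs =>
    (Ψ s).le_of_opNorm_le_of_le (hMΨ s hs) (haA s hs)
  have hΨi : IntervalIntegrable (fun s => Ψ s (a s)) volume 0 1 :=
    intervalIntegrable_of_bound h01 (ev.aestronglyMeasurable_comp₂ hΨc.aestronglyMeasurable
      (aestronglyMeasurable_of_intervalIntegrable h01 ha)) hΨb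
  have hΦb : ∀ s ∈ Icc (0 : ℝ) 1, ‖b s ∘L Φ s‖ ≤ C * MΦ := fun s hs =>
    (ContinuousLinearMap.opNorm_comp_le _ _).trans
      (mul_le_mul (hbC s hs) (hMΦ s hs) (norm_nonneg _) hC)
  set g : ℝ → EuclideanSpace ℝ (Fin d) := fun t => ∫ s in (0 : ℝ)..t, Ψ s (a s) with hg
  have hgc : ContinuousOn g (Icc 0 1) := continuousOn_integral h01 hΨi
  obtain ⟨Mg, hMg⟩ := isCompact_Icc.exists_bound_of_continuousOn hgc
  have hbg : IntervalIntegrable (fun s => b s (Φ s (g s))) volume 0 1 := by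
    refine intervalIntegrable_of_bound (C := C * MΦ * Mg) h01 ?_ fun s hs =>
      (b s ∘L Φ s).le_of_opNorm_le_of_le (hΦb s hs) (hMg s hs)
    exact ev.aestronglyMeasurable_comp₂ (f := fun s => b s ∘L Φ s)
      (aestronglyMeasurable_of_intervalIntegrable h01 hΦ.integrable)
      (hgc.aestronglyMeasurable measurableSet_Icc)
  refine ⟨hΨi, ha, hbg, fun t ht => ?_⟩
  -- Product rule for Φ(t)g(t) with g' = Ψa: the derivative is bΦg + ΦΨa = b(Φg) + a.
  have key := bilin_eq_add_integral ev (C := max (C * MΦ) (MΨ * A)) hΦ.integrable hΨi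
    (g := g) (g₀ := 0) (fun s hs => (hΦb s hs).trans (le_max_left _ _))
    (fun s hs => (hΨb s hs).trans (le_max_right _ _)) hΦ.eq_integral
    (fun t _ => by rw [zero_add]) t ht
  change Φ t (g t) = _
  change Φ t (g t) = _ at key
  rw [key, ← intervalIntegral.integral_add (intervalIntegrable_mono_Icc ha h0 ht)
    (intervalIntegrable_mono_Icc hbg h0 ht)]
  rw [map_zero, zero_add]
  refine intervalIntegral.integral_congr fun s hs => ?_
  rw [uIcc_of_le ht.1] at hs
  have : Φ s (Ψ s (a s)) = a s :=
    congrArg (fun A : EuclideanSpace ℝ (Fin d) →L[ℝ] EuclideanSpace ℝ (Fin d) => A (a s))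
      (hΦΨ s ⟨hs.1, hs.2.trans ht.2⟩)
  change b s (Φ s (g s)) + Φ s (Ψ s (a s)) = a s + b s (Φ s (g s))
  rw [this, add_comm]

end Linear

end RectifiedFlow

namespace RectifiedFlow

/-! ### Cores of a convex set, a decay estimate, and metric projection. -/

/-- The points of `Ω` whose closed ball of radius `ρ` is contained in `Ω`. -/
def core {E : Type*} [NormedAddCommGroup E] (Ω : Set E) (ρ : ℝ) : Set E :=
  {z | ∀ e, ‖e‖ ≤ ρ → z + e ∈ Ω}

section Core

variable {E : Type*} [NormedAddCommGroup E] {Ω : Set E} {ρ : ℝ}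

theorem core_subset (hρ : 0 ≤ ρ) : core Ω ρ ⊆ Ω := fun z hz => by
  simpa using hz 0 (by simpa using hρ)

theorem core_anti {ρ' : ℝ} (h : ρ ≤ ρ') : core Ω ρ' ⊆ core Ω ρ :=
  fun _ hz e he => hz e (he.trans h)

theorem isClosed_core (hΩ : IsClosed Ω) : IsClosed (core Ω ρ) := by
  have : core Ω ρ = ⋂ (e : E) (_ : ‖e‖ ≤ ρ), (fun z => z + e) ⁻¹' Ω := by
    ext z; simp [core]
  rw [this]
  exact isClosed_iInter fun e => isClosed_iInter fun _ => hΩ.preimage (by fun_prop)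

/-- Margin can be spent on displacement. This is how perturbed trajectories near a path are kept
inside a core on which the estimates hold. -/
theorem mem_core_of_norm_sub_le {ρ' : ℝ} {z z' : E} (hz : z ∈ core Ω (ρ + ρ'))
    (h : ‖z' - z‖ ≤ ρ') : z' ∈ core Ω ρ := fun e he => by
  have := hz (e + (z' - z)) ((norm_add_le _ _).trans (add_le_add he h))
  convert this using 1
  abel

theorem core_subset_interior (hρ : 0 < ρ) : core Ω ρ ⊆ interior Ω := fun z hz => by
  rw [mem_interior_iff_mem_nhds]
  refine mem_of_superset (Metric.closedBall_mem_nhds z hρ) fun w hw => ?_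
  have := hz (w - z) (by rwa [← dist_eq_norm])
  simpa using this

theorem exists_mem_core_of_mem_interior {z : E} (hz : z ∈ interior Ω) :
    ∃ ρ > 0, z ∈ core Ω ρ := by
  obtain ⟨ρ, hρ, h⟩ := Metric.nhds_basis_closedBall.mem_iff.1 (mem_interior_iff_mem_nhds.1 hz)
  exact ⟨ρ, hρ, fun e he => h (by simpa using he)⟩

theorem exists_subset_core {K : Set E} (hK : IsCompact K) (h : K ⊆ interior Ω) :
    ∃ ρ > 0, K ⊆ core Ω ρ := by
  obtain ⟨ρ, hρ, h⟩ := hK.exists_cthickening_subset_open isOpen_interior h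
  refine ⟨ρ, hρ, fun z hz e he => interior_subset (h ?_)⟩
  exact Metric.mem_cthickening_of_dist_le _ _ _ _ hz (by simpa using he)

variable [NormedSpace ℝ E]

theorem convex_core (hΩ : Convex ℝ Ω) : Convex ℝ (core Ω ρ) := by
  intro z hz z' hz' a b ha hb hab e he
  have := hΩ (hz e he) (hz' e he) ha hb hab
  convert this using 1
  rw [smul_add, smul_add, add_add_add_comm, ← add_smul, hab, one_smul]

/-- The supremum of f over the ball of radius ρ is ρ‖f‖. With the converse below, this describes the
core of a closed convex set by half-spaces pushed inwards, so that membership can be tested one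
functional at a time. -/
theorem add_mul_norm_le_of_mem_core {z : E} (hρ : 0 ≤ ρ) (hz : z ∈ core Ω ρ)
    {f : StrongDual ℝ E} {c : ℝ} (hf : ∀ y ∈ Ω, f y ≤ c) : f z + ρ * ‖f‖ ≤ c := by
  rcases hρ.eq_or_lt with rfl | hρ
  · simpa using hf z (core_subset le_rfl hz)
  have h1 : ∀ e, ‖e‖ ≤ ρ → f e ≤ c - f z := fun e he => by
    have := hf _ (hz e he); rw [map_add] at this; linarith
  have h0 : 0 ≤ c - f z := by simpa using h1 0 (by simpa using hρ.le)
  have h2 : ∀ e, f e ≤ (c - f z) / ρ * ‖e‖ := by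
    intro e
    rcases eq_or_ne e 0 with rfl | he
    · simp
    have hn : 0 < ‖e‖ := norm_pos_iff.2 he
    have := h1 ((ρ / ‖e‖) • e) (by
      rw [norm_smul, Real.norm_of_nonneg (by positivity), div_mul_cancel₀ _ hn.ne'])
    rw [map_smul, smul_eq_mul] at this
    rw [div_mul_eq_mul_div, le_div_iff₀ hρ]
    rw [div_mul_eq_mul_div, div_le_iff₀ hn] at this
    linarith
  have h3 : ‖f‖ ≤ (c - f z) / ρ := by
    refine f.opNorm_le_bound (by positivity) fun e => ?_
    rw [Real.norm_eq_abs, abs_le]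
    have := h2 (-e)
    rw [map_neg, norm_neg] at this
    exact ⟨by linarith, h2 e⟩
  rw [le_div_iff₀ hρ] at h3
  linarith

/-- If z + e were outside Ω, Hahn–Banach separation would give a half-space containing Ω in which z
has too little slack. -/
theorem mem_core_of_forall_dual (hΩc : IsClosed Ω) (hΩ : Convex ℝ Ω) {z : E}
    (h : ∀ (f : StrongDual ℝ E) (c : ℝ), (∀ y ∈ Ω, f y ≤ c) → f z + ρ * ‖f‖ ≤ c) :
    z ∈ core Ω ρ := by
  intro e he
  by_contra hne
  obtain ⟨f, u, hu, hfu⟩ := geometric_hahn_banach_closed_point hΩ hΩc hne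
  have h1 := h f u fun y hy => (hu y hy).le
  have h2 : f e ≤ ‖f‖ * ρ :=
    (le_abs_self _).trans ((f.le_opNorm e).trans (mul_le_mul_of_nonneg_left he (norm_nonneg _)))
  rw [map_add] at hfu
  linarith

end Core

/-- A continuous `u` with `u' ≥ -u / (1 - t)`, in integrated form, dominates `(1 - t) u(0)`. -/
theorem one_sub_mul_le_of_sub_ge_integral {u : ℝ → ℝ} {T : ℝ} (hT : T < 1)
    (hu : ContinuousOn u (Icc 0 T))
    (h : ∀ s ∈ Icc (0 : ℝ) T, ∀ t ∈ Icc s T, -∫ r in s..t, u r / (1 - r) ≤ u t - u s) :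
    ∀ t ∈ Icc (0 : ℝ) T, (1 - t) * u 0 ≤ u t := by
  intro t ht
  have hw : ContinuousOn (fun r => u r / (1 - r)) (Icc 0 T) :=
    hu.div (by fun_prop) fun r hr => by linarith [hr.2]
  -- Let s maximize u(r)/(1 - r) on [0,t]. On [s,t] the integrand is at most its value at s, so u(t)
  -- ≥ u(s) - (t - s)u(s)/(1 - s) = (1 - t)u(s)/(1 - s), and this is at least (1 - t)u(0).
  obtain ⟨s, hs, hmax⟩ := isCompact_Icc.exists_isMaxOn (nonempty_Icc.2 ht.1)
    (hw.mono (Icc_subset_Icc le_rfl ht.2))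
  have h1s : 0 < 1 - s := by linarith [hs.2, ht.2]
  have h1t : 0 < 1 - t := by linarith [ht.2]
  have hst := h s ⟨hs.1, hs.2.trans ht.2⟩ t ⟨hs.2, ht.2⟩
  have hI : ∫ r in s..t, u r / (1 - r) ≤ (t - s) * (u s / (1 - s)) := by
    have h1 : IntervalIntegrable (fun r => u r / (1 - r)) volume s t := by
      apply ContinuousOn.intervalIntegrable
      rw [uIcc_of_le hs.2]
      exact hw.mono (Icc_subset_Icc hs.1 ht.2)
    have := intervalIntegral.integral_mono_on hs.2 h1
      (_root_.intervalIntegrable_const (c := u s / (1 - s)))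
      (fun r hr => hmax ⟨hs.1.trans hr.1, hr.2⟩)
    rwa [intervalIntegral.integral_const, smul_eq_mul] at this
  have h0 : u 0 ≤ u s / (1 - s) := by simpa using hmax (show (0 : ℝ) ∈ Icc 0 t from ⟨le_rfl, ht.1⟩)
  have hus : u s = (1 - s) * (u s / (1 - s)) := by field_simp
  have : (1 - t) * (u s / (1 - s)) ≤ u t := by
    have e : (1 - t) * (u s / (1 - s)) = u s - (t - s) * (u s / (1 - s)) := by
      nth_rw 2 [hus]; ring
    linarith
  exact (mul_le_mul_of_nonneg_left h0 h1t.le).trans this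

section Projection

variable {E : Type*} [NormedAddCommGroup E] [InnerProductSpace ℝ E]

/-- A non-empty complete convex set of an inner product space is a 1-Lipschitz retract. -/
theorem exists_lipschitz_retraction {K : Set E} (hne : K.Nonempty) (hc : IsComplete K)
    (hK : Convex ℝ K) :
    ∃ π : E → E, (∀ y, π y ∈ K) ∧ (∀ y ∈ K, π y = y) ∧ ∀ y z, ‖π y - π z‖ ≤ ‖y - z‖ := by
  -- The retraction is the nearest-point map. Adding its obtuse-angle inequalities at y and at z
  -- gives ‖π y - π z‖² ≤ ⟪y - z, π y - π z⟫, and Cauchy–Schwarz finishes.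
  choose π hπ using exists_norm_eq_iInf_of_complete_convex hne hc hK
  have hin : ∀ y, ∀ w ∈ K, inner ℝ (y - π y) (w - π y) ≤ 0 := fun y =>
    (norm_eq_iInf_iff_real_inner_le_zero hK (hπ y).1).1 (hπ y).2
  refine ⟨π, fun y => (hπ y).1, fun y hy => ?_, fun y z => ?_⟩
  · have := hin y y hy
    rw [real_inner_self_eq_norm_sq] at this
    have : ‖y - π y‖ = 0 := by nlinarith [norm_nonneg (y - π y)]
    exact (sub_eq_zero.1 (norm_eq_zero.1 this)).symm
  · have h1 := hin y (π z) (hπ z).1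
    have h2 := hin z (π y) (hπ y).1
    have h3 : ‖π y - π z‖ ^ 2 ≤ inner ℝ (y - z) (π y - π z) := by
      rw [← real_inner_self_eq_norm_sq]
      have e1 : inner ℝ (y - π y) (π z - π y) = - inner ℝ (y - π y) (π y - π z) := by
        rw [← inner_neg_right, neg_sub]
      have e2 : inner ℝ (y - z) (π y - π z) = inner ℝ (π y - π z) (π y - π z) +
          inner ℝ (y - π y) (π y - π z) - inner ℝ (z - π z) (π y - π z) := by
        rw [← inner_add_left, ← inner_sub_left]; congr 1; abel
      linarith
    have h4 := real_inner_le_norm (y - z) (π y - π z)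
    by_contra hlt
    push Not at hlt
    nlinarith [norm_nonneg (y - z), norm_nonneg (π y - π z)]

end Projection

end RectifiedFlow

namespace RectifiedFlow

/-! ### Geometry of the sets S_t(z), and integrals over them. -/

section Admissible

variable {d : ℕ} {Ω : Set (EuclideanSpace ℝ (Fin d))} {t ρ D : ℝ}
  {z z' : EuclideanSpace ℝ (Fin d)}

theorem isClosed_admissible (hΩ : IsClosed Ω) : IsClosed (admissible Ω t z) :=
  (hΩ.preimage (f := fun δ => z - t • δ) (by fun_prop)).inter
    (hΩ.preimage (f := fun δ => z + (1 - t) • δ) (by fun_prop))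

theorem convex_admissible (hΩ : Convex ℝ Ω) : Convex ℝ (admissible Ω t z) := by
  intro δ hδ δ' hδ' a b ha hb hab
  have hz : a • z + b • z = z := by rw [← add_smul, hab, one_smul]
  constructor
  · convert hΩ hδ.1 hδ'.1 ha hb hab using 1
    nth_rw 1 [← hz]
    module
  · convert hΩ hδ.2 hδ'.2 ha hb hab using 1
    nth_rw 1 [← hz]
    module

theorem admissible_subset_closedBall (hD : ∀ x ∈ Ω, ∀ y ∈ Ω, ‖x - y‖ ≤ D) :
    admissible Ω t z ⊆ Metric.closedBall 0 D := by
  intro δ hδ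
  have := hD _ hδ.2 _ hδ.1
  rw [mem_closedBall_zero_iff]
  rwa [show z + (1 - t) • δ - (z - t • δ) = δ by module] at this

theorem closedBall_subset_admissible (ht : t ∈ Icc (0 : ℝ) 1) (hz : z ∈ core Ω ρ) :
    Metric.closedBall 0 ρ ⊆ admissible Ω t z := by
  intro δ hδ
  rw [mem_closedBall_zero_iff] at hδ
  have h1 : ∀ c : ℝ, |c| ≤ 1 → ‖c • δ‖ ≤ ρ := fun c hc => by
    rw [norm_smul, Real.norm_eq_abs]
    exact (mul_le_of_le_one_left (norm_nonneg _) hc).trans hδ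
  refine ⟨?_, hz _ (h1 _ (by rw [abs_of_nonneg] <;> linarith [ht.1, ht.2]))⟩
  rw [sub_eq_add_neg, ← neg_smul]
  exact hz _ (h1 _ (by rw [abs_neg, abs_of_nonneg ht.1]; exact ht.2))

/-- With l = ‖z' - z‖/ρ, the point z' equals (1 - l)z + lw for some w in the ρ-ball about z, hence
in Ω. Contracting both endpoints of the chord at z towards w by the factor 1 - l gives a chord
through z' with direction (1 - l)δ. -/
theorem smul_mem_admissible (hΩ : Convex ℝ Ω) (hρ : 0 < ρ) (hz : z ∈ core Ω ρ)
    (h : ‖z' - z‖ ≤ ρ) {δ : EuclideanSpace ℝ (Fin d)} (hδ : δ ∈ admissible Ω t z) :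
    (1 - ‖z' - z‖ / ρ) • δ ∈ admissible Ω t z' := by
  rcases eq_or_ne z' z with rfl | hne
  · simpa using hδ
  set l := ‖z' - z‖ / ρ with hl
  have hn : 0 < ‖z' - z‖ := norm_pos_iff.2 (sub_ne_zero.2 hne)
  have hl0 : 0 < l := div_pos hn hρ
  have hl1 : l ≤ 1 := (div_le_one hρ).2 h
  have hw : z + l⁻¹ • (z' - z) ∈ Ω := hz _ (by
    rw [norm_smul, Real.norm_of_nonneg (by positivity), hl, inv_div, div_mul_cancel₀ _ hn.ne'])
  have e : z' = (1 - l) • z + l • (z + l⁻¹ • (z' - z)) := by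
    rw [smul_add, smul_smul, mul_inv_cancel₀ hl0.ne']
    module
  constructor
  · convert hΩ hδ.1 hw (sub_nonneg.2 hl1) hl0.le (by ring) using 1
    nth_rw 1 [e]
    module
  · convert hΩ hδ.2 hw (sub_nonneg.2 hl1) hl0.le (by ring) using 1
    nth_rw 1 [e]
    module

theorem volume_admissible_ne_top (hD : ∀ x ∈ Ω, ∀ y ∈ Ω, ‖x - y‖ ≤ D) :
    volume (admissible Ω t z) ≠ ∞ :=
  measure_ne_top_of_subset (admissible_subset_closedBall hD) measure_closedBall_lt_top.ne

-- The contracted set (1 - l)S_t(z) lies in both sets and has volume (1 - l)^d times that of S_t(z);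
-- Bernoulli's inequality bounds what is lost.
open scoped Pointwise in
theorem volume_admissible_diff_le (hΩc : IsClosed Ω) (hΩ : Convex ℝ Ω)
    (hD : ∀ x ∈ Ω, ∀ y ∈ Ω, ‖x - y‖ ≤ D) (hρ : 0 < ρ) (hz : z ∈ core Ω ρ)
    (h : ‖z' - z‖ ≤ ρ) :
    volume.real (admissible Ω t z \ admissible Ω t z') ≤
      d * (‖z' - z‖ / ρ) * volume.real (admissible Ω t z) := by
  set l := ‖z' - z‖ / ρ with hl
  have hl0 : 0 ≤ l := by positivity
  have hl1 : l ≤ 1 := (div_le_one hρ).2 h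
  set S := admissible Ω t z with hS
  have hzΩ : z ∈ Ω := core_subset hρ.le hz
  have h0 : (0 : EuclideanSpace ℝ (Fin d)) ∈ S := by simp [hS, admissible, hzΩ]
  have hsub : (1 - l) • S ⊆ S ∩ admissible Ω t z' := by
    rintro _ ⟨δ, hδ, rfl⟩
    refine ⟨?_, smul_mem_admissible hΩ hρ hz h hδ⟩
    have := convex_admissible hΩ hδ h0 (sub_nonneg.2 hl1) hl0 (by ring)
    simpa using this
  have hfin : volume S ≠ ∞ := volume_admissible_ne_top hD
  have hSm : MeasurableSet S := (isClosed_admissible hΩc).measurableSet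
  have h1 : volume.real (S \ admissible Ω t z') = volume.real S -
      volume.real (S ∩ admissible Ω t z') := by
    rw [← measureReal_inter_add_sdiff (s := S)
      (isClosed_admissible hΩc (t := t) (z := z')).measurableSet hfin]
    ring
  have h2 : (1 - l) ^ d * volume.real S ≤ volume.real (S ∩ admissible Ω t z') := by
    have := measureReal_mono hsub (measure_ne_top_of_subset inter_subset_left hfin)
    rw [Measure.real, Measure.addHaar_smul, ENNReal.toReal_mul, ENNReal.toReal_ofReal (abs_nonneg _),
      abs_of_nonneg (pow_nonneg (sub_nonneg.2 hl1) _)] at this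
    simpa [Measure.real] using this
  have h3 : 1 - d * l ≤ (1 - l) ^ d := by
    have := one_add_mul_le_pow (a := -l) (by linarith) d
    rw [← sub_eq_add_neg] at this
    linarith
  have h4 := mul_le_mul_of_nonneg_right h3 (measureReal_nonneg (μ := volume) (s := S))
  rw [h1]
  linarith

end Admissible

/-- A measurable kernel that, on `Ω × Ω`, is bounded by `A` and Lipschitz with constant `B` along
simultaneous translations of both variables. -/
structure ChordKernel {d : ℕ} (Ω : Set (EuclideanSpace ℝ (Fin d)))
    (H : EuclideanSpace ℝ (Fin d) → EuclideanSpace ℝ (Fin d) → ℝ) (A B : ℝ) : Prop where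
  measurable : Measurable (Function.uncurry H)
  nonneg : 0 ≤ B
  bound : ∀ x ∈ Ω, ∀ y ∈ Ω, |H x y| ≤ A
  lipschitz : ∀ h, ∀ x ∈ Ω, ∀ y ∈ Ω, x + h ∈ Ω → y + h ∈ Ω → |H (x + h) (y + h) - H x y| ≤ B * ‖h‖

/-- The integral of `H(z - tδ, z + (1-t)δ) F(δ)` over `δ ∈ S_t(z)`. -/
noncomputable def chordIntegral {d : ℕ} {G : Type*} [NormedAddCommGroup G] [NormedSpace ℝ G]
    (Ω : Set (EuclideanSpace ℝ (Fin d)))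
    (H : EuclideanSpace ℝ (Fin d) → EuclideanSpace ℝ (Fin d) → ℝ)
    (F : EuclideanSpace ℝ (Fin d) → G) (t : ℝ) (z : EuclideanSpace ℝ (Fin d)) : G :=
  ∫ δ in admissible Ω t z, H (z - t • δ) (z + (1 - t) • δ) • F δ

section Chord

variable {d : ℕ} {G : Type*} [NormedAddCommGroup G] [NormedSpace ℝ G]
  {Ω : Set (EuclideanSpace ℝ (Fin d))}
  {H : EuclideanSpace ℝ (Fin d) → EuclideanSpace ℝ (Fin d) → ℝ}
  {F : EuclideanSpace ℝ (Fin d) → G} {A B D M t ρ : ℝ}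
  {z z' : EuclideanSpace ℝ (Fin d)}

theorem ChordKernel.integrableOn (hH : ChordKernel Ω H A B) (hΩc : IsClosed Ω)
    (hD : ∀ x ∈ Ω, ∀ y ∈ Ω, ‖x - y‖ ≤ D) (hF : StronglyMeasurable F)
    (hM : ∀ δ, ‖δ‖ ≤ D → ‖F δ‖ ≤ M) :
    IntegrableOn (fun δ => H (z - t • δ) (z + (1 - t) • δ) • F δ) (admissible Ω t z) := by
  refine IntegrableOn.of_bound (volume_admissible_ne_top hD).lt_top ?_ (A * M) ?_
  · have : Measurable fun δ : EuclideanSpace ℝ (Fin d) => H (z - t • δ) (z + (1 - t) • δ) :=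
      hH.measurable.comp (f := fun δ => (z - t • δ, z + (1 - t) • δ)) (by fun_prop)
    exact (this.stronglyMeasurable.smul hF).aestronglyMeasurable
  · filter_upwards [ae_restrict_mem (isClosed_admissible hΩc).measurableSet] with δ hδ
    have h1 := hH.bound _ hδ.1 _ hδ.2
    rw [norm_smul]
    exact mul_le_mul h1 (hM _ (by simpa using admissible_subset_closedBall hD hδ))
      (norm_nonneg _) ((abs_nonneg _).trans h1)

theorem norm_setIntegral_le_of_subset_admissible (hH : ChordKernel Ω H A B)
    (hD : ∀ x ∈ Ω, ∀ y ∈ Ω, ‖x - y‖ ≤ D)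
    (hM : ∀ δ, ‖δ‖ ≤ D → ‖F δ‖ ≤ M) {U : Set (EuclideanSpace ℝ (Fin d))}
    (hU : U ⊆ admissible Ω t z) :
    ‖∫ δ in U, H (z - t • δ) (z + (1 - t) • δ) • F δ‖ ≤ A * M * volume.real U := by
  refine norm_setIntegral_le_of_norm_le_const
    (measure_lt_top_of_subset hU (volume_admissible_ne_top hD)) fun δ hδ => ?_
  have h1 := hH.bound _ (hU hδ).1 _ (hU hδ).2
  rw [norm_smul]
  exact mul_le_mul h1 (hM _ (by simpa using admissible_subset_closedBall hD (hU hδ)))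
    (norm_nonneg _) ((abs_nonneg _).trans h1)

theorem ChordKernel.norm_chordIntegral_le (hH : ChordKernel Ω H A B) (hA : 0 ≤ A) (hM0 : 0 ≤ M)
    (hD : ∀ x ∈ Ω, ∀ y ∈ Ω, ‖x - y‖ ≤ D)
    (hM : ∀ δ, ‖δ‖ ≤ D → ‖F δ‖ ≤ M) :
    ‖chordIntegral Ω H F t z‖ ≤
      A * M * volume.real (Metric.closedBall (0 : EuclideanSpace ℝ (Fin d)) D) := by
  refine (norm_setIntegral_le_of_subset_admissible hH hD hM subset_rfl).trans ?_
  have hAM : 0 ≤ A * M := mul_nonneg hA hM0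
  exact mul_le_mul_of_nonneg_left
    (measureReal_mono (admissible_subset_closedBall hD) measure_closedBall_lt_top.ne) hAM

/-- On the common part of S_t(z) and S_t(z') the same δ is used, so both arguments of the kernel
move by z' - z and `B` applies. On the two set differences only the bound `A` and the small volume
are used. -/
theorem ChordKernel.norm_chordIntegral_sub_le (hH : ChordKernel Ω H A B) (hA : 0 ≤ A)
    (hM0 : 0 ≤ M) (hΩc : IsClosed Ω) (hΩ : Convex ℝ Ω) (hD : ∀ x ∈ Ω, ∀ y ∈ Ω, ‖x - y‖ ≤ D)
    (hF : StronglyMeasurable F) (hM : ∀ δ, ‖δ‖ ≤ D → ‖F δ‖ ≤ M) (hρ : 0 < ρ)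
    (hz : z ∈ core Ω ρ) (hz' : z' ∈ core Ω ρ) :
    ‖chordIntegral Ω H F t z' - chordIntegral Ω H F t z‖ ≤
      M * volume.real (Metric.closedBall (0 : EuclideanSpace ℝ (Fin d)) D) *
        (B + 2 * A * (d + 1) / ρ) * ‖z' - z‖ := by
  set V := volume.real (Metric.closedBall (0 : EuclideanSpace ℝ (Fin d)) D) with hV
  have hV0 : 0 ≤ V := measureReal_nonneg
  have hB := hH.nonneg
  rcases le_or_gt ‖z' - z‖ ρ with hle | hgt
  · set S := admissible Ω t z with hS
    set S' := admissible Ω t z' with hS'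
    have hSV : ∀ w, volume.real (admissible Ω t w) ≤ V := fun w =>
      measureReal_mono (admissible_subset_closedBall hD) measure_closedBall_lt_top.ne
    have hSm : MeasurableSet S := (isClosed_admissible hΩc).measurableSet
    have hSm' : MeasurableSet S' := (isClosed_admissible hΩc).measurableSet
    set f := fun δ => H (z - t • δ) (z + (1 - t) • δ) • F δ with hf
    set f' := fun δ => H (z' - t • δ) (z' + (1 - t) • δ) • F δ with hf'
    have hi : IntegrableOn f S := hH.integrableOn hΩc hD hF hM
    have hi' : IntegrableOn f' S' := hH.integrableOn hΩc hD hF hM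
    have e1 : chordIntegral Ω H F t z = (∫ δ in S ∩ S', f δ) + ∫ δ in S \ S', f δ :=
      (integral_inter_add_sdiff hSm' hi).symm
    have e2 : chordIntegral Ω H F t z' = (∫ δ in S ∩ S', f' δ) + ∫ δ in S' \ S, f' δ := by
      rw [inter_comm]; exact (integral_inter_add_sdiff hSm hi').symm
    have hdiff : ∀ w w', w ∈ core Ω ρ → ‖w' - w‖ = ‖z' - z‖ →
        volume.real (admissible Ω t w \ admissible Ω t w') ≤ d * (‖z' - z‖ / ρ) * V := by
      intro w w' hw hww
      refine (volume_admissible_diff_le hΩc hΩ hD hρ hw (hww.trans_le hle)).trans ?_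
      rw [hww]
      gcongr
      exact hSV w
    have b1 : ‖∫ δ in S \ S', f δ‖ ≤ A * M * (d * (‖z' - z‖ / ρ) * V) :=
      (norm_setIntegral_le_of_subset_admissible hH hD hM sdiff_subset).trans (by
        gcongr; exact hdiff z z' hz rfl)
    have b2 : ‖∫ δ in S' \ S, f' δ‖ ≤ A * M * (d * (‖z' - z‖ / ρ) * V) :=
      (norm_setIntegral_le_of_subset_admissible hH hD hM sdiff_subset).trans (by
        gcongr; exact hdiff z' z hz' (norm_sub_rev _ _))
    have b3 : ‖(∫ δ in S ∩ S', f' δ) - ∫ δ in S ∩ S', f δ‖ ≤ B * ‖z' - z‖ * M * V := by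
      rw [← integral_sub (hi'.mono_set inter_subset_right) (hi.mono_set inter_subset_left)]
      refine (norm_setIntegral_le_of_norm_le_const (C := B * ‖z' - z‖ * M)
        (measure_lt_top_of_subset inter_subset_left (volume_admissible_ne_top hD))
        fun δ hδ => ?_).trans ?_
      · have h1 := hH.lipschitz (z' - z) _ hδ.1.1 _ hδ.1.2
          (by convert hδ.2.1 using 1; abel) (by convert hδ.2.2 using 1; abel)
        rw [show z - t • δ + (z' - z) = z' - t • δ by abel,
          show z + (1 - t) • δ + (z' - z) = z' + (1 - t) • δ by abel] at h1
        rw [hf, hf', ← sub_smul, norm_smul, Real.norm_eq_abs]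
        exact mul_le_mul h1 (hM _ (by simpa using admissible_subset_closedBall hD hδ.1))
          (norm_nonneg _) (by positivity)
      · gcongr
        exact (measureReal_mono inter_subset_left (volume_admissible_ne_top hD)).trans (hSV z)
    rw [e1, e2]
    calc _ = ‖((∫ δ in S ∩ S', f' δ) - ∫ δ in S ∩ S', f δ) + (∫ δ in S' \ S, f' δ) -
          ∫ δ in S \ S', f δ‖ := by congr 1; abel
      _ ≤ B * ‖z' - z‖ * M * V + A * M * (d * (‖z' - z‖ / ρ) * V) +
          A * M * (d * (‖z' - z‖ / ρ) * V) :=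
        (norm_sub_le _ _).trans (add_le_add ((norm_add_le _ _).trans (add_le_add b3 b2)) b1)
      _ = M * V * (B + 2 * A * d / ρ) * ‖z' - z‖ := by ring
      _ ≤ _ := by gcongr; linarith
  -- Points farther apart than ρ: the trivial bound suffices, as ‖z' - z‖/ρ ≥ 1. The factor d + 1 in
  -- place of d absorbs this case, also when d = 0.
  · have h1 := hH.norm_chordIntegral_le (t := t) (z := z) hA hM0 hD hM
    have h2 := hH.norm_chordIntegral_le (t := t) (z := z') hA hM0 hD hM
    have h3 : 1 ≤ ‖z' - z‖ / ρ := (one_le_div hρ).2 hgt.le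
    calc _ ≤ A * M * V + A * M * V := (norm_sub_le _ _).trans (add_le_add h2 h1)
      _ = M * V * (2 * A) * 1 := by ring
      _ ≤ M * V * (2 * A) * (‖z' - z‖ / ρ) := by gcongr
      _ = M * V * (2 * A * 1 / ρ) * ‖z' - z‖ := by ring
      _ ≤ _ := by
        gcongr
        have : (1 : ℝ) ≤ d + 1 := by simp
        have h5 : 2 * A * 1 / ρ ≤ 2 * A * (d + 1) / ρ := by gcongr
        linarith

/-- Rewritten with an indicator, the integral has a fixed domain and a jointly measurable integrand,
so measurability in (t, z) is that of a parametric integral. -/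
theorem stronglyMeasurable_chordIntegral (hΩc : IsClosed Ω)
    (hH : Measurable (Function.uncurry H)) (hF : StronglyMeasurable F) :
    StronglyMeasurable fun w : ℝ × EuclideanSpace ℝ (Fin d) => chordIntegral Ω H F w.1 w.2 := by
  have h : ∀ w : ℝ × EuclideanSpace ℝ (Fin d), chordIntegral Ω H F w.1 w.2 =
      ∫ δ, {u : (ℝ × EuclideanSpace ℝ (Fin d)) × EuclideanSpace ℝ (Fin d) |
          u.1.2 - u.1.1 • u.2 ∈ Ω ∧ u.1.2 + (1 - u.1.1) • u.2 ∈ Ω}.indicator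
        (fun u => H (u.1.2 - u.1.1 • u.2) (u.1.2 + (1 - u.1.1) • u.2) • F u.2) (w, δ) := by
    intro w
    rw [chordIntegral, ← integral_indicator (isClosed_admissible hΩc).measurableSet]
    rfl
  simp_rw [h]
  refine StronglyMeasurable.integral_prod_right (f := fun w δ => indicator _ _ (w, δ)) ?_
  refine StronglyMeasurable.indicator ?_ ?_
  · have : Measurable fun u : (ℝ × EuclideanSpace ℝ (Fin d)) × EuclideanSpace ℝ (Fin d) =>
        H (u.1.2 - u.1.1 • u.2) (u.1.2 + (1 - u.1.1) • u.2) :=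
      hH.comp (f := fun u : (ℝ × EuclideanSpace ℝ (Fin d)) × EuclideanSpace ℝ (Fin d) =>
        (u.1.2 - u.1.1 • u.2, u.1.2 + (1 - u.1.1) • u.2)) (by fun_prop)
    exact this.stronglyMeasurable.smul (hF.comp_measurable measurable_snd)
  · exact ((hΩc.preimage (by fun_prop)).inter (hΩc.preimage (by fun_prop))).measurableSet

end Chord

end RectifiedFlow

namespace RectifiedFlow

/-! ### Bounds, Lipschitz continuity and stability of the velocity. -/

/-- `p` is measurable, and on `Ω` it takes values in `[m, M]` with `m > 0` and is Lipschitz with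
constant `L`. -/
structure IsRegular {d : ℕ} (Ω : Set (EuclideanSpace ℝ (Fin d)))
    (p : EuclideanSpace ℝ (Fin d) → ℝ) (m M L : ℝ) : Prop where
  measurable : Measurable p
  pos : 0 < m
  nonneg : 0 ≤ L
  lower : ∀ x ∈ Ω, m ≤ p x
  upper : ∀ x ∈ Ω, p x ≤ M
  lipschitz : ∀ x ∈ Ω, ∀ y ∈ Ω, |p x - p y| ≤ L * ‖x - y‖

section Velocity

variable {d : ℕ} {Ω : Set (EuclideanSpace ℝ (Fin d))}
  {p q : EuclideanSpace ℝ (Fin d) → ℝ} {m M L D t ρ : ℝ}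
  {z z' : EuclideanSpace ℝ (Fin d)}

theorem IsRegular.chordKernel (hne : Ω.Nonempty) (hp : IsRegular Ω p m M L)
    (hq : IsRegular Ω q m M L) :
    ChordKernel Ω (fun x y => p x * q y) (M ^ 2) (2 * M * L) := by
  obtain ⟨w, hw⟩ := hne
  have hM : 0 ≤ M := hp.pos.le.trans ((hp.lower w hw).trans (hp.upper w hw))
  have hpa : ∀ x ∈ Ω, |p x| ≤ M := fun x hx => by
    rw [abs_of_nonneg (hp.pos.le.trans (hp.lower x hx))]; exact hp.upper x hx
  have hqa : ∀ x ∈ Ω, |q x| ≤ M := fun x hx => by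
    rw [abs_of_nonneg (hq.pos.le.trans (hq.lower x hx))]; exact hq.upper x hx
  have hL := hp.nonneg
  refine ⟨?_, by positivity, fun x hx y hy => ?_, fun h x hx y hy hxh hyh => ?_⟩
  · exact (hp.measurable.comp measurable_fst).mul (hq.measurable.comp measurable_snd)
  · rw [abs_mul, sq]
    exact mul_le_mul (hpa x hx) (hqa y hy) (abs_nonneg _) hM
  · have e : p (x + h) * q (y + h) - p x * q y =
        (p (x + h) - p x) * q (y + h) + p x * (q (y + h) - q y) := by ring
    have h1 := hp.lipschitz _ hxh _ hx
    have h2 := hq.lipschitz _ hyh _ hy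
    rw [add_sub_cancel_left] at h1 h2
    rw [e]
    refine (abs_add_le _ _).trans ?_
    rw [abs_mul, abs_mul]
    have h3 := mul_le_mul h1 (hqa _ hyh) (abs_nonneg _) (by positivity)
    have h4 := mul_le_mul (hpa _ hx) h2 (abs_nonneg _) hM
    linarith

theorem velocity_eq_chordIntegral : velocity Ω p q t z =
    (chordIntegral Ω (fun x y => p x * q y) (fun _ => (1 : ℝ)) t z)⁻¹ •
      chordIntegral Ω (fun x y => p x * q y) id t z := by
  simp [velocity, chordIntegral]

theorem stronglyMeasurable_velocity (hΩc : IsClosed Ω) (hp : Measurable p) (hq : Measurable q) :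
    StronglyMeasurable fun w : ℝ × EuclideanSpace ℝ (Fin d) => velocity Ω p q w.1 w.2 := by
  simp_rw [velocity_eq_chordIntegral]
  have hH : Measurable (Function.uncurry fun x y => p x * q y) :=
    (hp.comp measurable_fst).mul (hq.comp measurable_snd)
  have h1 := stronglyMeasurable_chordIntegral (F := fun _ => (1 : ℝ)) hΩc hH
    stronglyMeasurable_const
  have h2 := stronglyMeasurable_chordIntegral (F := id) hΩc hH stronglyMeasurable_id
  exact h1.measurable.inv.stronglyMeasurable.smul h2

theorem mul_volume_le_chordIntegral {H : EuclideanSpace ℝ (Fin d) → EuclideanSpace ℝ (Fin d) → ℝ}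
    {A B c : ℝ} (hH : ChordKernel Ω H A B) (hΩc : IsClosed Ω)
    (hD : ∀ x ∈ Ω, ∀ y ∈ Ω, ‖x - y‖ ≤ D) (hc : 0 ≤ c) (hHc : ∀ x ∈ Ω, ∀ y ∈ Ω, c ≤ H x y)
    (ht : t ∈ Icc (0 : ℝ) 1) (hz : z ∈ core Ω ρ) :
    c * volume.real (Metric.closedBall (0 : EuclideanSpace ℝ (Fin d)) ρ) ≤
      chordIntegral Ω H (fun _ => (1 : ℝ)) t z := by
  have hi := hH.integrableOn (F := fun _ => (1 : ℝ)) (M := 1) (t := t) (z := z) hΩc hD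
    stronglyMeasurable_const (by simp)
  have hSm := (isClosed_admissible hΩc (t := t) (z := z)).measurableSet
  have h1 : ∫ δ in admissible Ω t z, c ≤ chordIntegral Ω H (fun _ => (1 : ℝ)) t z := by
    refine setIntegral_mono_on ?_ hi hSm fun δ hδ => ?_
    · exact integrableOn_const (volume_admissible_ne_top hD)
    · simpa using hHc _ hδ.1 _ hδ.2
  rw [setIntegral_const, smul_eq_mul] at h1
  refine le_trans ?_ h1
  rw [mul_comm]
  exact mul_le_mul_of_nonneg_right (measureReal_mono (closedBall_subset_admissible ht hz)
    (volume_admissible_ne_top hD)) hc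

theorem IsRegular.le_mul (hp : IsRegular Ω p m M L) (hq : IsRegular Ω q m M L) :
    ∀ x ∈ Ω, ∀ y ∈ Ω, m ^ 2 ≤ p x * q y := fun x hx y hy => by
  rw [sq]
  exact mul_le_mul (hp.lower x hx) (hq.lower y hy) hp.pos.le
    (hp.pos.le.trans (hp.lower x hx))

theorem volume_closedBall_pos (hρ : 0 < ρ) :
    0 < volume.real (Metric.closedBall (0 : EuclideanSpace ℝ (Fin d)) ρ) :=
  ENNReal.toReal_pos (Metric.measure_closedBall_pos volume _ hρ).ne'
    measure_closedBall_lt_top.ne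

theorem chordIntegral_one_pos (hΩc : IsClosed Ω) (hD : ∀ x ∈ Ω, ∀ y ∈ Ω, ‖x - y‖ ≤ D)
    (hp : IsRegular Ω p m M L) (hq : IsRegular Ω q m M L) (ht : t ∈ Icc (0 : ℝ) 1)
    (hz : z ∈ interior Ω) :
    0 < chordIntegral Ω (fun x y => p x * q y) (fun _ => (1 : ℝ)) t z := by
  obtain ⟨ρ, hρ, hzρ⟩ := exists_mem_core_of_mem_interior hz
  have := mul_volume_le_chordIntegral (hp.chordKernel ⟨z, interior_subset hz⟩ hq) hΩc hD
    (sq_nonneg m) (hp.le_mul hq) ht hzρ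
  have h2 := volume_closedBall_pos (d := d) hρ
  have h3 := hp.pos
  exact lt_of_lt_of_le (by positivity) this

/-- A linear functional that is bounded above on `S_t(z)` has the same bound at the velocity. -/
theorem dual_velocity_le (hΩc : IsClosed Ω) (hD : ∀ x ∈ Ω, ∀ y ∈ Ω, ‖x - y‖ ≤ D)
    (hp : IsRegular Ω p m M L) (hq : IsRegular Ω q m M L) (ht : t ∈ Icc (0 : ℝ) 1)
    (hz : z ∈ interior Ω) (f : StrongDual ℝ (EuclideanSpace ℝ (Fin d))) {c : ℝ}
    (hc : ∀ δ ∈ admissible Ω t z, f δ ≤ c) : f (velocity Ω p q t z) ≤ c := by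
  have hK := hp.chordKernel ⟨z, interior_subset hz⟩ hq
  have hpos := chordIntegral_one_pos hΩc hD hp hq ht hz
  have hi1 := hK.integrableOn (F := fun _ => (1 : ℝ)) (M := 1) (t := t) (z := z) hΩc hD
    stronglyMeasurable_const (by simp)
  have hi2 := hK.integrableOn (F := id) (M := D) (t := t) (z := z) hΩc hD
    stronglyMeasurable_id (fun δ h => h)
  rw [velocity_eq_chordIntegral, map_smul, smul_eq_mul, inv_mul_le_iff₀ hpos, chordIntegral,
    ← ContinuousLinearMap.integral_comp_comm f hi2, chordIntegral, ← integral_mul_const]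
  refine setIntegral_mono_on (f.integrable_comp hi2) (hi1.mul_const c)
    (isClosed_admissible hΩc).measurableSet fun δ hδ => ?_
  have h0 : 0 ≤ p (z - t • δ) * q (z + (1 - t) • δ) :=
    (sq_nonneg m).trans (hp.le_mul hq _ hδ.1 _ hδ.2)
  rw [map_smul, smul_eq_mul, smul_eq_mul, mul_one]
  exact mul_le_mul_of_nonneg_left (hc δ hδ) h0

/-- The velocity is a weighted mean of differences of two points of Ω. -/
theorem norm_velocity_le (hΩc : IsClosed Ω) (hD : ∀ x ∈ Ω, ∀ y ∈ Ω, ‖x - y‖ ≤ D)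
    (hp : IsRegular Ω p m M L) (hq : IsRegular Ω q m M L) (ht : t ∈ Icc (0 : ℝ) 1)
    (hz : z ∈ interior Ω) : ‖velocity Ω p q t z‖ ≤ D := by
  have hK := hp.chordKernel ⟨z, interior_subset hz⟩ hq
  have hpos := chordIntegral_one_pos hΩc hD hp hq ht hz
  have hi1 := hK.integrableOn (F := fun _ => (1 : ℝ)) (M := 1) (t := t) (z := z) hΩc hD
    stronglyMeasurable_const (by simp)
  rw [velocity_eq_chordIntegral, norm_smul, norm_inv, Real.norm_of_nonneg hpos.le,
    inv_mul_le_iff₀ hpos, chordIntegral, chordIntegral, ← integral_mul_const]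
  refine norm_integral_le_of_norm_le (hi1.mul_const D) ?_
  filter_upwards [ae_restrict_mem (isClosed_admissible hΩc).measurableSet] with δ hδ
  have h0 : 0 ≤ p (z - t • δ) * q (z + (1 - t) • δ) :=
    (sq_nonneg m).trans (hp.le_mul hq _ hδ.1 _ hδ.2)
  rw [norm_smul, Real.norm_of_nonneg h0, smul_eq_mul, mul_one]
  exact mul_le_mul_of_nonneg_left (by simpa using admissible_subset_closedBall hD hδ) h0

/-- Near a supporting hyperplane the velocity is controlled by the distance to it. -/
theorem dual_velocity_le_div_one_sub (hΩc : IsClosed Ω) (hD : ∀ x ∈ Ω, ∀ y ∈ Ω, ‖x - y‖ ≤ D)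
    (hp : IsRegular Ω p m M L) (hq : IsRegular Ω q m M L) (ht : t ∈ Ico (0 : ℝ) 1)
    (hz : z ∈ interior Ω) (f : StrongDual ℝ (EuclideanSpace ℝ (Fin d))) {c : ℝ}
    (hc : ∀ y ∈ Ω, f y ≤ c) : f (velocity Ω p q t z) ≤ (c - f z) / (1 - t) := by
  refine dual_velocity_le hΩc hD hp hq ⟨ht.1, ht.2.le⟩ hz f fun δ hδ => ?_
  have h1 : 0 < 1 - t := by linarith [ht.2]
  rw [le_div_iff₀ h1]
  have := hc _ hδ.2
  rw [map_add, map_smul, smul_eq_mul] at this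
  linarith

end Velocity

section Quotient

variable {E : Type*} [NormedAddCommGroup E] [NormedSpace ℝ E]

/-- The quotient rule with the denominators cleared: n(w - w') = (g - g') - (n - n')w'. Only one of
the denominators has to be bounded below. -/
theorem norm_sub_le_of_smul_eq {n n' c : ℝ} {w w' g g' : E} (hc : 0 < c) (hn : c ≤ n)
    (h : n • w = g) (h' : n' • w' = g') :
    ‖w - w'‖ ≤ c⁻¹ * (‖g - g'‖ + |n - n'| * ‖w'‖) := by
  have e : n • (w - w') = (g - g') - (n - n') • w' := by
    rw [← h, ← h']; module
  have h1 : n * ‖w - w'‖ ≤ ‖g - g'‖ + |n - n'| * ‖w'‖ := by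
    have := norm_sub_le (g - g') ((n - n') • w')
    rw [← e, norm_smul, norm_smul, Real.norm_of_nonneg (hc.le.trans hn)] at this
    exact this
  rw [le_inv_mul_iff₀ hc]
  exact (mul_le_mul_of_nonneg_right hn (norm_nonneg _)).trans h1

end Quotient

section VelocityLipschitz

variable {d : ℕ} {Ω : Set (EuclideanSpace ℝ (Fin d))}
  {p q : EuclideanSpace ℝ (Fin d) → ℝ} {m M L D t ρ : ℝ}
  {z z' : EuclideanSpace ℝ (Fin d)}

/-- The velocity of a regular pair is Lipschitz on `core Ω ρ`, uniformly in time. -/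
theorem exists_lipschitz_velocity (hΩc : IsClosed Ω) (hΩ : Convex ℝ Ω)
    (hD : ∀ x ∈ Ω, ∀ y ∈ Ω, ‖x - y‖ ≤ D) (hD0 : 0 ≤ D)
    (hp : IsRegular Ω p m M L) (hq : IsRegular Ω q m M L) (hρ : 0 < ρ) :
    ∃ C, 0 ≤ C ∧ ∀ t ∈ Icc (0 : ℝ) 1, ∀ z ∈ core Ω ρ, ∀ z' ∈ core Ω ρ,
      ‖velocity Ω p q t z - velocity Ω p q t z'‖ ≤ C * ‖z - z'‖ := by
  have hm := hp.pos
  set c := m ^ 2 * volume.real (Metric.closedBall (0 : EuclideanSpace ℝ (Fin d)) ρ) with hc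
  have hc0 : 0 < c := mul_pos (by positivity) (volume_closedBall_pos hρ)
  set V := volume.real (Metric.closedBall (0 : EuclideanSpace ℝ (Fin d)) D) with hV
  -- The constant must be nonnegative before a point of Ω is available to show M ≥ 0, hence the
  -- absolute value.
  set l := V * (2 * |M| * L + 2 * M ^ 2 * (d + 1) / ρ) with hl
  have hL := hp.nonneg
  have hl0 : 0 ≤ l := by positivity
  refine ⟨c⁻¹ * (D * l + l * D), by positivity, fun t ht z hz z' hz' => ?_⟩
  have hzi := core_subset_interior hρ hz
  have hzi' := core_subset_interior hρ hz'
  have hK := hp.chordKernel ⟨z, interior_subset hzi⟩ hq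
  have hM : |M| = M := abs_of_nonneg
    (hm.le.trans ((hp.lower z (interior_subset hzi)).trans (hp.upper z (interior_subset hzi))))
  rw [hM] at hl
  have h1 := hK.norm_chordIntegral_sub_le (F := fun _ => (1 : ℝ)) (M := 1) (t := t) (sq_nonneg M)
    zero_le_one hΩc hΩ hD stronglyMeasurable_const (by simp) hρ hz' hz
  have h2 := hK.norm_chordIntegral_sub_le (F := id) (M := D) (t := t) (sq_nonneg M)
    hD0 hΩc hΩ hD stronglyMeasurable_id (fun _ h => h) hρ hz' hz
  rw [one_mul, ← hV, ← hl] at h1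
  rw [mul_assoc D, ← hV, ← hl] at h2
  have hpos := chordIntegral_one_pos hΩc hD hp hq ht hzi
  have hpos' := chordIntegral_one_pos hΩc hD hp hq ht hzi'
  refine (norm_sub_le_of_smul_eq hc0
    (mul_volume_le_chordIntegral hK hΩc hD (sq_nonneg m) (hp.le_mul hq) ht hz)
    (w := velocity Ω p q t z) (w' := velocity Ω p q t z')
    (by rw [velocity_eq_chordIntegral, smul_inv_smul₀ hpos.ne'])
    (by rw [velocity_eq_chordIntegral, smul_inv_smul₀ hpos'.ne'])).trans ?_
  rw [mul_assoc]
  gcongr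
  have h3 := norm_velocity_le hΩc hD hp hq ht hzi'
  have h4 := mul_le_mul h1 h3 (norm_nonneg _) (by positivity)
  rw [Real.norm_eq_abs] at h4
  linarith

/-- If the kernel `p̂ ⊗ q̂ - p ⊗ q` is small in the Lipschitz sense, then so is the difference of
the velocities on `core Ω ρ`. -/
theorem exists_velocity_sub_le (hΩc : IsClosed Ω) (hΩ : Convex ℝ Ω)
    (hD : ∀ x ∈ Ω, ∀ y ∈ Ω, ‖x - y‖ ≤ D) (hD0 : 0 ≤ D)
    (hp : IsRegular Ω p m M L) (hq : IsRegular Ω q m M L) (hρ : 0 < ρ) :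
    ∃ C κ₀ : ℝ, 0 ≤ C ∧ 0 < κ₀ ∧ ∀ κ, 0 ≤ κ → κ ≤ κ₀ →
      ∀ p' q' : EuclideanSpace ℝ (Fin d) → ℝ,
      ChordKernel Ω (fun x y => p' x * q' y - p x * q y) κ κ →
      ∀ t ∈ Icc (0 : ℝ) 1, ∀ z ∈ core Ω ρ,
        ‖velocity Ω p' q' t z - velocity Ω p q t z‖ ≤ C * κ ∧
        ∀ z' ∈ core Ω ρ,
          ‖(velocity Ω p' q' t z - velocity Ω p q t z) -
            (velocity Ω p' q' t z' - velocity Ω p q t z')‖ ≤ C * κ * ‖z - z'‖ := by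
  obtain ⟨C, hC0, hC⟩ := exists_lipschitz_velocity hΩc hΩ hD hD0 hp hq hρ
  have hm := hp.pos
  set c := m ^ 2 * volume.real (Metric.closedBall (0 : EuclideanSpace ℝ (Fin d)) ρ) with hc
  have hc0 : 0 < c := mul_pos (by positivity) (volume_closedBall_pos hρ)
  set V := volume.real (Metric.closedBall (0 : EuclideanSpace ℝ (Fin d)) D) with hV
  have hV0 : 0 ≤ V := measureReal_nonneg
  have hL := hp.nonneg
  set l := V * (2 * |M| * L + 2 * M ^ 2 * (d + 1) / ρ) with hl
  have hl0 : 0 ≤ l := by positivity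
  -- `b` bounds the ratio of the size of an error integral, or of its increments, to `κ`
  set b := (1 + D) * (V * (1 + 2 * (d + 1) / ρ)) with hb
  have hb0 : 0 ≤ b := by positivity
  have hVb : V ≤ b := by
    have : 1 ≤ (1 + D) * (1 + 2 * (d + 1) / ρ) := by
      have h1 : 1 ≤ 1 + D := by linarith
      have h2 : 1 ≤ 1 + 2 * ((d : ℝ) + 1) / ρ := by
        have : 0 ≤ 2 * ((d : ℝ) + 1) / ρ := by positivity
        linarith
      nlinarith
    have := mul_le_mul_of_nonneg_left this hV0
    rw [hb]; linarith
  have hDVb : D * V ≤ b := by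
    have : D ≤ (1 + D) * (1 + 2 * (d + 1) / ρ) := by
      have h2 : 1 ≤ 1 + 2 * ((d : ℝ) + 1) / ρ := by
        have : 0 ≤ 2 * ((d : ℝ) + 1) / ρ := by positivity
        linarith
      nlinarith
    have := mul_le_mul_of_nonneg_left this hV0
    rw [hb]; linarith
  set β := (c / 2)⁻¹ * (b + b * D) with hβ
  have hβ0 : 0 ≤ β := by positivity
  -- The first entry of the maximum serves the size, the second the increments: there `l + b` bounds
  -- the variation of the perturbed denominator and `β * κ` the size of the difference. The bound on
  -- κ keeps the change of the denominator below c/2, half of its lower bound.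
  refine ⟨max β ((c / 2)⁻¹ * ((b + b * D + b * C) + (l + b) * β)), min 1 (c / (2 * (b + 1))),
    le_max_of_le_left hβ0, lt_min one_pos (by positivity), ?_⟩
  intro κ hκ0 hκ p' q' hE t ht
  have hκ1 : κ ≤ 1 := hκ.trans (min_le_left _ _)
  have hκb : b * κ ≤ c / 2 := by
    have h1 := hκ.trans (min_le_right _ _)
    rw [le_div_iff₀ (by positivity)] at h1
    nlinarith
  have hbd : ∀ z, ‖chordIntegral Ω (fun x y => p' x * q' y - p x * q y) (fun _ => (1 : ℝ)) t z‖ ≤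
      b * κ := fun z => by
    refine (hE.norm_chordIntegral_le (M := 1) hκ0 zero_le_one hD (by simp)).trans ?_
    rw [← hV]; nlinarith
  have hbd' : ∀ z, ‖chordIntegral Ω (fun x y => p' x * q' y - p x * q y) id t z‖ ≤
      b * κ := fun z => by
    refine (hE.norm_chordIntegral_le (M := D) hκ0 hD0 hD (fun _ h => h)).trans ?_
    rw [← hV]; nlinarith
  have hlip : ∀ z ∈ core Ω ρ, ∀ z' ∈ core Ω ρ,
      |chordIntegral Ω (fun x y => p' x * q' y - p x * q y) (fun _ => (1 : ℝ)) t z -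
      chordIntegral Ω (fun x y => p' x * q' y - p x * q y) (fun _ => (1 : ℝ)) t z'| ≤
      b * κ * ‖z - z'‖ := by
    intro z hz z' hz'
    refine (hE.norm_chordIntegral_sub_le (F := fun _ => (1 : ℝ)) (M := 1) hκ0 zero_le_one hΩc hΩ hD
      stronglyMeasurable_const (by simp) hρ hz' hz).trans ?_
    refine mul_le_mul_of_nonneg_right ?_ (norm_nonneg _)
    rw [← hV, hb]
    have : 0 ≤ D * (V * (1 + 2 * ((d : ℝ) + 1) / ρ)) * κ := by positivity
    calc 1 * V * (κ + 2 * κ * (d + 1) / ρ) = V * (1 + 2 * (d + 1) / ρ) * κ := by ring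
      _ ≤ _ := by linarith
  have hlip' : ∀ z ∈ core Ω ρ, ∀ z' ∈ core Ω ρ,
      ‖chordIntegral Ω (fun x y => p' x * q' y - p x * q y) id t z -
      chordIntegral Ω (fun x y => p' x * q' y - p x * q y) id t z'‖ ≤
      b * κ * ‖z - z'‖ := by
    intro z hz z' hz'
    refine (hE.norm_chordIntegral_sub_le (M := D) hκ0 hD0 hΩc hΩ hD
      stronglyMeasurable_id (fun _ h => h) hρ hz' hz).trans ?_
    refine mul_le_mul_of_nonneg_right ?_ (norm_nonneg _)
    rw [← hV, hb]
    have : 0 ≤ (V * (1 + 2 * ((d : ℝ) + 1) / ρ)) * κ := by positivity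
    calc D * V * (κ + 2 * κ * (d + 1) / ρ) = D * (V * (1 + 2 * (d + 1) / ρ)) * κ := by ring
      _ ≤ _ := by linarith
  -- the perturbed integrals
  have hadd : ∀ z ∈ core Ω ρ,
      chordIntegral Ω (fun x y => p' x * q' y) (fun _ => (1 : ℝ)) t z =
        chordIntegral Ω (fun x y => p x * q y) (fun _ => (1 : ℝ)) t z +
        chordIntegral Ω (fun x y => p' x * q' y - p x * q y) (fun _ => (1 : ℝ)) t z ∧
      chordIntegral Ω (fun x y => p' x * q' y) id t z =
        chordIntegral Ω (fun x y => p x * q y) id t z +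
        chordIntegral Ω (fun x y => p' x * q' y - p x * q y) id t z := by
    intro z hz
    have hK := hp.chordKernel ⟨z, core_subset hρ.le hz⟩ hq
    constructor
    · have i1 := hK.integrableOn (F := fun _ => (1 : ℝ)) (M := 1) (t := t) (z := z) hΩc hD
        stronglyMeasurable_const (by simp)
      have i2 := hE.integrableOn (F := fun _ => (1 : ℝ)) (M := 1) (t := t) (z := z) hΩc hD
        stronglyMeasurable_const (by simp)
      rw [chordIntegral, chordIntegral, chordIntegral, ← integral_add i1 i2]
      congr 1; ext δ; rw [← add_smul, add_sub_cancel]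
    · have i1 := hK.integrableOn (F := id) (M := D) (t := t) (z := z) hΩc hD
        stronglyMeasurable_id (fun _ h => h)
      have i2 := hE.integrableOn (F := id) (M := D) (t := t) (z := z) hΩc hD
        stronglyMeasurable_id (fun _ h => h)
      rw [chordIntegral, chordIntegral, chordIntegral, ← integral_add i1 i2]
      congr 1; ext1 δ; rw [← add_smul, add_sub_cancel]
  have hlow : ∀ z ∈ core Ω ρ,
      c / 2 ≤ chordIntegral Ω (fun x y => p' x * q' y) (fun _ => (1 : ℝ)) t z := by
    intro z hz
    have hK := hp.chordKernel ⟨z, core_subset hρ.le hz⟩ hq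
    have h1 := mul_volume_le_chordIntegral hK hΩc hD (sq_nonneg m) (hp.le_mul hq) ht hz
    rw [(hadd z hz).1]
    have h2 := neg_le_of_abs_le ((Real.norm_eq_abs _).symm.trans_le (hbd z))
    linarith
  -- Multiplied by the perturbed denominator, the difference of the velocities is expressed through
  -- integrals of the error kernel and the unperturbed velocity alone. Every term on the right thus
  -- carries a factor κ.
  have heq : ∀ z ∈ core Ω ρ,
      chordIntegral Ω (fun x y => p' x * q' y) (fun _ => (1 : ℝ)) t z •
        (velocity Ω p' q' t z - velocity Ω p q t z) =
      chordIntegral Ω (fun x y => p' x * q' y - p x * q y) id t z -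
        chordIntegral Ω (fun x y => p' x * q' y - p x * q y) (fun _ => (1 : ℝ)) t z •
          velocity Ω p q t z := by
    intro z hz
    have hpos := chordIntegral_one_pos hΩc hD hp hq ht (core_subset_interior hρ hz)
    have hpos' : 0 < chordIntegral Ω (fun x y => p' x * q' y) (fun _ => (1 : ℝ)) t z :=
      lt_of_lt_of_le (by positivity) (hlow z hz)
    have e1 : chordIntegral Ω (fun x y => p' x * q' y) (fun _ => (1 : ℝ)) t z •
        velocity Ω p' q' t z = chordIntegral Ω (fun x y => p' x * q' y) id t z := by
      rw [velocity_eq_chordIntegral, smul_inv_smul₀ hpos'.ne']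
    have e2 : chordIntegral Ω (fun x y => p x * q y) (fun _ => (1 : ℝ)) t z •
        velocity Ω p q t z = chordIntegral Ω (fun x y => p x * q y) id t z := by
      rw [velocity_eq_chordIntegral, smul_inv_smul₀ hpos.ne']
    rw [smul_sub, e1, (hadd z hz).1, (hadd z hz).2, add_smul, e2]
    abel
  have hv : ∀ z ∈ core Ω ρ, ‖velocity Ω p q t z‖ ≤ D := fun z hz =>
    norm_velocity_le hΩc hD hp hq ht (core_subset_interior hρ hz)
  have hsmall : ∀ z ∈ core Ω ρ, ‖velocity Ω p' q' t z - velocity Ω p q t z‖ ≤ β * κ := by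
    intro z hz
    -- Comparison with the trivial identity 1 • 0 = 0 bounds the difference itself.
    have h1 := norm_sub_le_of_smul_eq (by positivity : 0 < c / 2) (hlow z hz) (heq z hz)
      (n' := 1) (w' := (0 : EuclideanSpace ℝ (Fin d))) (g' := 0) (by simp)
    rw [sub_zero, sub_zero, norm_zero, mul_zero, add_zero] at h1
    refine h1.trans ?_
    rw [hβ, mul_assoc]
    gcongr
    refine (norm_sub_le _ _).trans ?_
    rw [norm_smul]
    have := mul_le_mul (hbd z) (hv z hz) (norm_nonneg _) (by positivity)
    linarith [hbd' z]
  intro z hz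
  refine ⟨(hsmall z hz).trans (by gcongr; exact le_max_left _ _), fun z' hz' => ?_⟩
  refine (norm_sub_le_of_smul_eq (by positivity : 0 < c / 2) (hlow z hz) (heq z hz)
    (heq z' hz')).trans ?_
  have hK := hp.chordKernel ⟨z, core_subset hρ.le hz⟩ hq
  have hM : |M| = M := abs_of_nonneg (hm.le.trans ((hp.lower z (core_subset hρ.le hz)).trans
    (hp.upper z (core_subset hρ.le hz))))
  have h1 := hK.norm_chordIntegral_sub_le (F := fun _ => (1 : ℝ)) (M := 1) (t := t) (sq_nonneg M)
    zero_le_one hΩc hΩ hD stronglyMeasurable_const (by simp) hρ hz' hz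
  rw [hM] at hl
  rw [one_mul, ← hV, ← hl, Real.norm_eq_abs] at h1
  have hn : |chordIntegral Ω (fun x y => p' x * q' y) (fun _ => (1 : ℝ)) t z -
      chordIntegral Ω (fun x y => p' x * q' y) (fun _ => (1 : ℝ)) t z'| ≤
      (l + b) * ‖z - z'‖ := by
    rw [(hadd z hz).1, (hadd z' hz').1, add_sub_add_comm]
    refine (abs_add_le _ _).trans ?_
    have h2 := hlip z hz z' hz'
    have h3 : b * κ * ‖z - z'‖ ≤ b * ‖z - z'‖ := by
      gcongr; exact mul_le_of_le_one_right hb0 hκ1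
    linarith
  have hg : ‖chordIntegral Ω (fun x y => p' x * q' y - p x * q y) id t z -
        chordIntegral Ω (fun x y => p' x * q' y - p x * q y) (fun _ => (1 : ℝ)) t z •
          velocity Ω p q t z -
      (chordIntegral Ω (fun x y => p' x * q' y - p x * q y) id t z' -
        chordIntegral Ω (fun x y => p' x * q' y - p x * q y) (fun _ => (1 : ℝ)) t z' •
          velocity Ω p q t z')‖ ≤ (b + b * D + b * C) * κ * ‖z - z'‖ := by
    set f := chordIntegral Ω (fun x y => p' x * q' y - p x * q y) id t z
    set f' := chordIntegral Ω (fun x y => p' x * q' y - p x * q y) id t z'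
    set e := chordIntegral Ω (fun x y => p' x * q' y - p x * q y) (fun _ => (1 : ℝ)) t z
    set e' := chordIntegral Ω (fun x y => p' x * q' y - p x * q y) (fun _ => (1 : ℝ)) t z'
    set v := velocity Ω p q t z
    set v' := velocity Ω p q t z'
    have e0 : f - e • v - (f' - e' • v') = (f - f') - (e - e') • v - e' • (v - v') := by module
    rw [e0]
    refine (norm_sub_le _ _).trans ((add_le_add (norm_sub_le _ _) le_rfl).trans ?_)
    rw [norm_smul, norm_smul, Real.norm_eq_abs]
    have i1 : ‖f - f'‖ ≤ b * κ * ‖z - z'‖ := hlip' z hz z' hz'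
    have i2 := mul_le_mul (hlip z hz z' hz') (hv z hz) (norm_nonneg _) (by positivity)
    have i3 := mul_le_mul (hbd z') (hC t ht z hz z' hz') (norm_nonneg _) (by positivity)
    change |e - e'| * ‖v‖ ≤ _ at i2
    change ‖e'‖ * ‖v - v'‖ ≤ _ at i3
    calc _ ≤ b * κ * ‖z - z'‖ + b * κ * ‖z - z'‖ * D + b * κ * (C * ‖z - z'‖) := by linarith
      _ = _ := by ring
  have hw := mul_le_mul hn (hsmall z' hz') (norm_nonneg _) (by positivity)
  calc _ ≤ (c / 2)⁻¹ * ((b + b * D + b * C) * κ * ‖z - z'‖ + (l + b) * ‖z - z'‖ * (β * κ)) := by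
        gcongr
    _ = (c / 2)⁻¹ * ((b + b * D + b * C) + (l + b) * β) * κ * ‖z - z'‖ := by ring
    _ ≤ _ := by gcongr; exact le_max_right _ _

end VelocityLipschitz

end RectifiedFlow

namespace RectifiedFlow

/-! ### Existence, uniqueness and confinement of trajectories. -/

/-- Continuous induction: a curve that starts in a closed set `K`, and that is in the interior of
`K` at every time up to which it has stayed in `K`, never leaves `K`. -/
theorem forall_mem_of_bootstrap {X : Type*} [TopologicalSpace X] {y : ℝ → X} {K : Set X} {T : ℝ}
    (hy : ContinuousOn y (Icc 0 T)) (hK : IsClosed K) (h0 : y 0 ∈ K)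
    (h : ∀ τ ∈ Icc (0 : ℝ) T, τ < T → (∀ r ∈ Icc 0 τ, y r ∈ K) → K ∈ 𝓝 (y τ)) :
    ∀ t ∈ Icc (0 : ℝ) T, y t ∈ K := by
  -- Stopping at time t keeps the range of r independent of t, so the set of good times is visibly
  -- an intersection of closed sets.
  set s : Set ℝ := {t | ∀ r ∈ Icc (0 : ℝ) T, y (min r t) ∈ K} with hs
  have hmin : ∀ r ∈ Icc (0 : ℝ) T, ∀ t ∈ Icc (0 : ℝ) T, min r t ∈ Icc (0 : ℝ) T :=
    fun r hr t ht => ⟨le_min hr.1 ht.1, (min_le_left _ _).trans hr.2⟩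
  intro t ht
  have hT : 0 ≤ T := ht.1.trans ht.2
  have key : Icc 0 T ⊆ s := by
    refine IsClosed.Icc_subset_of_forall_exists_gt ?_ ?_ ?_
    · have : s ∩ Icc 0 T = Icc 0 T ∩ ⋂ r : Icc (0 : ℝ) T, (Icc 0 T ∩ (fun t => y (min r t)) ⁻¹' K) := by
        ext t
        simp only [hs, mem_inter_iff, mem_ofPred_eq, mem_iInter, mem_preimage, Subtype.forall]
        grind
      rw [this]
      refine isClosed_Icc.inter (isClosed_iInter fun r => ?_)
      exact ContinuousOn.preimage_isClosed_of_isClosed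
        (hy.comp (by fun_prop) fun t ht => hmin r r.2 t ht) isClosed_Icc hK
    · intro r hr
      rwa [min_eq_right hr.1]
    · rintro τ ⟨hτ, hτT⟩ τ' hττ'
      have hτI : τ ∈ Icc (0 : ℝ) T := ⟨hτT.1, hτT.2.le⟩
      have hin : ∀ r ∈ Icc 0 τ, y r ∈ K := fun r hr => by
        have := hτ r ⟨hr.1, hr.2.trans hτT.2.le⟩
        rwa [min_eq_left hr.2] at this
      have h1 : ∀ᶠ r in 𝓝[Icc 0 T] τ, y r ∈ K := hy τ hτI (h τ hτI hτT.2 hin)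
      rw [eventually_nhdsWithin_iff, Metric.eventually_nhds_iff] at h1
      obtain ⟨ε, hε, h1⟩ := h1
      refine ⟨min τ' (min T (τ + ε / 2)), fun r hr => ?_, ?_, min_le_left _ _⟩
      · rcases le_or_gt r τ with hrτ | hrτ
        · have : τ < min τ' (min T (τ + ε / 2)) :=
            lt_min hττ' (lt_min hτT.2 (by linarith))
          rw [min_eq_left (hrτ.trans this.le)]
          exact hin r ⟨hr.1, hrτ⟩
        · set w := min r (min τ' (min T (τ + ε / 2))) with hw
          have hw1 : τ < w := lt_min hrτ (lt_min hττ' (lt_min hτT.2 (by linarith)))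
          have hw2 : w ≤ τ + ε / 2 :=
            (min_le_right _ _).trans ((min_le_right _ _).trans (min_le_right _ _))
          refine h1 ?_ ⟨hτT.1.trans hw1.le, (min_le_left _ _).trans hr.2⟩
          rw [Real.dist_eq, abs_of_pos (by linarith)]
          linarith
      · exact lt_min hττ' (lt_min hτT.2 (by linarith))
  have := key ht t ht
  rwa [min_self] at this

section Flow

variable {d : ℕ} {Ω : Set (EuclideanSpace ℝ (Fin d))}
  {p q : EuclideanSpace ℝ (Fin d) → ℝ} {m M L D : ℝ} {x : EuclideanSpace ℝ (Fin d)}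

theorem IsSolution.continuousOn
    {v : ℝ → EuclideanSpace ℝ (Fin d) → EuclideanSpace ℝ (Fin d)}
    {y : ℝ → EuclideanSpace ℝ (Fin d)} (hy : IsSolution Ω v x y) : ContinuousOn y (Icc 0 1) :=
  (continuousOn_const.add (continuousOn_integral zero_le_one hy.integrable)).congr hy.eq_integral

theorem aestronglyMeasurable_velocity_comp (hΩc : IsClosed Ω) (hp : Measurable p)
    (hq : Measurable q) {y : ℝ → EuclideanSpace ℝ (Fin d)} {S : Set ℝ} (hS : MeasurableSet S)
    (hy : ContinuousOn y S) :
    AEStronglyMeasurable (fun s => velocity Ω p q s (y s)) (volume.restrict S) :=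
  ((stronglyMeasurable_velocity hΩc hp hq).measurable.comp_aemeasurable
    (f := fun s => (s, y s)) (aemeasurable_id.prodMk (hy.aemeasurable hS))).aestronglyMeasurable

/-- A trajectory stays at distance at least `(1 - t)ρ` from the boundary. -/
theorem mem_core_one_sub_mul (hΩc : IsClosed Ω) (hΩ : Convex ℝ Ω)
    (hD : ∀ x ∈ Ω, ∀ y ∈ Ω, ‖x - y‖ ≤ D)
    (hp : IsRegular Ω p m M L) (hq : IsRegular Ω q m M L) {T ρ : ℝ} (hT : T < 1) (hρ : 0 ≤ ρ)
    (hx : x ∈ core Ω ρ) {y : ℝ → EuclideanSpace ℝ (Fin d)}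
    (hyi : ∀ t ∈ Icc (0 : ℝ) T, y t ∈ interior Ω)
    (hint : IntervalIntegrable (fun s => velocity Ω p q s (y s)) volume 0 T)
    (hy : ∀ t ∈ Icc (0 : ℝ) T, y t = x + ∫ s in (0 : ℝ)..t, velocity Ω p q s (y s)) :
    ∀ t ∈ Icc (0 : ℝ) T, y t ∈ core Ω ((1 - t) * ρ) := by
  intro t ht
  have hT0 : 0 ≤ T := ht.1.trans ht.2
  have h0 : (0 : ℝ) ∈ Icc (0 : ℝ) T := ⟨le_rfl, hT0⟩
  have hyc : ContinuousOn y (Icc 0 T) :=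
    (continuousOn_const.add (continuousOn_integral hT0 hint)).congr hy
  -- The slack c - f(y) in one half-space loses at most the rate (c - f(y))/(1 - t), which is the
  -- hypothesis of `one_sub_mul_le_of_sub_ge_integral`.
  refine mem_core_of_forall_dual hΩc hΩ fun f c hf => ?_
  have hu : ContinuousOn (fun t => c - f (y t)) (Icc 0 T) :=
    continuousOn_const.sub (f.continuous.comp_continuousOn hyc)
  have key := one_sub_mul_le_of_sub_ge_integral (u := fun t => c - f (y t)) hT hu (by
    intro s hs t ht
    have ht' : t ∈ Icc (0 : ℝ) T := ⟨hs.1.trans ht.1, ht.2⟩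
    have hst := intervalIntegrable_mono_Icc hint hs ht'
    have e : (c - f (y t)) - (c - f (y s)) = -∫ r in s..t, f (velocity Ω p q r (y r)) := by
      rw [ContinuousLinearMap.intervalIntegral_comp_comm f hst, hy t ht', hy s hs,
        ← intervalIntegral.integral_interval_sub_left (intervalIntegrable_mono_Icc hint h0 ht')
        (intervalIntegrable_mono_Icc hint h0 hs)]
      simp only [map_add, map_sub]; ring
    change _ ≤ (c - f (y t)) - (c - f (y s))
    rw [e, neg_le_neg_iff]
    refine intervalIntegral.integral_mono_on ht.1 ?_ ?_ fun r hr => ?_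
    · exact (f.integrable_comp hst.1 |> fun h => ⟨h, f.integrable_comp hst.2⟩)
    · apply ContinuousOn.intervalIntegrable
      rw [uIcc_of_le ht.1]
      exact (hu.mono (Icc_subset_Icc hs.1 ht.2)).div (by fun_prop)
        fun r hr => by linarith [hr.2, ht.2]
    · have hr' : r ∈ Icc (0 : ℝ) T := ⟨hs.1.trans hr.1, hr.2.trans ht.2⟩
      exact dual_velocity_le_div_one_sub hΩc hD hp hq ⟨hr'.1, hr'.2.trans_lt hT⟩ (hyi r hr') f hf)
    t ht
  have hy0 : y 0 = x := by simpa using hy 0 h0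
  simp only [hy0] at key
  have h1 := add_mul_norm_le_of_mem_core hρ hx hf
  have h2 : (1 - t) * (ρ * ‖f‖) ≤ (1 - t) * (c - f x) :=
    mul_le_mul_of_nonneg_left (by linarith) (by linarith [ht.2])
  linarith

/-- Both curves trace compact subsets of the interior, so a single core contains them and a single
Lipschitz constant serves Grönwall's inequality. -/
theorem eqOn_of_eq_integral (hΩc : IsClosed Ω) (hΩ : Convex ℝ Ω)
    (hD : ∀ x ∈ Ω, ∀ y ∈ Ω, ‖x - y‖ ≤ D) (hD0 : 0 ≤ D)
    (hp : IsRegular Ω p m M L) (hq : IsRegular Ω q m M L) {T : ℝ} (hT0 : 0 ≤ T) (hT : T ≤ 1)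
    {y₁ y₂ : ℝ → EuclideanSpace ℝ (Fin d)}
    (hi₁ : ∀ t ∈ Icc (0 : ℝ) T, y₁ t ∈ interior Ω) (hi₂ : ∀ t ∈ Icc (0 : ℝ) T, y₂ t ∈ interior Ω)
    (hint₁ : IntervalIntegrable (fun s => velocity Ω p q s (y₁ s)) volume 0 T)
    (hint₂ : IntervalIntegrable (fun s => velocity Ω p q s (y₂ s)) volume 0 T)
    (h₁ : ∀ t ∈ Icc (0 : ℝ) T, y₁ t = x + ∫ s in (0 : ℝ)..t, velocity Ω p q s (y₁ s))
    (h₂ : ∀ t ∈ Icc (0 : ℝ) T, y₂ t = x + ∫ s in (0 : ℝ)..t, velocity Ω p q s (y₂ s)) :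
    EqOn y₁ y₂ (Icc 0 T) := by
  have h0 : (0 : ℝ) ∈ Icc (0 : ℝ) T := ⟨le_rfl, hT0⟩
  have hc₁ : ContinuousOn y₁ (Icc 0 T) :=
    (continuousOn_const.add (continuousOn_integral hT0 hint₁)).congr h₁
  have hc₂ : ContinuousOn y₂ (Icc 0 T) :=
    (continuousOn_const.add (continuousOn_integral hT0 hint₂)).congr h₂
  obtain ⟨ρ, hρ, hK⟩ := exists_subset_core
    ((isCompact_Icc.image_of_continuousOn hc₁).union (isCompact_Icc.image_of_continuousOn hc₂))
    (union_subset (image_subset_iff.2 hi₁) (image_subset_iff.2 hi₂))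
  obtain ⟨C, hC0, hC⟩ := exists_lipschitz_velocity hΩc hΩ hD hD0 hp hq hρ
  intro t ht
  refine sub_eq_zero.1 (eq_zero_of_eq_integral (u := fun t => y₁ t - y₂ t) hC0
    (hint₁.sub hint₂) ?_ ?_ t ht)
  · intro t ht
    rw [h₁ t ht, h₂ t ht, intervalIntegral.integral_sub
      (intervalIntegrable_mono_Icc hint₁ h0 ht) (intervalIntegrable_mono_Icc hint₂ h0 ht)]
    abel
  · intro s hs
    exact hC s ⟨hs.1, hs.2.trans hT⟩ _ (hK (Or.inl (mem_image_of_mem _ hs))) _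
      (hK (Or.inr (mem_image_of_mem _ hs)))

/-- A solution may touch the boundary at time 1, where no Lipschitz bound is available. Uniqueness
is therefore proved on [0,1) and extended by continuity. -/
theorem IsSolution.eqOn (hΩc : IsClosed Ω) (hΩ : Convex ℝ Ω)
    (hD : ∀ x ∈ Ω, ∀ y ∈ Ω, ‖x - y‖ ≤ D) (hD0 : 0 ≤ D)
    (hp : IsRegular Ω p m M L) (hq : IsRegular Ω q m M L)
    {y₁ y₂ : ℝ → EuclideanSpace ℝ (Fin d)} (h₁ : IsSolution Ω (velocity Ω p q) x y₁)
    (h₂ : IsSolution Ω (velocity Ω p q) x y₂) : EqOn y₁ y₂ (Icc 0 1) := by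
  have h0 : (0 : ℝ) ∈ Icc (0 : ℝ) 1 := by simp
  have hlt : EqOn y₁ y₂ (Ico 0 1) := fun t ht => by
    have ht' : t ∈ Icc (0 : ℝ) 1 := ⟨ht.1, ht.2.le⟩
    refine eqOn_of_eq_integral (x := x) hΩc hΩ hD hD0 hp hq ht.1 ht.2.le
      (fun s hs => h₁.mem_interior s ⟨hs.1, hs.2.trans_lt ht.2⟩)
      (fun s hs => h₂.mem_interior s ⟨hs.1, hs.2.trans_lt ht.2⟩)
      (intervalIntegrable_mono_Icc h₁.integrable h0 ht')
      (intervalIntegrable_mono_Icc h₂.integrable h0 ht')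
      (fun s hs => h₁.eq_integral s ⟨hs.1, hs.2.trans ht.2.le⟩)
      (fun s hs => h₂.eq_integral s ⟨hs.1, hs.2.trans ht.2.le⟩) ⟨ht.1, le_rfl⟩
  refine hlt.of_subset_closure h₁.continuousOn h₂.continuousOn Ico_subset_Icc_self ?_
  rw [closure_Ico (by norm_num)]

/-- Existence on `[0, T]` for `T < 1`. -/
theorem exists_eq_integral (hΩc : IsClosed Ω) (hΩ : Convex ℝ Ω)
    (hD : ∀ x ∈ Ω, ∀ y ∈ Ω, ‖x - y‖ ≤ D) (hD0 : 0 ≤ D)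
    (hp : IsRegular Ω p m M L) (hq : IsRegular Ω q m M L) {T ρ : ℝ} (hT0 : 0 ≤ T) (hT : T < 1)
    (hρ : 0 < ρ) (hx : x ∈ core Ω ρ) :
    ∃ y : ℝ → EuclideanSpace ℝ (Fin d), Continuous y ∧ (∀ t ∈ Icc (0 : ℝ) T, y t ∈ interior Ω) ∧
      IntervalIntegrable (fun s => velocity Ω p q s (y s)) volume 0 T ∧
      ∀ t ∈ Icc (0 : ℝ) T, y t = x + ∫ s in (0 : ℝ)..t, velocity Ω p q s (y s) := by
  have hr : 0 < (1 - T) * ρ := mul_pos (by linarith) hρ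
  set K := core Ω ((1 - T) * ρ) with hK
  have hKi : K ⊆ interior Ω := core_subset_interior hr
  have hKc : IsClosed K := isClosed_core hΩc
  have hxK : x ∈ K := core_anti (by nlinarith) hx
  -- Composition with the projection onto `K` makes the field globally Lipschitz in space. The
  -- solution of the modified equation is then shown never to leave `K`, where the projection is the
  -- identity.
  obtain ⟨π, hπK, hπid, hπl⟩ := exists_lipschitz_retraction ⟨x, hxK⟩ hKc.isComplete (convex_core hΩ)
  have hπc : Continuous π := by
    refine (LipschitzWith.of_dist_le_mul (K := 1) fun y z => ?_).continuous
    simpa [dist_eq_norm] using hπl y z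
  obtain ⟨C, hC0, hC⟩ := exists_lipschitz_velocity hΩc hΩ hD hD0 hp hq hr
  have hint : ∀ y : ℝ → EuclideanSpace ℝ (Fin d), Continuous y →
      IntervalIntegrable (fun s => velocity Ω p q s (π (y s))) volume 0 T := by
    intro y hy
    refine intervalIntegrable_of_bound (C := D) hT0 ?_ fun s hs => ?_
    · exact aestronglyMeasurable_velocity_comp hΩc hp.measurable hq.measurable measurableSet_Icc
        (hπc.comp hy).continuousOn
    · exact norm_velocity_le hΩc hD hp hq ⟨hs.1, hs.2.trans hT.le⟩ (hKi (hπK _))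
  obtain ⟨y, hyc, hy⟩ := exists_continuous_eq_add_integral
    (f := fun s y => velocity Ω p q s (π y)) hT0 hC0 hint
    (fun s hs y z => (hC s ⟨hs.1, hs.2.trans hT.le⟩ _ (hπK y) _ (hπK z)).trans
      (mul_le_mul_of_nonneg_left (hπl y z) hC0)) x
  have h0 : (0 : ℝ) ∈ Icc (0 : ℝ) T := ⟨le_rfl, hT0⟩
  have hy0 : y 0 = x := by simpa using hy 0 h0
  have hyK : ∀ t ∈ Icc (0 : ℝ) T, y t ∈ K := by
    refine forall_mem_of_bootstrap hyc.continuousOn hKc (by rwa [hy0]) fun τ hτ hτT hin => ?_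
    have hcongr : ∀ t ∈ Icc (0 : ℝ) τ, ∀ s ∈ uIcc 0 t,
        velocity Ω p q s (π (y s)) = velocity Ω p q s (y s) := fun t ht s hs => by
      rw [uIcc_of_le ht.1] at hs
      rw [hπid _ (hin s ⟨hs.1, hs.2.trans ht.2⟩)]
    have h1 := mem_core_one_sub_mul hΩc hΩ hD hp hq (hτT.trans hT) hρ.le hx
      (fun t ht => hKi (hin t ht))
      ((intervalIntegrable_mono_Icc (hint y hyc) h0 hτ).congr (fun s hs =>
        hcongr τ ⟨hτ.1, le_rfl⟩ s (uIoc_subset_uIcc hs)))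
      (fun t ht => by
        rw [hy t ⟨ht.1, ht.2.trans hτ.2⟩, intervalIntegral.integral_congr (hcongr t ht)]) τ
      ⟨hτ.1, le_rfl⟩
    -- At time τ < T the confinement estimate gives margin (1 - τ)ρ, which exceeds the margin (1 -
    -- T)ρ of `K` by this amount.
    have hgap : 0 < (T - τ) * ρ := mul_pos (by linarith) hρ
    refine mem_of_superset (Metric.closedBall_mem_nhds _ hgap) fun w hw => ?_
    refine mem_core_of_norm_sub_le (ρ' := (T - τ) * ρ) (z := y τ) ?_ (by rwa [← dist_eq_norm])
    convert h1 using 1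
    ring_nf
  have hcongr : ∀ t ∈ Icc (0 : ℝ) T, ∀ s ∈ uIcc 0 t,
      velocity Ω p q s (π (y s)) = velocity Ω p q s (y s) := fun t ht s hs => by
    rw [uIcc_of_le ht.1] at hs
    rw [hπid _ (hyK s ⟨hs.1, hs.2.trans ht.2⟩)]
  refine ⟨y, hyc, fun t ht => hKi (hyK t ht), ?_, fun t ht => ?_⟩
  · exact (hint y hyc).congr (fun s hs => hcongr T ⟨hT0, le_rfl⟩ s (uIoc_subset_uIcc hs))
  · conv_lhs => rw [hy t ht, intervalIntegral.integral_congr (hcongr t ht)]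

/-- The solutions on [0,T], T < 1, agree by uniqueness and are glued along the diagonal; the bound
on the velocity makes the integral up to time 1 converge. -/
theorem exists_isSolution (hΩc : IsClosed Ω) (hΩ : Convex ℝ Ω)
    (hD : ∀ x ∈ Ω, ∀ y ∈ Ω, ‖x - y‖ ≤ D) (hD0 : 0 ≤ D)
    (hp : IsRegular Ω p m M L) (hq : IsRegular Ω q m M L) (hx : x ∈ interior Ω) :
    ∃ y, IsSolution Ω (velocity Ω p q) x y := by
  obtain ⟨ρ, hρ, hxρ⟩ := exists_mem_core_of_mem_interior hx
  have hex : ∀ T : ℝ, ∃ y : ℝ → EuclideanSpace ℝ (Fin d), T ∈ Ico (0 : ℝ) 1 → Continuous y ∧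
      (∀ t ∈ Icc (0 : ℝ) T, y t ∈ interior Ω) ∧
      IntervalIntegrable (fun s => velocity Ω p q s (y s)) volume 0 T ∧
      ∀ t ∈ Icc (0 : ℝ) T, y t = x + ∫ s in (0 : ℝ)..t, velocity Ω p q s (y s) := by
    intro T
    by_cases hT : T ∈ Ico (0 : ℝ) 1
    · obtain ⟨y, hy⟩ := exists_eq_integral hΩc hΩ hD hD0 hp hq hT.1 hT.2 hρ hxρ
      exact ⟨y, fun _ => hy⟩
    · exact ⟨0, fun h => absurd h hT⟩
  choose Y hY using hex
  set Z : ℝ → EuclideanSpace ℝ (Fin d) := fun t => Y t t with hZ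
  have hZY : ∀ T ∈ Ico (0 : ℝ) 1, EqOn Z (Y T) (Icc 0 T) := by
    intro T hT t ht
    have ht1 : t ∈ Ico (0 : ℝ) 1 := ⟨ht.1, ht.2.trans_lt hT.2⟩
    obtain ⟨-, a1, a2, a3⟩ := hY t ht1
    obtain ⟨-, b1, b2, b3⟩ := hY T hT
    exact eqOn_of_eq_integral (x := x) hΩc hΩ hD hD0 hp hq ht.1 ht1.2.le a1
      (fun s hs => b1 s ⟨hs.1, hs.2.trans ht.2⟩) a2
      (intervalIntegrable_mono_Icc b2 ⟨le_rfl, hT.1⟩ ht) a3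
      (fun s hs => b3 s ⟨hs.1, hs.2.trans ht.2⟩) ⟨ht.1, le_rfl⟩
  have hZi : ∀ t ∈ Ico (0 : ℝ) 1, Z t ∈ interior Ω := fun t ht => (hY t ht).2.1 t ⟨ht.1, le_rfl⟩
  have hZc : ContinuousOn Z (Ico 0 1) := by
    intro t ht
    obtain ⟨T, hT1, hT2⟩ := exists_between ht.2
    have hT : T ∈ Ico (0 : ℝ) 1 := ⟨ht.1.trans hT1.le, hT2⟩
    have h1 : ContinuousWithinAt Z (Icc 0 T) t :=
      ((hY T hT).1.continuousOn.congr (hZY T hT)) t ⟨ht.1, hT1.le⟩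
    refine h1.mono_of_mem_nhdsWithin ?_
    have : Ico (0 : ℝ) 1 ∩ Iio T ∈ 𝓝[Ico 0 1] t := inter_mem_nhdsWithin _ (Iio_mem_nhds hT1)
    exact mem_of_superset this fun s hs => ⟨hs.1.1, hs.2.le⟩
  have hZint : IntervalIntegrable (fun s => velocity Ω p q s (Z s)) volume 0 1 := by
    rw [intervalIntegrable_iff_integrableOn_Ico_of_le zero_le_one]
    refine Integrable.of_bound (aestronglyMeasurable_velocity_comp hΩc hp.measurable hq.measurable
      measurableSet_Ico hZc) D ?_
    filter_upwards [ae_restrict_mem measurableSet_Ico] with s hs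
    exact norm_velocity_le hΩc hD hp hq ⟨hs.1, hs.2.le⟩ (hZi s hs)
  -- `Z 1` is arbitrary, because `Y 1` is unconstrained. The integral formula replaces it by the
  -- limit at time 1, and the change at a single time does not affect integrals.
  set W : ℝ → EuclideanSpace ℝ (Fin d) :=
    fun t => x + ∫ s in (0 : ℝ)..t, velocity Ω p q s (Z s) with hW
  have hWZ : ∀ t ∈ Ico (0 : ℝ) 1, W t = Z t := by
    intro t ht
    have h1 := (hY t ht).2.2.2 t ⟨ht.1, le_rfl⟩
    rw [hW, hZ]
    simp only
    rw [h1]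
    congr 1
    refine intervalIntegral.integral_congr fun s hs => ?_
    rw [uIcc_of_le ht.1] at hs
    rw [← hZY t ht hs]
  have hae : ∀ᵐ s ∂(volume : Measure ℝ), s ∈ Icc (0 : ℝ) 1 →
      velocity Ω p q s (Z s) = velocity Ω p q s (W s) := by
    have : ∀ᵐ s ∂(volume : Measure ℝ), s ≠ 1 := by simp [ae_iff, measure_singleton]
    filter_upwards [this] with s hs1 hs
    rw [hWZ s ⟨hs.1, lt_of_le_of_ne hs.2 hs1⟩]
  refine ⟨W, fun t ht => by rw [hWZ t ht]; exact hZi t ht, ?_, fun t ht => ?_⟩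
  · refine hZint.congr_ae ?_
    rw [EventuallyEq, ae_restrict_iff' measurableSet_uIoc]
    filter_upwards [hae] with s hs hs'
    rw [uIoc_of_le zero_le_one] at hs'
    exact hs ⟨hs'.1.le, hs'.2⟩
  · change x + _ = x + _
    congr 1
    refine intervalIntegral.integral_congr_ae ?_
    filter_upwards [hae] with s hs hs'
    rw [uIoc_of_le ht.1] at hs'
    exact hs ⟨hs'.1.le, hs'.2.trans ht.2⟩

end Flow

end RectifiedFlow

namespace RectifiedFlow

/-! ### Lipschitz constants from almost everywhere derivative bounds. -/

section LipschitzOfFDeriv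

variable {E : Type*} [NormedAddCommGroup E] [NormedSpace ℝ E] [FiniteDimensional ℝ E]
  [MeasurableSpace E] [BorelSpace E] {μ : Measure E} [μ.IsAddHaarMeasure]

/-- A function that is Lipschitz on a convex set with non-empty interior is Lipschitz with any
constant that bounds its derivative almost everywhere. -/
theorem abs_sub_le_of_ae_norm_fderiv_le {g : E → ℝ} {Ω : Set E} {K : ℝ≥0} {κ : ℝ}
    (hΩ : Convex ℝ Ω) (hne : (interior Ω).Nonempty) (hg : LipschitzOnWith K g Ω) (hκ : 0 ≤ κ)
    (h : ∀ᵐ x ∂μ, x ∈ interior Ω → ‖fderiv ℝ g x‖ ≤ κ) :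
    ∀ x ∈ Ω, ∀ y ∈ Ω, |g x - g y| ≤ κ * ‖x - y‖ := by
  have hdiff : ∀ᵐ x ∂μ, x ∈ interior Ω → DifferentiableAt ℝ g x := by
    filter_upwards [hg.ae_differentiableWithinAt_of_mem (μ := μ)] with x hx hxi
    exact (hx (interior_subset hxi)).differentiableAt (mem_interior_iff_mem_nhds.1 hxi)
  have hgood := hdiff.and h
  -- A measurable null set containing the bad points, as Fubini's theorem requires measurability.
  set N := toMeasurable μ {x | ¬((x ∈ interior Ω → DifferentiableAt ℝ g x) ∧
    (x ∈ interior Ω → ‖fderiv ℝ g x‖ ≤ κ))} with hN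
  have hN0 : μ N = 0 := by rw [hN, measure_toMeasurable]; exact hgood
  have hNm : MeasurableSet N := measurableSet_toMeasurable _ _
  have hNgood : ∀ x ∉ N, x ∈ interior Ω → DifferentiableAt ℝ g x ∧ ‖fderiv ℝ g x‖ ≤ κ := by
    intro x hx hxi
    by_contra hc
    exact hx (subset_toMeasurable _ _ fun hh => hc ⟨hh.1 hxi, hh.2 hxi⟩)
  have hint : ∀ x ∈ interior Ω, ∀ y ∈ interior Ω, |g x - g y| ≤ κ * ‖x - y‖ := by
    intro x hx y hy
    -- The segment from x to y may lie wholly in the null set. By Fubini almost every translate of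
    -- it meets the null set in a null set of parameters only. Such translations are dense, so the
    -- bound holds along translates and passes to the limit w → 0.
    have hae : ∀ᵐ w ∂μ, ∀ᵐ t : ℝ, x + w + t • (y - x) ∉ N := by
      rw [← Measure.ae_ae_comm (p := fun (t : ℝ) (w : E) => x + w + t • (y - x) ∉ N)]
      · refine Eventually.of_forall fun t => ?_
        rw [ae_iff]
        simp only [not_not]
        have : {w | x + w + t • (y - x) ∈ N} = (fun w => (x + t • (y - x)) + w) ⁻¹' N := by
          ext w; simp only [mem_ofPred_eq, mem_preimage]
          rw [add_right_comm]
        rw [this, measure_preimage_add]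
        exact hN0
      · exact (hNm.preimage (f := fun u : ℝ × E => x + u.2 + u.1 • (y - x)) (by fun_prop)).compl
    have hdense := Measure.dense_of_ae hae
    set A := {w : E | ∀ᵐ t : ℝ, x + w + t • (y - x) ∉ N} with hA
    have hneb : (𝓝[A] (0 : E)).NeBot := mem_closure_iff_nhdsWithin_neBot.1 (hdense 0)
    have hnear : ∀ z ∈ interior Ω, Tendsto (fun w => z + w) (𝓝[A] 0) (𝓝 z) := fun z _ => by
      have : Tendsto (fun w => z + w) (𝓝 0) (𝓝 (z + 0)) := by
        apply Continuous.tendsto; fun_prop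
      rw [add_zero] at this
      exact this.mono_left nhdsWithin_le_nhds
    have hgc : ∀ z ∈ interior Ω, Tendsto (fun w => g (z + w)) (𝓝[A] 0) (𝓝 (g z)) := fun z hz =>
      (hg.continuousOn.continuousAt (mem_interior_iff_mem_nhds.1 hz)).tendsto.comp (hnear z hz)
    refine le_of_tendsto (((hgc x hx).sub (hgc y hy)).abs) ?_
    filter_upwards [hnear x hx (isOpen_interior.mem_nhds hx),
      hnear y hy (isOpen_interior.mem_nhds hy), self_mem_nhdsWithin] with w hxw hyw hwA
    set φ : ℝ → ℝ := fun t => g (x + w + t • (y - x)) with hφ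
    have hseg : ∀ t ∈ Icc (0 : ℝ) 1, x + w + t • (y - x) ∈ interior Ω := fun t ht => by
      have := hΩ.interior hxw hyw (sub_nonneg.2 ht.2) ht.1 (by ring)
      convert this using 1
      module
    have hlip : LipschitzOnWith (K * ‖y - x‖₊) φ (uIcc 0 1) := by
      rw [uIcc_of_le zero_le_one]
      refine LipschitzOnWith.of_dist_le_mul fun t ht s hs => ?_
      refine (hg.dist_le_mul _ (interior_subset (hseg t ht)) _ (interior_subset (hseg s hs))).trans
        (le_of_eq ?_)
      rw [dist_eq_norm, show x + w + t • (y - x) - (x + w + s • (y - x)) = (t - s) • (y - x) by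
        module, norm_smul, Real.dist_eq, Real.norm_eq_abs]
      push_cast
      ring
    have hFTC := hlip.absolutelyContinuousOnInterval.integral_deriv_eq_sub
    have hb : ‖∫ t in (0 : ℝ)..1, deriv φ t‖ ≤ (κ * ‖x - y‖) * |1 - 0| := by
      refine intervalIntegral.norm_integral_le_of_norm_le_const_ae ?_
      filter_upwards [hwA] with t ht hti
      rw [uIoc_of_le zero_le_one] at hti
      obtain ⟨h1, h2⟩ := hNgood _ ht (hseg t ⟨hti.1.le, hti.2⟩)
      have hd : HasDerivAt (fun t : ℝ => x + w + t • (y - x)) (y - x) t := by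
        simpa using ((hasDerivAt_id t).smul_const (y - x)).const_add (x + w)
      have := h1.hasFDerivAt.comp_hasDerivAt t hd
      have e : deriv φ t = fderiv ℝ g (x + w + t • (y - x)) (y - x) := this.deriv
      rw [e, norm_sub_rev x y]
      exact ContinuousLinearMap.le_of_opNorm_le _ h2 _
    rw [hFTC] at hb
    simp only [hφ, one_smul, zero_smul, add_zero, sub_zero, abs_one, mul_one,
      Real.norm_eq_abs] at hb
    rw [show x + w + (y - x) = y + w by abel] at hb
    rwa [abs_sub_comm] at hb
  have h1 : LipschitzOnWith (Real.toNNReal κ) g (interior Ω) :=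
    LipschitzOnWith.of_dist_le_mul fun x hx y hy => by
      rw [Real.dist_eq, dist_eq_norm, Real.coe_toNNReal _ hκ]; exact hint x hx y hy
  intro x hx y hy
  have hcl : Ω ⊆ closure (interior Ω) := by
    rw [hΩ.closure_interior_eq_closure_of_nonempty_interior hne]; exact subset_closure
  have h2 : ∀ z ∈ Ω, ∃ u : ℕ → E, (∀ n, u n ∈ interior Ω) ∧ Tendsto u atTop (𝓝 z) := fun z hz =>
    mem_closure_iff_seq_limit.1 (hcl hz)
  obtain ⟨u, hu, hux⟩ := h2 x hx
  obtain ⟨w, hw, hwy⟩ := h2 y hy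
  have hgu : ∀ (u : ℕ → E) (z : E), z ∈ Ω → (∀ n, u n ∈ interior Ω) → Tendsto u atTop (𝓝 z) →
      Tendsto (fun n => g (u n)) atTop (𝓝 (g z)) := fun u z hz hu hlim =>
    (hg.continuousOn z hz).tendsto.comp (tendsto_nhdsWithin_iff.2
      ⟨hlim, Eventually.of_forall fun n => interior_subset (hu n)⟩)
  refine le_of_tendsto_of_tendsto' ((hgu u x hx hu hux).sub (hgu w y hy hw hwy)).abs
    ((hux.sub hwy).norm.const_mul κ) fun n => hint _ (hu n) _ (hw n)

end LipschitzOfFDeriv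

/-! ### From the linear modulus to regular densities. -/

section Modulus

variable {d : ℕ} {Ω : Set (EuclideanSpace ℝ (Fin d))}
  {p q : EuclideanSpace ℝ (Fin d) → ℝ}

/-- At a zero of p the ratio p(z)/p(z) is 0 by the convention for division, so the modulus is at
least 1 for every η; a choice of η with |L|η < 1 excludes this. -/
theorem HasLinearModulus.exists_le (h : HasLinearModulus Ω p q) :
    ∃ L, 0 ≤ L ∧ ∀ z ∈ Ω, (p z ≠ 0 ∧ q z ≠ 0) ∧ ∀ z' ∈ Ω,
      |p z / p z' - 1| ≤ L * ‖z - z'‖ ∧ |q z / q z' - 1| ≤ L * ‖z - z'‖ := by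
  obtain ⟨L, hL⟩ := h
  have key : ∀ z ∈ Ω, ∀ z' ∈ Ω, ∀ η > 0, ‖z - z'‖ ≤ η →
      max |p z / p z' - 1| |q z / q z' - 1| ≤ |L| * η := by
    intro z hz z' hz' η hη hzz
    have h1 : ENNReal.ofReal (max |p z / p z' - 1| |q z / q z' - 1|) ≤ modulus Ω p q η := by
      rw [modulus]
      exact le_iSup₂_of_le z hz (le_iSup₂_of_le z' hz' (le_iSup_of_le hzz le_rfl))
    have h2 := h1.trans ((hL η hη).trans
      (ENNReal.ofReal_le_ofReal (mul_le_mul_of_nonneg_right (le_abs_self L) hη.le)))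
    exact (ENNReal.ofReal_le_ofReal_iff (by positivity)).1 h2
  have hz0 : ∀ z ∈ Ω, p z ≠ 0 ∧ q z ≠ 0 := by
    intro z hz
    have h1 := key z hz z hz (1 / (2 * (|L| + 1))) (by positivity) (by
      rw [sub_self, norm_zero]; positivity)
    have h2 : |L| * (1 / (2 * (|L| + 1))) < 1 := by
      rw [mul_one_div, div_lt_one (by positivity)]
      linarith [abs_nonneg L]
    constructor
    · intro hp
      have := (le_max_left _ _).trans h1
      simp only [hp, div_zero, zero_sub, abs_neg, abs_one] at this
      linarith
    · intro hq
      have := (le_max_right _ _).trans h1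
      simp only [hq, div_zero, zero_sub, abs_neg, abs_one] at this
      linarith
  refine ⟨|L|, abs_nonneg _, fun z hz => ⟨hz0 z hz, fun z' hz' => ?_⟩⟩
  rcases eq_or_ne z z' with rfl | hne
  · simp [hz0 z hz]
  · have := key z hz z' hz' ‖z - z'‖ (norm_pos_iff.2 (sub_ne_zero.2 hne)) le_rfl
    exact ⟨(le_max_left _ _).trans this, (le_max_right _ _).trans this⟩

theorem IsRegular.mono {m M L m' M' L' : ℝ} (h : IsRegular Ω p m M L) (h0 : 0 < m') (hm : m' ≤ m)
    (hM : M ≤ M') (hL : L ≤ L') : IsRegular Ω p m' M' L' :=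
  ⟨h.measurable, h0, h.nonneg.trans hL, fun x hx => hm.trans (h.lower x hx),
    fun x hx => (h.upper x hx).trans hM,
    fun x hx y hy => (h.lipschitz x hx y hy).trans (by gcongr)⟩

-- The modulus condition allows negative functions. A nowhere vanishing continuous function on a
-- convex set has constant sign, and σ = ±1 makes it positive. The cutoff to Ω restores
-- measurability, since values off Ω are arbitrary.
open Classical in
theorem exists_isRegular_indicator (hΩ : IsCompact Ω) (hc : Convex ℝ Ω) (hne : Ω.Nonempty) {L : ℝ}
    (hL : 0 ≤ L) (h0 : ∀ z ∈ Ω, p z ≠ 0)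
    (h : ∀ z ∈ Ω, ∀ z' ∈ Ω, |p z / p z' - 1| ≤ L * ‖z - z'‖) :
    ∃ σ m M L' : ℝ, σ ≠ 0 ∧ IsRegular Ω (Ω.indicator fun x => σ * p x) m M L' ∧
      ((∀ x ∈ Ω, 0 < p x) → σ = 1) := by
  have hlip : ∀ z ∈ Ω, ∀ z' ∈ Ω, |p z - p z'| ≤ L * |p z'| * ‖z - z'‖ := by
    intro z hz z' hz'
    have e : p z - p z' = (p z / p z' - 1) * p z' := by
      have := h0 z' hz'
      field_simp
    rw [e, abs_mul]
    calc _ ≤ L * ‖z - z'‖ * |p z'| := by gcongr; exact h z hz z' hz'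
      _ = _ := by ring
  have hcont : ContinuousOn p Ω := by
    intro z' hz'
    rw [ContinuousWithinAt, tendsto_iff_norm_sub_tendsto_zero]
    have h1 : Tendsto (fun z => L * |p z'| * ‖z - z'‖) (𝓝[Ω] z') (𝓝 0) := by
      have : Tendsto (fun z => L * |p z'| * ‖z - z'‖) (𝓝 z') (𝓝 (L * |p z'| * ‖z' - z'‖)) := by
        apply Continuous.tendsto; fun_prop
      simp only [sub_self, norm_zero, mul_zero] at this
      exact this.mono_left nhdsWithin_le_nhds
    refine squeeze_zero' (Eventually.of_forall fun _ => norm_nonneg _) ?_ h1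
    filter_upwards [self_mem_nhdsWithin] with z hz using hlip z hz z' hz'
  obtain ⟨w, hw⟩ := hne
  obtain ⟨σ, hσ, hpos, hσ1⟩ : ∃ σ : ℝ, |σ| = 1 ∧ (∀ x ∈ Ω, 0 < σ * p x) ∧
      ((∀ x ∈ Ω, 0 < p x) → σ = 1) := by
    rcases lt_or_gt_of_ne (h0 w hw) with hneg | hposw
    · refine ⟨-1, by simp, fun x hx => ?_, fun hall => absurd (hall w hw) hneg.not_gt⟩
      by_contra hx'
      have hx0 : 0 ≤ p x := by linarith
      obtain ⟨y, hy, hy0⟩ := hc.isPreconnected.intermediate_value hw hx hcont ⟨hneg.le, hx0⟩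
      exact h0 y hy hy0
    · refine ⟨1, by simp, fun x hx => ?_, fun _ => rfl⟩
      by_contra hx'
      have hx0 : p x ≤ 0 := by linarith
      obtain ⟨y, hy, hy0⟩ := hc.isPreconnected.intermediate_value hx hw hcont ⟨hx0, hposw.le⟩
      exact h0 y hy hy0
  have hcσ : ContinuousOn (fun x => σ * p x) Ω := continuousOn_const.mul hcont
  obtain ⟨a, ha, hmin⟩ := hΩ.exists_isMinOn ⟨w, hw⟩ hcσ
  obtain ⟨b, hb, hmax⟩ := hΩ.exists_isMaxOn ⟨w, hw⟩ hcσ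
  have hbpos := hpos b hb
  refine ⟨σ, σ * p a, σ * p b, L * (σ * p b), by rintro rfl; simp at hσ, ⟨?_, hpos a ha,
    by positivity, ?_, ?_, ?_⟩, hσ1⟩
  · rw [← piecewise_eq_indicator]
    exact hcσ.measurable_piecewise continuousOn_const hΩ.measurableSet
  · intro x hx
    rw [indicator_of_mem hx]
    exact hmin hx
  · intro x hx
    rw [indicator_of_mem hx]
    exact hmax hx
  · intro x hx y hy
    rw [indicator_of_mem hx, indicator_of_mem hy, ← mul_sub, abs_mul, hσ, one_mul]
    refine (hlip x hx y hy).trans ?_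
    have : |p y| = σ * p y := by
      rw [← abs_of_pos (hpos y hy), abs_mul, hσ, one_mul]
    rw [this]
    exact mul_le_mul_of_nonneg_right (mul_le_mul_of_nonneg_left (hmax hy) hL) (norm_nonneg _)

/-- The velocity of a pair with a linear modulus is that of a regular pair. -/
theorem HasLinearModulus.exists_isRegular (h : HasLinearModulus Ω p q) (hΩ : IsCompact Ω)
    (hc : Convex ℝ Ω) (hne : Ω.Nonempty) :
    ∃ (p' q' : EuclideanSpace ℝ (Fin d) → ℝ) (m M L : ℝ), IsRegular Ω p' m M L ∧
      IsRegular Ω q' m M L ∧ velocity Ω p q = velocity Ω p' q' ∧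
      ((∀ x ∈ Ω, 0 < p x) → ∀ x ∈ Ω, p' x = p x) ∧
      ((∀ x ∈ Ω, 0 < q x) → ∀ x ∈ Ω, q' x = q x) := by
  obtain ⟨L, hL, h⟩ := h.exists_le
  obtain ⟨σ, m₁, M₁, L₁, hσ, hp, hσ1⟩ := exists_isRegular_indicator hΩ hc hne hL
    (fun z hz => (h z hz).1.1) (fun z hz z' hz' => ((h z hz).2 z' hz').1)
  obtain ⟨τ, m₂, M₂, L₂, hτ, hq, hτ1⟩ := exists_isRegular_indicator hΩ hc hne hL
    (fun z hz => (h z hz).1.2) (fun z hz z' hz' => ((h z hz).2 z' hz').2)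
  refine ⟨_, _, min m₁ m₂, max M₁ M₂, max L₁ L₂,
    hp.mono (lt_min hp.pos hq.pos) (min_le_left _ _) (le_max_left _ _) (le_max_left _ _),
    hq.mono (lt_min hp.pos hq.pos) (min_le_right _ _) (le_max_right _ _) (le_max_right _ _),
    ?_, fun hpos x hx => by rw [indicator_of_mem hx, hσ1 hpos, one_mul],
    fun hpos x hx => by rw [indicator_of_mem hx, hτ1 hpos, one_mul]⟩
  -- The signs are common factors of numerator and denominator and cancel.
  funext t z
  have hSm := (isClosed_admissible hΩ.isClosed (t := t) (z := z)).measurableSet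
  have e : ∀ δ ∈ admissible Ω t z, (Ω.indicator (fun x => σ * p x) (z - t • δ) *
      Ω.indicator (fun x => τ * q x) (z + (1 - t) • δ)) =
      (σ * τ) * (p (z - t • δ) * q (z + (1 - t) • δ)) := fun δ hδ => by
    rw [indicator_of_mem hδ.1, indicator_of_mem hδ.2]; ring
  have e' : ∀ δ ∈ admissible Ω t z, (Ω.indicator (fun x => σ * p x) (z - t • δ) *
      Ω.indicator (fun x => τ * q x) (z + (1 - t) • δ)) • δ =
      (σ * τ) • ((p (z - t • δ) * q (z + (1 - t) • δ)) • δ) := fun δ hδ => by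
    rw [e δ hδ, mul_smul]
  rw [velocity, velocity, setIntegral_congr_fun hSm e, setIntegral_congr_fun hSm e',
    integral_const_mul, integral_smul, smul_smul, mul_inv, mul_comm _ (σ * τ), ← mul_assoc,
    mul_inv_cancel₀ (mul_ne_zero hσ hτ), one_mul]

end Modulus

end RectifiedFlow

namespace RectifiedFlow

/-! ### From log-ratio and score errors to errors of the velocity. -/

theorem abs_exp_sub_exp_le {a b c : ℝ} (ha : a ≤ c) (hb : b ≤ c) :
    |Real.exp a - Real.exp b| ≤ Real.exp c * |a - b| := by
  have key : ∀ a b : ℝ, a ≤ c → Real.exp a - Real.exp b ≤ Real.exp c * |a - b| := by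
    intro a b ha
    have h1 : Real.exp a - Real.exp b = Real.exp a * (1 - Real.exp (b - a)) := by
      rw [mul_sub, mul_one, ← Real.exp_add, add_sub_cancel]
    have h2 : 1 - Real.exp (b - a) ≤ |a - b| := by
      linarith [Real.add_one_le_exp (b - a), le_abs_self (a - b)]
    rw [h1]
    exact (mul_le_mul_of_nonneg_left h2 (Real.exp_pos a).le).trans
      (mul_le_mul_of_nonneg_right (Real.exp_le_exp.2 ha) (abs_nonneg _))
  refine abs_le.2 ⟨?_, key a b ha⟩
  have := key b a hb
  rw [abs_sub_comm] at this
  linarith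

theorem abs_log_sub_log_le {a b m : ℝ} (hm : 0 < m) (ha : m ≤ a) (hb : m ≤ b) :
    |Real.log a - Real.log b| ≤ m⁻¹ * |a - b| := by
  have key : ∀ a b : ℝ, m ≤ a → m ≤ b → Real.log a - Real.log b ≤ m⁻¹ * |a - b| := by
    intro a b ha hb
    have ha0 := hm.trans_le ha
    have hb0 := hm.trans_le hb
    rw [← Real.log_div ha0.ne' hb0.ne']
    refine (Real.log_le_sub_one_of_pos (div_pos ha0 hb0)).trans ?_
    have : a / b - 1 = b⁻¹ * (a - b) := by field_simp
    rw [this]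
    calc b⁻¹ * (a - b) ≤ b⁻¹ * |a - b| :=
          mul_le_mul_of_nonneg_left (le_abs_self _) (inv_pos.2 hb0).le
      _ ≤ m⁻¹ * |a - b| := by gcongr
  refine abs_le.2 ⟨?_, key a b ha hb⟩
  have := key b a hb ha
  rw [abs_sub_comm] at this
  linarith

section Kernel

variable {d : ℕ} {Ω : Set (EuclideanSpace ℝ (Fin d))}
  {p q p' q' : EuclideanSpace ℝ (Fin d) → ℝ} {m M L κ : ℝ}

/-- If the log-ratios of two pairs are bounded by `κ` and Lipschitz with constant `κ`, then the
difference of the product kernels is of order `κ`. -/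
theorem chordKernel_sub (hne : Ω.Nonempty) (hp : IsRegular Ω p m M L) (hq : IsRegular Ω q m M L)
    (hp' : Measurable p') (hq' : Measurable q') (hκ0 : 0 ≤ κ) (hκ : κ ≤ 1)
    {g h : EuclideanSpace ℝ (Fin d) → ℝ}
    (hpg : ∀ x ∈ Ω, p' x = p x * Real.exp (g x)) (hqh : ∀ x ∈ Ω, q' x = q x * Real.exp (h x))
    (hg : ∀ x ∈ Ω, |g x| ≤ κ) (hh : ∀ x ∈ Ω, |h x| ≤ κ)
    (hgl : ∀ x ∈ Ω, ∀ y ∈ Ω, |g x - g y| ≤ κ * ‖x - y‖)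
    (hhl : ∀ x ∈ Ω, ∀ y ∈ Ω, |h x - h y| ≤ κ * ‖x - y‖) :
    ChordKernel Ω (fun x y => p' x * q' y - p x * q y)
      (Real.exp 2 * (2 * M ^ 2 + 4 * M * L) * κ) (Real.exp 2 * (2 * M ^ 2 + 4 * M * L) * κ) := by
  have hK := hp.chordKernel hne hq
  obtain ⟨w, hw⟩ := hne
  have hM : 0 ≤ M := hp.pos.le.trans ((hp.lower w hw).trans (hp.upper w hw))
  have hL := hp.nonneg
  have he : 0 < Real.exp 2 := Real.exp_pos 2
  have hG : ∀ x ∈ Ω, ∀ y ∈ Ω, |g x + h y| ≤ 2 * κ := fun x hx y hy =>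
    (abs_add_le _ _).trans (by linarith [hg x hx, hh y hy])
  have hG2 : ∀ x ∈ Ω, ∀ y ∈ Ω, g x + h y ≤ 2 := fun x hx y hy =>
    (le_abs_self _).trans ((hG x hx y hy).trans (by linarith))
  -- The error kernel is the original kernel times exp(g + h) - 1. As g + h ≤ 2κ ≤ 2, the
  -- exponential has Lipschitz constant exp 2 on the relevant range.
  have e0 : ∀ x ∈ Ω, ∀ y ∈ Ω, p' x * q' y - p x * q y =
      p x * q y * (Real.exp (g x + h y) - 1) := fun x hx y hy => by
    rw [hpg x hx, hqh y hy, Real.exp_add]; ring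
  have hexp1 : ∀ x ∈ Ω, ∀ y ∈ Ω, |Real.exp (g x + h y) - 1| ≤ Real.exp 2 * (2 * κ) := by
    intro x hx y hy
    have := abs_exp_sub_exp_le (hG2 x hx y hy) (zero_le_two (α := ℝ))
    rw [Real.exp_zero, sub_zero] at this
    exact this.trans (mul_le_mul_of_nonneg_left (hG x hx y hy) he.le)
  refine ⟨?_, by positivity, fun x hx y hy => ?_, fun u x hx y hy hxu hyu => ?_⟩
  · exact ((hp'.comp measurable_fst).mul (hq'.comp measurable_snd)).sub
      ((hp.measurable.comp measurable_fst).mul (hq.measurable.comp measurable_snd))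
  · rw [e0 x hx y hy, abs_mul]
    calc |p x * q y| * |Real.exp (g x + h y) - 1| ≤ M ^ 2 * (Real.exp 2 * (2 * κ)) :=
          mul_le_mul (hK.bound x hx y hy) (hexp1 x hx y hy) (abs_nonneg _) (by positivity)
      _ = Real.exp 2 * (2 * M ^ 2) * κ := by ring
      _ ≤ _ := by gcongr; nlinarith [mul_nonneg hM hL]
  · have e1 : (p' (x + u) * q' (y + u) - p (x + u) * q (y + u)) - (p' x * q' y - p x * q y) =
        (p (x + u) * q (y + u) - p x * q y) * (Real.exp (g (x + u) + h (y + u)) - 1) +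
        p x * q y * (Real.exp (g (x + u) + h (y + u)) - Real.exp (g x + h y)) := by
      rw [e0 _ hxu _ hyu, e0 x hx y hy]; ring
    have h1 := mul_le_mul (hK.lipschitz u x hx y hy hxu hyu) (hexp1 _ hxu _ hyu) (abs_nonneg _)
      (mul_nonneg hK.nonneg (norm_nonneg _))
    have h2 : |Real.exp (g (x + u) + h (y + u)) - Real.exp (g x + h y)| ≤
        Real.exp 2 * (2 * κ * ‖u‖) := by
      refine (abs_exp_sub_exp_le (hG2 _ hxu _ hyu) (hG2 x hx y hy)).trans
        (mul_le_mul_of_nonneg_left ?_ he.le)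
      have a1 := hgl _ hxu _ hx
      have a2 := hhl _ hyu _ hy
      rw [add_sub_cancel_left] at a1 a2
      rw [add_sub_add_comm]
      exact (abs_add_le _ _).trans (by linarith)
    have h3 := mul_le_mul (hK.bound x hx y hy) h2 (abs_nonneg _) (by positivity)
    rw [e1]
    refine (abs_add_le _ _).trans ?_
    rw [abs_mul, abs_mul]
    refine (add_le_add h1 h3).trans (le_of_eq ?_)
    ring

theorem lipschitzOnWith_log (hp : IsRegular Ω p m M L) :
    LipschitzOnWith (Real.toNNReal (m⁻¹ * L)) (fun x => Real.log (p x)) Ω := by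
  have := hp.pos
  have := hp.nonneg
  refine LipschitzOnWith.of_dist_le_mul fun x hx y hy => ?_
  rw [Real.dist_eq, dist_eq_norm, Real.coe_toNNReal _ (by positivity), mul_assoc]
  exact (abs_log_sub_log_le hp.pos (hp.lower x hx) (hp.lower y hy)).trans (by
    gcongr; exact hp.lipschitz x hx y hy)

theorem ae_differentiableAt_log (hp : IsRegular Ω p m M L) :
    ∀ᵐ x, x ∈ interior Ω → DifferentiableAt ℝ (fun x => Real.log (p x)) x := by
  filter_upwards [(lipschitzOnWith_log hp).ae_differentiableWithinAt_of_mem] with x hx hxi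
  exact (hx (interior_subset hxi)).differentiableAt (mem_interior_iff_mem_nhds.1 hxi)

/-- A bound on the difference of the scores bounds the Lipschitz constant of the log-ratio. -/
theorem abs_log_sub_log_sub_le_of_gradient {m' M' L' : ℝ} (hΩ : Convex ℝ Ω)
    (hne : (interior Ω).Nonempty) (hp : IsRegular Ω p m M L) (hp' : IsRegular Ω p' m' M' L')
    (hκ : 0 ≤ κ)
    (h : ∀ᵐ x, x ∈ interior Ω → ‖gradient (fun y => Real.log (p' y)) x -
      gradient (fun y => Real.log (p y)) x‖ ≤ κ) :
    ∀ x ∈ Ω, ∀ y ∈ Ω, |(Real.log (p' x) - Real.log (p x)) - (Real.log (p' y) - Real.log (p y))| ≤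
      κ * ‖x - y‖ := by
  refine abs_sub_le_of_ae_norm_fderiv_le (μ := volume)
    (g := fun x => Real.log (p' x) - Real.log (p x)) hΩ hne
    ((lipschitzOnWith_log hp').sub (lipschitzOnWith_log hp)) hκ ?_
  -- Rademacher's theorem makes both logarithms differentiable almost everywhere. Elsewhere the
  -- gradients can be default zeros and would say nothing about the log-ratio.
  filter_upwards [ae_differentiableAt_log hp, ae_differentiableAt_log hp', h] with x h1 h2 h3 hx
  rw [fderiv_fun_sub (h2 hx) (h1 hx), ← toDual_gradient, ← toDual_gradient, ← map_sub,
    LinearIsometryEquiv.norm_map]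
  exact h3 hx

end Kernel

theorem of_absLogRatio_le {a b κ : ℝ} (hκ : 0 ≤ κ) (h : absLogRatio a b ≤ ENNReal.ofReal κ) :
    0 < a ∧ |Real.log (a / b)| ≤ κ := by
  rw [absLogRatio] at h
  split_ifs at h with ha
  · exact ⟨ha, (ENNReal.ofReal_le_ofReal_iff hκ).1 h⟩
  · exact absurd h (by simp)

section Errors

variable {d : ℕ} {Ω : Set (EuclideanSpace ℝ (Fin d))}
  {p₀ p₁ q₀ q₁ : EuclideanSpace ℝ (Fin d) → ℝ} {κ : ℝ}

theorem of_logRatioError_le (hκ : 0 ≤ κ)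
    (h : logRatioError Ω p₀ p₁ q₀ q₁ ≤ ENNReal.ofReal κ) :
    ∀ x ∈ Ω, (0 < q₀ x ∧ |Real.log (q₀ x / p₀ x)| ≤ κ) ∧
      (0 < q₁ x ∧ |Real.log (q₁ x / p₁ x)| ≤ κ) := by
  intro x hx
  have h1 : max (absLogRatio (q₀ x) (p₀ x)) (absLogRatio (q₁ x) (p₁ x)) ≤ ENNReal.ofReal κ :=
    le_trans (le_iSup₂_of_le (f := fun x (_ : x ∈ Ω) =>
      max (absLogRatio (q₀ x) (p₀ x)) (absLogRatio (q₁ x) (p₁ x))) x hx le_rfl) h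
  exact ⟨of_absLogRatio_le hκ ((le_max_left _ _).trans h1),
    of_absLogRatio_le hκ ((le_max_right _ _).trans h1)⟩

theorem of_scoreError_le (hκ : 0 ≤ κ) (h : scoreError Ω p₀ p₁ q₀ q₁ ≤ ENNReal.ofReal κ) :
    (∀ᵐ x, x ∈ interior Ω → ‖gradient (fun y => Real.log (q₀ y)) x -
      gradient (fun y => Real.log (p₀ y)) x‖ ≤ κ) ∧
    (∀ᵐ x, x ∈ interior Ω → ‖gradient (fun y => Real.log (q₁ y)) x -
      gradient (fun y => Real.log (p₁ y)) x‖ ≤ κ) := by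
  have key := ENNReal.ae_le_essSup (μ := volume.restrict (interior Ω)) (fun x =>
    max ‖gradient (fun y => Real.log (q₀ y)) x - gradient (fun y => Real.log (p₀ y)) x‖ₑ
      ‖gradient (fun y => Real.log (q₁ y)) x - gradient (fun y => Real.log (p₁ y)) x‖ₑ)
  rw [ae_restrict_iff' isOpen_interior.measurableSet] at key
  have aux : ∀ w : EuclideanSpace ℝ (Fin d), ‖w‖ₑ ≤ ENNReal.ofReal κ → ‖w‖ ≤ κ := fun w hw => by
    rwa [← ofReal_norm, ENNReal.ofReal_le_ofReal_iff hκ] at hw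
  constructor
  · filter_upwards [key] with x hx hxi
    exact aux _ ((le_max_left _ _).trans ((hx hxi).trans h))
  · filter_upwards [key] with x hx hxi
    exact aux _ ((le_max_right _ _).trans ((hx hxi).trans h))

/-- Closeness of velocities in terms of the log-ratio and score errors. -/
theorem exists_velocity_sub_le_of_errors {m M L D ρ : ℝ} (hΩk : IsCompact Ω) (hΩ : Convex ℝ Ω)
    (hne : (interior Ω).Nonempty) (hD : ∀ x ∈ Ω, ∀ y ∈ Ω, ‖x - y‖ ≤ D) (hD0 : 0 ≤ D)
    (hp₀ : IsRegular Ω p₀ m M L) (hp₁ : IsRegular Ω p₁ m M L) (hρ : 0 < ρ) :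
    ∃ C κ₀ : ℝ, 0 ≤ C ∧ 0 < κ₀ ∧ ∀ κ, 0 ≤ κ → κ ≤ κ₀ →
      ∀ q₀ q₁ : EuclideanSpace ℝ (Fin d) → ℝ, HasLinearModulus Ω q₀ q₁ →
      logRatioError Ω p₀ p₁ q₀ q₁ ≤ ENNReal.ofReal κ →
      scoreError Ω p₀ p₁ q₀ q₁ ≤ ENNReal.ofReal κ →
      ∀ t ∈ Icc (0 : ℝ) 1, ∀ z ∈ core Ω ρ,
        ‖velocity Ω q₀ q₁ t z - velocity Ω p₀ p₁ t z‖ ≤ C * κ ∧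
        ∀ z' ∈ core Ω ρ,
          ‖(velocity Ω q₀ q₁ t z - velocity Ω p₀ p₁ t z) -
            (velocity Ω q₀ q₁ t z' - velocity Ω p₀ p₁ t z')‖ ≤ C * κ * ‖z - z'‖ := by
  obtain ⟨C, κ₀, hC, hκ₀, H⟩ := exists_velocity_sub_le hΩk.isClosed hΩ hD hD0 hp₀ hp₁ hρ
  obtain ⟨w, hw⟩ := hne
  have hwΩ := interior_subset hw
  have hM : 0 ≤ M := hp₀.pos.le.trans ((hp₀.lower w hwΩ).trans (hp₀.upper w hwΩ))
  have hL := hp₀.nonneg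
  set A := Real.exp 2 * (2 * M ^ 2 + 4 * M * L) with hA
  have hA0 : 0 ≤ A := by positivity
  -- `A * κ` is the size of the error kernel: κ ≤ 1 is needed for that bound, and A * κ ≤ κ₀ for the
  -- stability estimate of the velocity.
  refine ⟨C * A, min 1 (κ₀ / (A + 1)), by positivity, lt_min one_pos (by positivity), ?_⟩
  intro κ hκ0 hκ q₀ q₁ hq hr hs
  have hκ1 : κ ≤ 1 := hκ.trans (min_le_left _ _)
  have hκA : A * κ ≤ κ₀ := by
    have := hκ.trans (min_le_right _ _)
    rw [le_div_iff₀ (by positivity)] at this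
    nlinarith
  obtain ⟨q₀', q₁', m', M', L', hq₀', hq₁', hvel, e₀, e₁⟩ :=
    hq.exists_isRegular hΩk hΩ ⟨w, hwΩ⟩
  have hr' := of_logRatioError_le hκ0 hr
  have hs' := of_scoreError_le hκ0 hs
  have e₀ := e₀ fun x hx => (hr' x hx).1.1
  have e₁ := e₁ fun x hx => (hr' x hx).2.1
  have hgrad : ∀ q q' : EuclideanSpace ℝ (Fin d) → ℝ, (∀ x ∈ Ω, q' x = q x) → ∀ x ∈ interior Ω,
      gradient (fun y => Real.log (q' y)) x = gradient (fun y => Real.log (q y)) x := by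
    intro q q' h x hx
    have : (fun y => Real.log (q' y)) =ᶠ[𝓝 x] fun y => Real.log (q y) := by
      filter_upwards [mem_interior_iff_mem_nhds.1 hx] with y hy
      rw [h y hy]
    rw [gradient, gradient, this.fderiv_eq]
  have hpp : ∀ {p q' : EuclideanSpace ℝ (Fin d) → ℝ}, IsRegular Ω p m M L →
      IsRegular Ω q' m' M' L' →
      (∀ x ∈ Ω, q' x = p x * Real.exp (Real.log (q' x) - Real.log (p x))) := by
    intro p q' hp hq' x hx
    have h1 := hp.pos.trans_le (hp.lower x hx)
    have h2 := hq'.pos.trans_le (hq'.lower x hx)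
    rw [Real.exp_sub, Real.exp_log h1, Real.exp_log h2]
    field_simp
  have hbd : ∀ {p q q' : EuclideanSpace ℝ (Fin d) → ℝ}, IsRegular Ω p m M L →
      IsRegular Ω q' m' M' L' → (∀ x ∈ Ω, q' x = q x) →
      (∀ x ∈ Ω, |Real.log (q x / p x)| ≤ κ) →
      ∀ x ∈ Ω, |Real.log (q' x) - Real.log (p x)| ≤ κ := by
    intro p q q' hp hq' e h x hx
    have h1 := hp.pos.trans_le (hp.lower x hx)
    have h2 := hq'.pos.trans_le (hq'.lower x hx)
    rw [← Real.log_div h2.ne' h1.ne', e x hx]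
    exact h x hx
  have hK := chordKernel_sub ⟨w, hwΩ⟩ hp₀ hp₁ hq₀'.measurable hq₁'.measurable hκ0 hκ1
    (hpp hp₀ hq₀') (hpp hp₁ hq₁')
    (hbd hp₀ hq₀' e₀ fun x hx => (hr' x hx).1.2) (hbd hp₁ hq₁' e₁ fun x hx => (hr' x hx).2.2)
    (abs_log_sub_log_sub_le_of_gradient hΩ ⟨w, hw⟩ hp₀ hq₀' hκ0 (by
      filter_upwards [hs'.1] with x hx hxi
      rw [hgrad _ _ e₀ x hxi]; exact hx hxi))
    (abs_log_sub_log_sub_le_of_gradient hΩ ⟨w, hw⟩ hp₁ hq₁' hκ0 (by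
      filter_upwards [hs'.2] with x hx hxi
      rw [hgrad _ _ e₁ x hxi]; exact hx hxi))
  rw [hvel, mul_assoc C]
  exact H (A * κ) (by positivity) hκA q₀' q₁' hK

end Errors

end RectifiedFlow

namespace RectifiedFlow

/-! ### The derivative along the path and the linearization. -/

section Derivative

variable {d : ℕ}

/-- In finite dimension an operator is a finite sum of terms built from its columns, so
measurability can be checked vector by vector. -/
theorem aestronglyMeasurable_clm_of_apply {α : Type*} [MeasurableSpace α] {μ : Measure α}
    {b : α → EuclideanSpace ℝ (Fin d) →L[ℝ] EuclideanSpace ℝ (Fin d)}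
    (h : ∀ e, AEStronglyMeasurable (fun s => b s e) μ) : AEStronglyMeasurable b μ := by
  have e : b = fun s => ∑ i : Fin d, ContinuousLinearMap.smulRightL ℝ (EuclideanSpace ℝ (Fin d))
      (EuclideanSpace ℝ (Fin d)) (EuclideanSpace.proj i) (b s (EuclideanSpace.single i 1)) := by
    funext s
    refine ContinuousLinearMap.ext fun e => ?_
    conv_lhs => rw [← (EuclideanSpace.basisFun (Fin d) ℝ).sum_repr e, map_sum]
    simp [_root_.sum_apply]
  rw [e]
  refine Finset.aestronglyMeasurable_fun_sum _ fun i _ => ?_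
  exact (ContinuousLinearMap.continuous _).comp_aestronglyMeasurable (h _)

variable {Ω : Set (EuclideanSpace ℝ (Fin d))} {p q : EuclideanSpace ℝ (Fin d) → ℝ}
  {C ρ : ℝ} {y : ℝ → EuclideanSpace ℝ (Fin d)}

/-- Each directional derivative is an almost everywhere limit of difference quotients, which are
measurable in time. -/
theorem aestronglyMeasurable_fderiv_velocity (hΩc : IsClosed Ω) (hp : Measurable p)
    (hq : Measurable q) (hy : ContinuousOn y (Icc 0 1))
    (hd : ∀ᵐ s ∂(volume.restrict (Icc (0 : ℝ) 1)),
      DifferentiableAt ℝ (velocity Ω p q s) (y s)) :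
    AEStronglyMeasurable (fun s => fderiv ℝ (velocity Ω p q s) (y s))
      (volume.restrict (Icc 0 1)) := by
  refine aestronglyMeasurable_clm_of_apply fun e => ?_
  refine aestronglyMeasurable_of_tendsto_ae atTop (f := fun (n : ℕ) s =>
    (n : ℝ) • (velocity Ω p q s (y s + (n : ℝ)⁻¹ • e) - velocity Ω p q s (y s))) (fun n => ?_) ?_
  · exact ((aestronglyMeasurable_velocity_comp hΩc hp hq measurableSet_Icc
      (hy.add continuousOn_const)).sub
      (aestronglyMeasurable_velocity_comp hΩc hp hq measurableSet_Icc hy)).const_smul (n : ℝ)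
  · filter_upwards [hd] with s hs
    refine hs.hasFDerivAt.lim e ?_
    simpa using tendsto_natCast_atTop_atTop (R := ℝ)

theorem norm_fderiv_le_of_core {v : EuclideanSpace ℝ (Fin d) → EuclideanSpace ℝ (Fin d)}
    {z : EuclideanSpace ℝ (Fin d)} (hρ : 0 < ρ) (hC : 0 ≤ C) (hz : z ∈ core Ω (ρ + ρ))
    (hv : ∀ z ∈ core Ω ρ, ∀ z' ∈ core Ω ρ, ‖v z - v z'‖ ≤ C * ‖z - z'‖) :
    ‖fderiv ℝ v z‖ ≤ C := by
  have hl : LipschitzOnWith (Real.toNNReal C) v (core Ω ρ) :=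
    LipschitzOnWith.of_dist_le_mul fun a ha b hb => by
      rw [dist_eq_norm, dist_eq_norm, Real.coe_toNNReal _ hC]; exact hv a ha b hb
  have hn : core Ω ρ ∈ 𝓝 z := mem_of_superset (Metric.closedBall_mem_nhds z hρ) fun w hw =>
    mem_core_of_norm_sub_le hz (by rwa [← dist_eq_norm])
  have := norm_fderiv_le_of_lipschitzOn ℝ hn hl
  rwa [Real.coe_toNNReal _ hC] at this

end Derivative

section Linearization

variable {d : ℕ} {Ω : Set (EuclideanSpace ℝ (Fin d))} {p q : EuclideanSpace ℝ (Fin d) → ℝ}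
  {C ρ : ℝ} {y : ℝ → EuclideanSpace ℝ (Fin d)}
  {b : ℝ → EuclideanSpace ℝ (Fin d) →L[ℝ] EuclideanSpace ℝ (Fin d)}

theorem aestronglyMeasurable_remainder (hΩc : IsClosed Ω) (hp : Measurable p) (hq : Measurable q)
    (hy : ContinuousOn y (Icc 0 1)) (hbm : AEStronglyMeasurable b (volume.restrict (Icc 0 1)))
    {D : ℝ → EuclideanSpace ℝ (Fin d)} (hD : ContinuousOn D (Icc 0 1)) :
    AEStronglyMeasurable (fun s => velocity Ω p q s (y s + D s) - velocity Ω p q s (y s) -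
      b s (D s)) (volume.restrict (Icc 0 1)) :=
  ((aestronglyMeasurable_velocity_comp hΩc hp hq measurableSet_Icc (hy.add hD)).sub
    (aestronglyMeasurable_velocity_comp hΩc hp hq measurableSet_Icc hy)).sub
    ((ContinuousLinearMap.id ℝ (EuclideanSpace ℝ (Fin d) →L[ℝ]
      EuclideanSpace ℝ (Fin d))).aestronglyMeasurable_comp₂ hbm
      (hD.aestronglyMeasurable measurableSet_Icc))

/-- The dominating bound for the convergence argument below; it needs no differentiability. -/
theorem norm_remainder_le (hρ : 0 < ρ)
    (hC : ∀ t ∈ Icc (0 : ℝ) 1, ∀ z ∈ core Ω ρ, ∀ z' ∈ core Ω ρ,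
      ‖velocity Ω p q t z - velocity Ω p q t z'‖ ≤ C * ‖z - z'‖)
    (hyK : ∀ t ∈ Icc (0 : ℝ) 1, y t ∈ core Ω (ρ + ρ))
    (hbC : ∀ s ∈ Icc (0 : ℝ) 1, ‖b s‖ ≤ C) {s : ℝ} (hs : s ∈ Icc (0 : ℝ) 1)
    {h : EuclideanSpace ℝ (Fin d)} (hh : ‖h‖ ≤ ρ) :
    ‖velocity Ω p q s (y s + h) - velocity Ω p q s (y s) - b s h‖ ≤ 2 * C * ‖h‖ := by
  have h1 : y s + h ∈ core Ω ρ := mem_core_of_norm_sub_le (hyK s hs) (by simpa using hh)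
  have h2 : y s ∈ core Ω ρ := core_anti (by linarith) (hyK s hs)
  have h3 := hC s hs _ h1 _ h2
  rw [add_sub_cancel_left] at h3
  have h4 := (b s).le_of_opNorm_le (hbC s hs) h
  refine (norm_sub_le _ _).trans ?_
  linarith

/-- The linearization of the velocity along a path, at the points where it is differentiable, is
uniform in the mean. -/
theorem exists_integral_remainder_le (hΩc : IsClosed Ω) (hp : Measurable p) (hq : Measurable q)
    (hρ : 0 < ρ)
    (hC : ∀ t ∈ Icc (0 : ℝ) 1, ∀ z ∈ core Ω ρ, ∀ z' ∈ core Ω ρ,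
      ‖velocity Ω p q t z - velocity Ω p q t z'‖ ≤ C * ‖z - z'‖)
    (hy : ContinuousOn y (Icc 0 1)) (hyK : ∀ t ∈ Icc (0 : ℝ) 1, y t ∈ core Ω (ρ + ρ))
    (hbm : AEStronglyMeasurable b (volume.restrict (Icc 0 1)))
    (hbC : ∀ s ∈ Icc (0 : ℝ) 1, ‖b s‖ ≤ C)
    (hd : ∀ᵐ s ∂(volume.restrict (Icc (0 : ℝ) 1)), HasFDerivAt (velocity Ω p q s) (b s) (y s))
    {ε : ℝ} (hε : 0 < ε) :
    ∃ η, 0 < η ∧ η ≤ ρ ∧ ∀ (D : ℝ → EuclideanSpace ℝ (Fin d)) (N : ℝ),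
      ContinuousOn D (Icc 0 1) → (∀ t ∈ Icc (0 : ℝ) 1, ‖D t‖ ≤ N) → N ≤ η →
      ∫ s in (0 : ℝ)..1,
        ‖velocity Ω p q s (y s + D s) - velocity Ω p q s (y s) - b s (D s)‖ ≤ ε * N := by
  -- Failure for every η produces displacements `D n` tending uniformly to 0 whose remainders,
  -- divided by the bounds `N n`, keep an integral above ε. These quotients are dominated by 2C and
  -- tend to 0 at each time of differentiability, a contradiction.
  by_contra hcon
  push Not at hcon
  have hex : ∀ n : ℕ, ∃ (D : ℝ → EuclideanSpace ℝ (Fin d)) (N : ℝ),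
      ContinuousOn D (Icc 0 1) ∧ (∀ t ∈ Icc (0 : ℝ) 1, ‖D t‖ ≤ N) ∧ N ≤ min ρ (1 / (n + 1)) ∧
      ε * N < ∫ s in (0 : ℝ)..1,
        ‖velocity Ω p q s (y s + D s) - velocity Ω p q s (y s) - b s (D s)‖ := fun n =>
    hcon (min ρ (1 / (n + 1))) (lt_min hρ (by positivity)) (min_le_left _ _)
  choose D N hDc hDN hN hlt using hex
  have h0 : (0 : ℝ) ∈ Icc (0 : ℝ) 1 := by simp
  have hC0 : 0 ≤ C := (norm_nonneg _).trans (hbC 0 h0)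
  have hNpos : ∀ n, 0 < N n := by
    intro n
    refine lt_of_le_of_ne ((norm_nonneg _).trans (hDN n 0 h0)) fun h => ?_
    have := hlt n
    rw [← h, mul_zero] at this
    have hz : ∫ s in (0 : ℝ)..1, ‖velocity Ω p q s (y s + D n s) - velocity Ω p q s (y s) -
        b s (D n s)‖ = ∫ s in (0 : ℝ)..1, (0 : ℝ) := by
      refine intervalIntegral.integral_congr fun s hs => ?_
      rw [uIcc_of_le zero_le_one] at hs
      have : D n s = 0 := norm_le_zero_iff.1 (h ▸ hDN n s hs)
      simp [this]
    rw [hz, intervalIntegral.integral_zero] at this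
    exact lt_irrefl _ this
  have hDρ : ∀ n, ∀ s ∈ Icc (0 : ℝ) 1, ‖D n s‖ ≤ ρ := fun n s hs =>
    (hDN n s hs).trans ((hN n).trans (min_le_left _ _))
  have hDlim : ∀ s ∈ Icc (0 : ℝ) 1, Tendsto (fun n => D n s) atTop (𝓝 0) := by
    intro s hs
    refine squeeze_zero_norm (fun n => (hDN n s hs).trans ((hN n).trans (min_le_right _ _))) ?_
    exact tendsto_one_div_add_atTop_nhds_zero_nat
  have hlim : Tendsto (fun n => ∫ s in (0 : ℝ)..1, (N n)⁻¹ *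
      ‖velocity Ω p q s (y s + D n s) - velocity Ω p q s (y s) - b s (D n s)‖) atTop
      (𝓝 (∫ s in (0 : ℝ)..1, (0 : ℝ))) := by
    have hIoc : ∀ {f : ℝ → EuclideanSpace ℝ (Fin d)},
        AEStronglyMeasurable f (volume.restrict (Icc 0 1)) →
        AEStronglyMeasurable f (volume.restrict (uIoc 0 1)) := fun h => by
      rw [uIoc_of_le zero_le_one]; exact h.mono_set Ioc_subset_Icc_self
    refine intervalIntegral.tendsto_integral_filter_of_dominated_convergence (fun _ => 2 * C)
      (Eventually.of_forall fun n => ?_) (Eventually.of_forall fun n => ?_) (by simp) ?_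
    · exact (hIoc (aestronglyMeasurable_remainder hΩc hp hq hy hbm (hDc n))).norm.const_mul _
    · refine Eventually.of_forall fun s hs => ?_
      rw [uIoc_of_le zero_le_one] at hs
      have hs' : s ∈ Icc (0 : ℝ) 1 := ⟨hs.1.le, hs.2⟩
      rw [norm_mul, norm_inv, Real.norm_of_nonneg (hNpos n).le, norm_norm,
        inv_mul_le_iff₀ (hNpos n), mul_comm (N n)]
      exact (norm_remainder_le hρ hC hyK hbC hs' (hDρ n s hs')).trans
        (mul_le_mul_of_nonneg_left (hDN n s hs') (by positivity))
    · rw [ae_restrict_iff' measurableSet_Icc] at hd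
      filter_upwards [hd] with s hs hsI
      rw [uIoc_of_le zero_le_one] at hsI
      have hs' : s ∈ Icc (0 : ℝ) 1 := ⟨hsI.1.le, hsI.2⟩
      have hlo := hasFDerivAt_iff_isLittleO_nhds_zero.1 (hs hs')
      rw [Metric.tendsto_nhds]
      intro c hc
      have h1 := (hDlim s hs').eventually (hlo.bound (half_pos hc))
      filter_upwards [h1] with n hn
      rw [Real.dist_eq, sub_zero, abs_of_nonneg (mul_nonneg (inv_nonneg.2 (hNpos n).le)
        (norm_nonneg _)), inv_mul_lt_iff₀ (hNpos n)]
      have h2 := mul_le_mul_of_nonneg_left (hDN n s hs') (half_pos hc).le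
      have h3 := mul_pos (hNpos n) hc
      linarith
  rw [intervalIntegral.integral_zero] at hlim
  refine absurd (ge_of_tendsto' hlim (b := ε) fun n => ?_) (not_le.2 hε)
  rw [intervalIntegral.integral_const_mul, le_inv_mul_iff₀ (hNpos n), mul_comm]
  exact (hlt n).le

/-- The error of the perturbed trajectory is, to first order, the solution of the linearized
equation. -/
theorem exists_linearization {p₀ p₁ : EuclideanSpace ℝ (Fin d) → ℝ} {m M L Δ : ℝ}
    {x : EuclideanSpace ℝ (Fin d)} (hΩk : IsCompact Ω)
    (hΩ : Convex ℝ Ω) (hne : (interior Ω).Nonempty) (hΔ : ∀ x ∈ Ω, ∀ y ∈ Ω, ‖x - y‖ ≤ Δ)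
    (hΔ0 : 0 ≤ Δ) (hp₀ : IsRegular Ω p₀ m M L) (hp₁ : IsRegular Ω p₁ m M L) (hρ : 0 < ρ)
    (hC0 : 0 ≤ C)
    (hC : ∀ t ∈ Icc (0 : ℝ) 1, ∀ z ∈ core Ω ρ, ∀ z' ∈ core Ω ρ,
      ‖velocity Ω p₀ p₁ t z - velocity Ω p₀ p₁ t z'‖ ≤ C * ‖z - z'‖)
    (hy : IsSolution Ω (velocity Ω p₀ p₁) x y)
    (hyK : ∀ t ∈ Icc (0 : ℝ) 1, y t ∈ core Ω (ρ + ρ))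
    (hbm : AEStronglyMeasurable b (volume.restrict (Icc 0 1)))
    (hbC : ∀ s ∈ Icc (0 : ℝ) 1, ‖b s‖ ≤ C)
    (hd : ∀ᵐ s ∂(volume.restrict (Icc (0 : ℝ) 1)), HasFDerivAt (velocity Ω p₀ p₁ s) (b s) (y s))
    {ε : ℝ} (hε : 0 < ε) :
    ∃ κ, 0 < κ ∧ ∀ q₀ q₁ : EuclideanSpace ℝ (Fin d) → ℝ, HasLinearModulus Ω q₀ q₁ →
      logRatioError Ω p₀ p₁ q₀ q₁ ≤ ENNReal.ofReal κ →
      scoreError Ω p₀ p₁ q₀ q₁ ≤ ENNReal.ofReal κ →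
      ∀ y' w : ℝ → EuclideanSpace ℝ (Fin d), IsSolution Ω (velocity Ω q₀ q₁) x y' →
      IsVolterraSolution b (fun s => velocity Ω q₀ q₁ s (y s) - velocity Ω p₀ p₁ s (y s)) w →
      ∀ S, (∀ t ∈ Icc (0 : ℝ) 1, ‖w t‖ ≤ S) →
      ∀ t ∈ Icc (0 : ℝ) 1, ‖y' t - y t - w t‖ ≤ ε * S := by
  have h01 : (0 : ℝ) ≤ 1 := zero_le_one
  have h0 : (0 : ℝ) ∈ Icc (0 : ℝ) 1 := by simp
  have hE : 0 < Real.exp C := Real.exp_pos C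
  have hexp : ∀ {c : ℝ}, 0 ≤ c → ∀ t ∈ Icc (0 : ℝ) 1,
      c * Real.exp (C * t) ≤ c * Real.exp C := fun hc t ht =>
    mul_le_mul_of_nonneg_left (Real.exp_le_exp.2 (mul_le_of_le_one_right hC0 ht.2)) hc
  -- The bound 1/2 lets sup ‖D‖ be absorbed, at the price of a factor 2; the bound ε/2 compensates
  -- for that factor.
  set θ := min (1 / 2) (ε / 2) with hθ
  have hθ0 : 0 < θ := lt_min (by norm_num) (half_pos hε)
  set ε' := θ / (2 * Real.exp C) with hε'
  have hε'0 : 0 < ε' := by positivity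
  obtain ⟨η, hη0, hηρ, hrem⟩ := exists_integral_remainder_le hΩk.isClosed hp₀.measurable
    hp₁.measurable hρ hC hy.continuousOn hyK hbm hbC hd hε'0
  obtain ⟨C₁, κ₀, hC₁, hκ₀, hclose⟩ := exists_velocity_sub_le_of_errors hΩk hΩ hne hΔ hΔ0 hp₀ hp₁ hρ
  -- The second entry bounds the Lipschitz constant C₁κ of the velocity error by ε'. The third puts
  -- the Grönwall bound C₁κ exp C strictly below η, the strictness being what continuous induction
  -- needs.
  set κ := min κ₀ (min (ε' / (C₁ + 1)) (η / (2 * (C₁ + 1) * Real.exp C))) with hκ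
  have hκ0 : 0 < κ := lt_min hκ₀ (lt_min (by positivity) (by positivity))
  have hκε : C₁ * κ ≤ ε' := by
    have h1 : κ ≤ ε' / (C₁ + 1) := (min_le_right _ _).trans (min_le_left _ _)
    rw [le_div_iff₀ (by positivity)] at h1
    linarith
  have hκη : C₁ * κ * Real.exp C < η := by
    have h1 : κ ≤ η / (2 * (C₁ + 1) * Real.exp C) := (min_le_right _ _).trans (min_le_right _ _)
    rw [le_div_iff₀ (by positivity)] at h1
    have h2 : 0 < κ * Real.exp C := by positivity
    have h3 : 0 ≤ C₁ * κ * Real.exp C := by positivity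
    nlinarith
  refine ⟨κ, hκ0, fun q₀ q₁ hq hr hs y' w hy' hw S hS => ?_⟩
  have hcl := hclose κ hκ0.le (min_le_left _ _) q₀ q₁ hq hr hs
  set v := velocity Ω p₀ p₁ with hv
  set v' := velocity Ω q₀ q₁ with hv'
  have hyc := hy.continuousOn
  have hyc' := hy'.continuousOn
  set D : ℝ → EuclideanSpace ℝ (Fin d) := fun t => y' t - y t with hDdef
  have hDc : ContinuousOn D (Icc 0 1) := hyc'.sub hyc
  have hDint : ∀ t ∈ Icc (0 : ℝ) 1, D t = ∫ s in (0 : ℝ)..t, (v' s (y' s) - v s (y s)) := by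
    intro t ht
    rw [intervalIntegral.integral_sub (intervalIntegrable_mono_Icc hy'.integrable h0 ht)
      (intervalIntegrable_mono_Icc hy.integrable h0 ht), hDdef]
    simp only
    rw [hy'.eq_integral t ht, hy.eq_integral t ht]
    abel
  have hyρ : ∀ s ∈ Icc (0 : ℝ) 1, y s ∈ core Ω ρ := fun s hs =>
    core_anti (by linarith) (hyK s hs)
  have hnear : ∀ s ∈ Icc (0 : ℝ) 1, ‖D s‖ ≤ η → y' s ∈ core Ω ρ := fun s hs h =>
    mem_core_of_norm_sub_le (hyK s hs) (h.trans hηρ)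
  -- the perturbed trajectory stays close to the original one
  have hDη : ∀ t ∈ Icc (0 : ℝ) 1, D t ∈ Metric.closedBall 0 η := by
    have hD0 : D 0 = 0 := by simpa using hDint 0 h0
    refine forall_mem_of_bootstrap hDc Metric.isClosed_closedBall (by simp [hD0, hη0.le])
      fun τ hτ _ hin => ?_
    have h1 : ‖D τ‖ ≤ C₁ * κ * Real.exp (C * τ) := by
      refine norm_le_mul_exp_of_eq_integral (T := τ) (ρ := fun _ => C₁ * κ) hC0
        (intervalIntegrable_mono_Icc (hy'.integrable.sub hy.integrable) h0 hτ)
        (fun t ht => hDint t ⟨ht.1, ht.2.trans hτ.2⟩) (by simp) (fun _ _ => by positivity) ?_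
        (fun s hs => ?_) τ ⟨hτ.1, le_rfl⟩
      · rw [intervalIntegral.integral_const, sub_zero, smul_eq_mul]
        exact mul_le_of_le_one_left (by positivity) hτ.2
      · have hs' : s ∈ Icc (0 : ℝ) 1 := ⟨hs.1, hs.2.trans hτ.2⟩
        have hy's := hnear s hs' (by simpa using hin s hs)
        have a1 := (hcl s hs' _ hy's).1
        have a2 := hC s hs' _ hy's _ (hyρ s hs')
        calc ‖v' s (y' s) - v s (y s)‖ = ‖(v' s (y' s) - v s (y' s)) + (v s (y' s) - v s (y s))‖ := by
              rw [sub_add_sub_cancel]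
          _ ≤ _ := (norm_add_le _ _).trans (add_le_add a1 a2)
    have h2 : ‖D τ‖ < η := (h1.trans (hexp (by positivity) τ hτ)).trans_lt hκη
    exact mem_of_superset (Metric.isOpen_ball.mem_nhds (by simpa using h2))
      Metric.ball_subset_closedBall
  have hDη' : ∀ t ∈ Icc (0 : ℝ) 1, ‖D t‖ ≤ η := fun t ht => by simpa using hDη t ht
  obtain ⟨t₀, ht₀, hmax⟩ := isCompact_Icc.exists_isMaxOn (nonempty_Icc.2 h01) hDc.norm
  set N := ‖D t₀‖ with hN
  have hDN : ∀ t ∈ Icc (0 : ℝ) 1, ‖D t‖ ≤ N := fun t ht => hmax ht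
  have hremN := hrem D N hDc hDN (hDη' t₀ ht₀)
  have hremi : IntervalIntegrable
      (fun s => ‖v s (y s + D s) - v s (y s) - b s (D s)‖) volume 0 1 := by
    refine (intervalIntegrable_of_bound (C := 2 * C * ρ) h01 (aestronglyMeasurable_remainder
      hΩk.isClosed hp₀.measurable hp₁.measurable hyc hbm hDc) fun s hs => ?_).norm
    exact (norm_remainder_le hρ hC hyK hbC hs ((hDη' s hs).trans hηρ)).trans
      (mul_le_mul_of_nonneg_left ((hDη' s hs).trans hηρ) (by positivity))
  have hW : ∀ t ∈ Icc (0 : ℝ) 1, ‖D t - w t‖ ≤ θ * N := by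
    intro t ht
    have h1 : ‖D t - w t‖ ≤ (2 * ε' * N) * Real.exp (C * t) := by
      refine norm_le_mul_exp_of_eq_integral (T := 1) (u := fun t => D t - w t)
        (k := fun s => (v' s (y' s) - v s (y s)) - ((v' s (y s) - v s (y s)) + b s (w s)))
        (ρ := fun s => C₁ * κ * N + ‖v s (y s + D s) - v s (y s) - b s (D s)‖) hC0
        ((hy'.integrable.sub hy.integrable).sub (hw.integrable_drift.add hw.integrable))
        (fun t ht => ?_) ((_root_.intervalIntegrable_const).add hremi)
        (fun _ _ => by positivity) ?_ (fun s hs => ?_) t ht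
      · have i1 := intervalIntegrable_mono_Icc (hy'.integrable.sub hy.integrable) h0 ht
        have i2 := intervalIntegrable_mono_Icc hw.integrable_drift h0 ht
        have i3 := intervalIntegrable_mono_Icc hw.integrable h0 ht
        rw [intervalIntegral.integral_sub i1 (i2.add i3), intervalIntegral.integral_add i2 i3,
          ← hDint t ht, ← hw.eq_integral t ht]
      · rw [intervalIntegral.integral_add _root_.intervalIntegrable_const hremi,
          intervalIntegral.integral_const, sub_zero, one_smul]
        have : C₁ * κ * N ≤ ε' * N := mul_le_mul_of_nonneg_right hκε (norm_nonneg _)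
        linarith
      · have hy's := hnear s hs (hDη' s hs)
        have a1 := (hcl s hs _ hy's).2 _ (hyρ s hs)
        have a2 : C₁ * κ * ‖y' s - y s‖ ≤ C₁ * κ * N :=
          mul_le_mul_of_nonneg_left (hDN s hs) (by positivity)
        have a3 := (b s).le_of_opNorm_le (hbC s hs) (D s - w s)
        have e1 : y s + D s = y' s := by simp [hDdef]
        -- Increment of the velocity error, remainder of the linearization, and the linear term that
        -- Grönwall's inequality removes.
        have e2 : (v' s (y' s) - v s (y s)) - ((v' s (y s) - v s (y s)) + b s (w s)) =
            ((v' s (y' s) - v s (y' s)) - (v' s (y s) - v s (y s))) +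
            (v s (y s + D s) - v s (y s) - b s (D s)) + b s (D s - w s) := by
          rw [e1, map_sub (b s) (D s)]; abel
        rw [e2]
        exact (norm_add_le _ _).trans (add_le_add ((norm_add_le _ _).trans
          (add_le_add (a1.trans a2) le_rfl)) a3)
    refine (h1.trans (hexp (by positivity) t ht)).trans (le_of_eq ?_)
    rw [hε']
    field_simp
  have hNS : N ≤ 2 * S := by
    have h1 := hW t₀ ht₀
    have h2 : N ≤ ‖D t₀ - w t₀‖ + ‖w t₀‖ := by
      have := norm_add_le (D t₀ - w t₀) (w t₀)
      rwa [sub_add_cancel] at this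
    have h3 : θ * N ≤ 1 / 2 * N := mul_le_mul_of_nonneg_right (min_le_left _ _) (norm_nonneg _)
    linarith [hS t₀ ht₀]
  intro t ht
  have h1 : θ * N ≤ ε / 2 * (2 * S) :=
    mul_le_mul (min_le_right _ _) hNS (norm_nonneg _) (half_pos hε).le
  exact (hW t ht).trans (h1.trans (le_of_eq (by ring)))

end Linearization

end RectifiedFlow

namespace RectifiedFlow

/-! ### Assembly of the theorem. -/

section Assembly

variable {d : ℕ} {Ω : Set (EuclideanSpace ℝ (Fin d))} {x : EuclideanSpace ℝ (Fin d)}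

theorem mem_interior_of_infDist_frontier_pos (hΩ : IsClosed Ω) (hx : x ∈ Ω)
    (h : 0 < Metric.infDist x (frontier Ω)) : x ∈ interior Ω := by
  by_contra hxi
  have : x ∈ frontier Ω := by rw [hΩ.frontier_eq]; exact ⟨hx, hxi⟩
  rw [Metric.infDist_zero_of_mem this] at h
  exact lt_irrefl _ h

theorem isSolution_flow {v : ℝ → EuclideanSpace ℝ (Fin d) → EuclideanSpace ℝ (Fin d)}
    (h : ∃ y, IsSolution Ω v x y) : IsSolution Ω v x (fun t => flow Ω v t x) := by
  have : (fun t => flow Ω v t x) = h.choose := by funext t; rw [flow, dif_pos h]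
  rw [this]
  exact h.choose_spec

theorem isVolterraSolution_volterraSolution
    {b : ℝ → EuclideanSpace ℝ (Fin d) →L[ℝ] EuclideanSpace ℝ (Fin d)}
    {a : ℝ → EuclideanSpace ℝ (Fin d)} (h : ∃ w, IsVolterraSolution b a w) :
    IsVolterraSolution b a (volterraSolution b a) := by
  rw [volterraSolution, dif_pos h]
  exact h.choose_spec

theorem IsVolterraSolution.continuousOn
    {b : ℝ → EuclideanSpace ℝ (Fin d) →L[ℝ] EuclideanSpace ℝ (Fin d)}
    {a w : ℝ → EuclideanSpace ℝ (Fin d)} (h : IsVolterraSolution b a w) :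
    ContinuousOn w (Icc 0 1) :=
  ((continuousOn_integral zero_le_one h.integrable_drift).add
    (continuousOn_integral zero_le_one h.integrable)).congr h.eq_integral

theorem IsRegular.congr {p p' : EuclideanSpace ℝ (Fin d) → ℝ} {m M L : ℝ}
    (h : IsRegular Ω p' m M L) (hp : Measurable p) (e : ∀ x ∈ Ω, p' x = p x) :
    IsRegular Ω p m M L :=
  ⟨hp, h.pos, h.nonneg, fun x hx => e x hx ▸ h.lower x hx, fun x hx => e x hx ▸ h.upper x hx,
    fun x hx y hy => e x hx ▸ e y hy ▸ h.lipschitz x hx y hy⟩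

/-- A solution that ends in the interior stays in a fixed core. -/
theorem IsSolution.exists_forall_mem_core
    {v : ℝ → EuclideanSpace ℝ (Fin d) → EuclideanSpace ℝ (Fin d)}
    {y : ℝ → EuclideanSpace ℝ (Fin d)} (hy : IsSolution Ω v x y) (h1 : y 1 ∈ interior Ω) :
    ∃ ρ > 0, ∀ t ∈ Icc (0 : ℝ) 1, y t ∈ core Ω ρ := by
  have hmem : ∀ t ∈ Icc (0 : ℝ) 1, y t ∈ interior Ω := fun t ht => by
    rcases ht.2.eq_or_lt with rfl | h
    · exact h1
    · exact hy.mem_interior t ⟨ht.1, h⟩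
  obtain ⟨ρ, hρ, hK⟩ := exists_subset_core
    (isCompact_Icc.image_of_continuousOn hy.continuousOn) (image_subset_iff.2 hmem)
  exact ⟨ρ, hρ, fun t ht => hK (mem_image_of_mem _ ht)⟩

theorem IsSolution.apply_one_mem {v : ℝ → EuclideanSpace ℝ (Fin d) → EuclideanSpace ℝ (Fin d)}
    {y : ℝ → EuclideanSpace ℝ (Fin d)} (hΩ : IsClosed Ω) (hy : IsSolution Ω v x y) : y 1 ∈ Ω := by
  have h1 : ContinuousWithinAt y (Ico 0 1) 1 :=
    (hy.continuousOn 1 (by simp)).mono Ico_subset_Icc_self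
  have hcl : (1 : ℝ) ∈ closure (Ico (0 : ℝ) 1) := by
    rw [closure_Ico (by norm_num)]; simp
  have := h1.mem_closure hcl (t := Ω) (fun t ht => interior_subset (hy.mem_interior t ht))
  rwa [hΩ.closure_eq] at this

/-- The drift of the linearized equation is bounded and integrable. -/
theorem intervalIntegrable_velocity_sub {p q p' q' : EuclideanSpace ℝ (Fin d) → ℝ}
    {m M L m' M' L' Δ : ℝ} {y : ℝ → EuclideanSpace ℝ (Fin d)} (hΩc : IsClosed Ω)
    (hΔ : ∀ x ∈ Ω, ∀ y ∈ Ω, ‖x - y‖ ≤ Δ)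
    (hp : IsRegular Ω p m M L) (hq : IsRegular Ω q m M L)
    (hp' : IsRegular Ω p' m' M' L') (hq' : IsRegular Ω q' m' M' L')
    (hy : ContinuousOn y (Icc 0 1)) (hyi : ∀ t ∈ Icc (0 : ℝ) 1, y t ∈ interior Ω) :
    IntervalIntegrable (fun s => velocity Ω p' q' s (y s) - velocity Ω p q s (y s)) volume 0 1 ∧
      ∀ s ∈ Icc (0 : ℝ) 1, ‖velocity Ω p' q' s (y s) - velocity Ω p q s (y s)‖ ≤ Δ + Δ := by
  have hb : ∀ s ∈ Icc (0 : ℝ) 1,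
      ‖velocity Ω p' q' s (y s) - velocity Ω p q s (y s)‖ ≤ Δ + Δ := fun s hs =>
    (norm_sub_le _ _).trans (add_le_add (norm_velocity_le hΩc hΔ hp' hq' hs (hyi s hs))
      (norm_velocity_le hΩc hΔ hp hq hs (hyi s hs)))
  refine ⟨intervalIntegrable_of_bound zero_le_one ?_ hb, hb⟩
  exact (aestronglyMeasurable_velocity_comp hΩc hp'.measurable hq'.measurable measurableSet_Icc
    hy).sub (aestronglyMeasurable_velocity_comp hΩc hp.measurable hq.measurable measurableSet_Icc hy)

end Assembly

end RectifiedFlow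

theorem mainTheorem9 {d : ℕ} {Ω : Set (EuclideanSpace ℝ (Fin d))}
    (hΩ_compact : IsCompact Ω) (hΩ_convex : Convex ℝ Ω) (hΩ_interior : (interior Ω).Nonempty)
    -- the densities, with a linear modulus of continuity
    {p₀ p₁ : EuclideanSpace ℝ (Fin d) → ℝ}
    (hp₀ : RectifiedFlow.IsDensityOn Ω p₀) (hp₁ : RectifiedFlow.IsDensityOn Ω p₁)
    (hp : RectifiedFlow.HasLinearModulus Ω p₀ p₁)
    -- the estimators of the densities, with a linear modulus of continuity with probability
    -- tending to one
    {Ξ : Type*} [MeasurableSpace Ξ] (P : Measure Ξ) [IsProbabilityMeasure P]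
    (phat₀ phat₁ : ℕ → Ξ → EuclideanSpace ℝ (Fin d) → ℝ)
    (hphat : Tendsto
      (fun n => P {ξ | ¬ RectifiedFlow.HasLinearModulus Ω (phat₀ n ξ) (phat₁ n ξ)}) atTop (𝓝 0))
    -- the velocity field and its estimator, the flow and its estimator
    (v : ℝ → EuclideanSpace ℝ (Fin d) → EuclideanSpace ℝ (Fin d))
    (hv : v = RectifiedFlow.velocity Ω p₀ p₁)
    (vhat : ℕ → Ξ → ℝ → EuclideanSpace ℝ (Fin d) → EuclideanSpace ℝ (Fin d))
    (hvhat : ∀ n ξ, vhat n ξ = RectifiedFlow.velocity Ω (phat₀ n ξ) (phat₁ n ξ))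
    (R : ℝ → EuclideanSpace ℝ (Fin d) → EuclideanSpace ℝ (Fin d))
    (hR : R = RectifiedFlow.flow Ω v)
    (Rhat : ℕ → Ξ → ℝ → EuclideanSpace ℝ (Fin d) → EuclideanSpace ℝ (Fin d))
    (hRhat : ∀ n ξ, Rhat n ξ = RectifiedFlow.flow Ω (vhat n ξ))
    -- the starting point
    (x : EuclideanSpace ℝ (Fin d))
    (hx : x ∈ RectifiedFlow.E₁ Ω ∩ RectifiedFlow.E₂ Ω v ∩ RectifiedFlow.E₄ Ω v)
    -- the derivative of `v` along the path, the drift, and the linearized error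
    (b : ℝ → EuclideanSpace ℝ (Fin d) →L[ℝ] EuclideanSpace ℝ (Fin d))
    (hb : ∀ s, b s = fderiv ℝ (v s) (R s x))
    (a : ℕ → Ξ → ℝ → EuclideanSpace ℝ (Fin d))
    (ha : ∀ n ξ s, a n ξ s = vhat n ξ s (R s x) - v s (R s x))
    (Etilde : ℕ → Ξ → ℝ → EuclideanSpace ℝ (Fin d))
    (hEtilde : ∀ n ξ, Etilde n ξ = RectifiedFlow.volterraSolution b (a n ξ)) :
    -- the flows are well defined
    (RectifiedFlow.IsSolution Ω v x (fun t => R t x) ∧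
      ∀ y, RectifiedFlow.IsSolution Ω v x y → EqOn y (fun t => R t x) (Icc 0 1)) ∧
    (∀ n ξ, RectifiedFlow.HasLinearModulus Ω (phat₀ n ξ) (phat₁ n ξ) →
      RectifiedFlow.IsSolution Ω (vhat n ξ) x (fun t => Rhat n ξ t x) ∧
      ∀ y, RectifiedFlow.IsSolution Ω (vhat n ξ) x y →
        EqOn y (fun t => Rhat n ξ t x) (Icc 0 1)) ∧
    -- differentiability of `v` along the path
    (∀ᵐ s ∂(volume.restrict (Icc (0 : ℝ) 1)), DifferentiableAt ℝ (v s) (R s x)) ∧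
    -- the fundamental matrix, and the linearized error expressed through it
    (∃ Φ : ℝ → EuclideanSpace ℝ (Fin d) →L[ℝ] EuclideanSpace ℝ (Fin d),
      RectifiedFlow.IsFundamentalSolution b Φ ∧
      (∀ Ψ, RectifiedFlow.IsFundamentalSolution b Ψ → EqOn Ψ Φ (Icc 0 1)) ∧
      (∀ t ∈ Icc (0 : ℝ) 1, IsUnit (Φ t)) ∧
      ∀ n ξ, RectifiedFlow.HasLinearModulus Ω (phat₀ n ξ) (phat₁ n ξ) →
        RectifiedFlow.IsVolterraSolution b (a n ξ) (Etilde n ξ) ∧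
        (∀ w, RectifiedFlow.IsVolterraSolution b (a n ξ) w → EqOn w (Etilde n ξ) (Icc 0 1)) ∧
        (IntervalIntegrable (fun s => Ring.inverse (Φ s) (a n ξ s)) volume 0 1 ∧
          ∀ t ∈ Icc (0 : ℝ) 1,
            Etilde n ξ t = Φ t (∫ s in (0 : ℝ)..t, Ring.inverse (Φ s) (a n ξ s)))) ∧
    -- the linearization
    (RectifiedFlow.IsLittleOP P
        (fun n ξ => RectifiedFlow.logRatioError Ω p₀ p₁ (phat₀ n ξ) (phat₁ n ξ) +
          RectifiedFlow.scoreError Ω p₀ p₁ (phat₀ n ξ) (phat₁ n ξ))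
        (fun _ _ => 1) →
      RectifiedFlow.IsLittleOP P
        (fun n ξ => ⨆ t ∈ Icc (0 : ℝ) 1, ‖Rhat n ξ t x - R t x - Etilde n ξ t‖ₑ)
        (fun n ξ => ⨆ t ∈ Icc (0 : ℝ) 1, ‖Etilde n ξ t‖ₑ)) := by
  have hΩc : IsClosed Ω := hΩ_compact.isClosed
  have hne : Ω.Nonempty := hΩ_interior.mono interior_subset
  obtain ⟨Δ, hΔ⟩ : ∃ Δ, ∀ x ∈ Ω, ∀ y ∈ Ω, ‖x - y‖ ≤ Δ := by
    obtain ⟨A, hA⟩ := hΩ_compact.isBounded.exists_norm_le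
    exact ⟨A + A, fun x hx y hy => (norm_sub_le _ _).trans (add_le_add (hA x hx) (hA y hy))⟩
  have hΔ0 : 0 ≤ Δ := by
    obtain ⟨w, hw⟩ := hne
    exact (norm_nonneg _).trans (hΔ w hw w hw)
  have hpos : ∀ {p : EuclideanSpace ℝ (Fin d) → ℝ}, RectifiedFlow.IsDensityOn Ω p →
      ∀ x ∈ Ω, 0 < p x := fun h x hx => by
    obtain ⟨c, hc, hcp⟩ := h.bounded_below
    exact hc.trans_le (hcp x hx)
  obtain ⟨p₀', p₁', m, M, L, hr₀, hr₁, -, e₀, e₁⟩ :=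
    hp.exists_isRegular hΩ_compact hΩ_convex hne
  replace hr₀ := hr₀.congr (hp₀.measurable hΩ_compact) (e₀ (hpos hp₀))
  replace hr₁ := hr₁.congr (hp₁.measurable hΩ_compact) (e₁ (hpos hp₁))
  obtain ⟨⟨hx₁, hx₂⟩, hx₄⟩ := hx
  have hxi : x ∈ interior Ω :=
    RectifiedFlow.mem_interior_of_infDist_frontier_pos hΩc hx₁.1 hx₁.2
  subst hv hR
  set y : ℝ → EuclideanSpace ℝ (Fin d) :=
    fun t => RectifiedFlow.flow Ω (RectifiedFlow.velocity Ω p₀ p₁) t x with hy_def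
  have hy : RectifiedFlow.IsSolution Ω (RectifiedFlow.velocity Ω p₀ p₁) x y :=
    RectifiedFlow.isSolution_flow
      (RectifiedFlow.exists_isSolution hΩc hΩ_convex hΔ hΔ0 hr₀ hr₁ hxi)
  have hy1 : y 1 ∈ interior Ω :=
    RectifiedFlow.mem_interior_of_infDist_frontier_pos hΩc (hy.apply_one_mem hΩc) hx₂.2
  obtain ⟨ρ', hρ', hyK'⟩ := hy.exists_forall_mem_core hy1
  -- Half of the margin is reserved for the perturbed path, the other half for the Lipschitz
  -- estimates there.
  obtain ⟨ρ, hρ, rfl⟩ : ∃ ρ > 0, ρ' = ρ + ρ := ⟨ρ' / 2, half_pos hρ', by ring⟩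
  have hyi : ∀ t ∈ Icc (0 : ℝ) 1, y t ∈ interior Ω := fun t ht =>
    RectifiedFlow.core_subset_interior hρ' (hyK' t ht)
  obtain ⟨C, hC0, hC⟩ :=
    RectifiedFlow.exists_lipschitz_velocity hΩc hΩ_convex hΔ hΔ0 hr₀ hr₁ hρ
  have hdiff : ∀ᵐ s ∂(volume.restrict (Icc (0 : ℝ) 1)),
      DifferentiableAt ℝ (RectifiedFlow.velocity Ω p₀ p₁ s) (y s) := by
    rw [ae_restrict_iff' measurableSet_Icc, ae_iff]
    refine measure_mono_null (fun t ht => ?_) hx₄.2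
    simp only [mem_ofPred_eq, Classical.not_imp] at ht
    exact ⟨ht.1, interior_subset (hyi t ht.1), ht.2⟩
  obtain rfl : b = fun s => fderiv ℝ (RectifiedFlow.velocity Ω p₀ p₁ s) (y s) := funext hb
  have hbm := RectifiedFlow.aestronglyMeasurable_fderiv_velocity hΩc hr₀.measurable hr₁.measurable
    hy.continuousOn hdiff
  -- This holds at every time, exceptional ones included, because `fderiv` is 0 where there is no
  -- derivative.
  have hbC : ∀ s ∈ Icc (0 : ℝ) 1,
      ‖fderiv ℝ (RectifiedFlow.velocity Ω p₀ p₁ s) (y s)‖ ≤ C := fun s hs =>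
    RectifiedFlow.norm_fderiv_le_of_core hρ hC0 (hyK' s hs) (hC s hs)
  obtain ⟨Φ, Ψ, hΦc, hΨc, hΦ, hΦΨ, hΨΦ⟩ := RectifiedFlow.exists_isFundamentalSolution hbm hbC
  have hinv : ∀ s ∈ Icc (0 : ℝ) 1, Ring.inverse (Φ s) = Ψ s := fun s hs =>
    Ring.inverse_unit ⟨Φ s, Ψ s, hΦΨ s hs, hΨΦ s hs⟩
  have haeq : ∀ n ξ, a n ξ = fun s => RectifiedFlow.velocity Ω (phat₀ n ξ) (phat₁ n ξ) s (y s) -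
      RectifiedFlow.velocity Ω p₀ p₁ s (y s) := fun n ξ => by
    funext s; rw [ha n ξ s, hvhat n ξ]
  have hflow : ∀ n ξ, RectifiedFlow.HasLinearModulus Ω (phat₀ n ξ) (phat₁ n ξ) →
      RectifiedFlow.IsSolution Ω (vhat n ξ) x (fun t => Rhat n ξ t x) ∧
      ∀ y, RectifiedFlow.IsSolution Ω (vhat n ξ) x y →
        EqOn y (fun t => Rhat n ξ t x) (Icc 0 1) := by
    intro n ξ hG
    obtain ⟨q₀, q₁, m', M', L', hq₀, hq₁, hvel, -, -⟩ :=
      hG.exists_isRegular hΩ_compact hΩ_convex hne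
    rw [hRhat n ξ, hvhat n ξ, hvel]
    have hsol := RectifiedFlow.isSolution_flow
      (RectifiedFlow.exists_isSolution hΩc hΩ_convex hΔ hΔ0 hq₀ hq₁ hxi)
    exact ⟨hsol, fun y' hy' => hy'.eqOn hΩc hΩ_convex hΔ hΔ0 hq₀ hq₁ hsol⟩
  have hlin : ∀ n ξ, RectifiedFlow.HasLinearModulus Ω (phat₀ n ξ) (phat₁ n ξ) →
      IntervalIntegrable (fun s => Ψ s (a n ξ s)) volume 0 1 ∧
      RectifiedFlow.IsVolterraSolution
        (fun s => fderiv ℝ (RectifiedFlow.velocity Ω p₀ p₁ s) (y s)) (a n ξ)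
        (fun t => Φ t (∫ s in (0 : ℝ)..t, Ψ s (a n ξ s))) ∧
      RectifiedFlow.IsVolterraSolution
        (fun s => fderiv ℝ (RectifiedFlow.velocity Ω p₀ p₁ s) (y s)) (a n ξ) (Etilde n ξ) := by
    intro n ξ hG
    obtain ⟨q₀, q₁, m', M', L', hq₀, hq₁, hvel, -, -⟩ :=
      hG.exists_isRegular hΩ_compact hΩ_convex hne
    obtain ⟨hai, hab⟩ := RectifiedFlow.intervalIntegrable_velocity_sub hΩc hΔ hr₀ hr₁ hq₀ hq₁
      hy.continuousOn hyi
    rw [← hvel, ← haeq n ξ] at hai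
    obtain ⟨h1, h2⟩ := hΦ.isVolterraSolution hbC hΦc hΨc hΦΨ hai
      (fun s hs => by rw [haeq n ξ, hvel]; exact hab s hs)
    refine ⟨h1, h2, ?_⟩
    rw [hEtilde n ξ]
    exact RectifiedFlow.isVolterraSolution_volterraSolution ⟨_, h2⟩
  refine ⟨⟨hy, fun y' hy' => hy'.eqOn hΩc hΩ_convex hΔ hΔ0 hr₀ hr₁ hy⟩, hflow, hdiff,
    ⟨Φ, hΦ, fun Ψ' hΨ' => hΨ'.eqOn hbC hΦ, fun t ht =>
      ⟨⟨Φ t, Ψ t, hΦΨ t ht, hΨΦ t ht⟩, rfl⟩, fun n ξ hG => ?_⟩, fun hrs => ?_⟩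
  · obtain ⟨h1, h2, h3⟩ := hlin n ξ hG
    refine ⟨h3, fun w hw => hw.eqOn hbC h3, ?_, fun t ht => ?_⟩
    · refine h1.congr fun s hs => ?_
      rw [uIoc_of_le zero_le_one] at hs
      simp only [hinv s ⟨hs.1.le, hs.2⟩]
    · rw [h3.eqOn hbC h2 ht]
      refine congrArg (Φ t) (intervalIntegral.integral_congr fun s hs => ?_)
      rw [uIcc_of_le ht.1] at hs
      simp only [hinv s ⟨hs.1, hs.2.trans ht.2⟩]
  · intro ε hε
    obtain ⟨κ, hκ, hκlin⟩ := RectifiedFlow.exists_linearization hΩ_compact hΩ_convex hΩ_interior hΔ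
      hΔ0 hr₀ hr₁ hρ hC0 hC hy hyK' hbm hbC
      (by filter_upwards [hdiff] with s hs using hs.hasFDerivAt) hε
    -- The event of a large linearization error lies in the union of the complement of G_n and the
    -- event r_n + s_n > κ, both of vanishing probability. Outer measure is monotone and
    -- subadditive, so no measurability of the events is needed.
    have hsum := (hphat.add (hrs κ hκ))
    rw [add_zero] at hsum
    refine tendsto_of_tendsto_of_tendsto_of_le_of_le tendsto_const_nhds hsum
      (fun n => zero_le) fun n => (measure_mono fun ξ hξ => ?_).trans (measure_union_le _ _)
    by_contra hcon
    simp only [mem_union, mem_ofPred_eq, not_or, not_not, not_lt, mul_one] at hcon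
    obtain ⟨hG, hsmall⟩ := hcon
    rw [mem_ofPred_eq] at hξ
    refine hξ.not_ge ?_
    obtain ⟨h1, h2, h3⟩ := hlin n ξ hG
    -- The supremum of the linearized error is attained, which turns the extended-valued supremum
    -- into the real bound `S` of the deterministic estimate.
    obtain ⟨t₁, ht₁, hmax⟩ := isCompact_Icc.exists_isMaxOn
      (nonempty_Icc.2 (zero_le_one (α := ℝ))) h3.continuousOn.norm
    have hsol := (hflow n ξ hG).1
    rw [hvhat n ξ] at hsol
    rw [haeq n ξ] at h3
    have key := hκlin (phat₀ n ξ) (phat₁ n ξ) hG (le_self_add.trans hsmall)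
      (le_add_self.trans hsmall) _ _ hsol h3 ‖Etilde n ξ t₁‖ (fun t ht => hmax ht)
    refine iSup₂_le fun t ht => ?_
    calc ‖Rhat n ξ t x - y t - Etilde n ξ t‖ₑ ≤ ENNReal.ofReal (ε * ‖Etilde n ξ t₁‖) := by
          rw [← ofReal_norm]; exact ENNReal.ofReal_le_ofReal (key t ht)
      _ = ENNReal.ofReal ε * ‖Etilde n ξ t₁‖ₑ := by
          rw [ENNReal.ofReal_mul hε.le, ofReal_norm]
      _ ≤ _ := by
          gcongr
          exact le_iSup₂_of_le (f := fun t (_ : t ∈ Icc (0 : ℝ) 1) => ‖Etilde n ξ t‖ₑ) t₁ ht₁ le_rfl
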